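/- Let $\Sigma$ be the set of real antisymmetric $4\times4$ tensors $Q=(Q^{\mu\nu})_{\mu,\nu=0,\dots,3}$ whose electric and magnetic components $e_j=Q^{0j}$, $m_l=\tfrac12\varepsilon_{ljk}Q^{jk}$ ($j,k,l=1,2,3$) fulfil the quantum conditions $\vec e^{\,2}=\vec m^2$, $\vec e\cdot\vec m=\pm1$. Consider three independent events of quantum spacetime in Planck units, i.e. any nondegenerate representation, on a Hilbert space $\mathcal H$, of the threefold tensor power over $\mathcal Z=C_b(\Sigma)$ of the C*-algebra of quantum spacetime. Explicitly: a representation of $C_b(\Sigma)$ on $\mathcal H$ that is nondegenerate on $C_0(\Sigma)$ (so that real continuous functions on $\Sigma$, in particular $Q^{\mu\nu}, e_j, m_l,\vec e^{\,2},\vec m^2$, become selfadjoint operators), and strongly continuous unitaries $W(\alpha)$, $\alpha=(\alpha_{a\mu})\in\mathbb R^{3\times4}$, which commute with it and satisfy \[ W(\alpha)W(\beta)=e^{-\frac i2\sum_a\alpha_{a\mu}Q^{\mu\nu}\beta_{a\nu}}\,W(\alpha+\beta). \] Let $q_a^\mu$ ($a=1,2,3$) be the selfadjoint coordinates defined by $W(\alpha)=e^{i\sum_a\alpha_{a\mu}q_a^\mu}$;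 thus $[q_a^\mu,q_b^\nu]=i\delta_{ab}Q^{\mu\nu}$. As operators of three events put \[ dq^\mu dq^\nu=(q_2^\mu-q_1^\mu)(q_3^\nu-q_2^\nu),\qquad dq^\mu\wedge dq^\nu=dq^\mu dq^\nu-dq^\nu dq^\mu , \] where $dq^\mu\wedge dq^\nu$ denotes the closure of the operator on the natural domain, and let $A^{\mu\nu}$ be the closure of $(q_2^\mu q_3^\nu-q_1^\mu q_3^\nu+q_1^\mu q_2^\nu)-(q_2^\nu q_3^\mu-q_1^\nu q_3^\mu+q_1^\nu q_2^\mu)$ on its natural domain. Let $N_l=\varepsilon_{ljk}dq^jdq^k$ (i.e. $N_l=dq^j\wedge dq^k$ with $(l,j,k)$ cyclic) be the space-space area components and $M_j=dq^j\wedge dq^0$ the space-time area components. Then: 1. For each $l$, $A_l:=A^{jk}$ ($(l,j,k)$ cyclic) and $m_l$ are selfadjoint, $N_l=A_l-i\,m_l$, and $N_l$ is normal. For each $j$, $A^{j0}$ and $e_j$ are selfadjoint, $M_j=A^{j0}+i\,e_j$, and $M_j$ is normal. 2. $\sum_{l=1}^3N_l^*N_l\ge\vec m^2\ge I$ and $\sum_{j=1}^3M_j^*M_j\ge\vec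 e^{\,2}\ge I$. Here $X\ge Y$ means that the domain of $X$ is contained in that of $Y$ and $\langle\psi,X\psi\rangle\ge\langle\psi,Y\psi\rangle$ on it. 3. The space-space area operator $\bigl(\sum_lN_l^*N_l\bigr)^{1/2}$ and the space-time area operator $\bigl(\sum_jM_j^*M_j\bigr)^{1/2}$, the sums under the roots being taken in the sense of quadratic forms, exist as nonnegative selfadjoint operators and are unique: the first is the only nonnegative selfadjoint operator $S$ with domain $\bigcap_lD(N_l)$ and $\|S\psi\|^2=\sum_l\|N_l\psi\|^2$ there, and likewise for the second with $M_j$. Their squares extend the operator sums in 2 and are $\ge\vec m^2$, respectively $\ge\vec e^{\,2}$. Both area operators are $\ge I$. -/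

import Mathlib

noncomputable section

namespace QST

/-! ### Unbounded operators -/

section Operators

variable {H : Type*} [NormedAddCommGroup H] [InnerProductSpace ℂ H]

/-- The product `S T` of two unbounded operators, on its natural domain
`{x ∈ D(T) | T x ∈ D(S)}`. -/
def opMul (S T : H →ₗ.[ℂ] H) : H →ₗ.[ℂ] H where
  domain :=
    { carrier := {x | ∃ h : x ∈ T.domain, T ⟨x, h⟩ ∈ S.domain}
      add_mem' := by
        rintro x y ⟨hx, hx'⟩ ⟨hy, hy'⟩
        refine ⟨T.domain.add_mem hx hy, ?_⟩
        have := T.map_add ⟨x, hx⟩ ⟨y, hy⟩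
        rw [AddMemClass.mk_add_mk] at this
        rw [this]
        exact S.domain.add_mem hx' hy'
      zero_mem' := ⟨T.domain.zero_mem, by
        have h0 : (⟨0, T.domain.zero_mem⟩ : T.domain) = 0 := rfl
        rw [h0, T.map_zero]
        exact S.domain.zero_mem⟩
      smul_mem' := by
        rintro c x ⟨hx, hx'⟩
        refine ⟨T.domain.smul_mem c hx, ?_⟩
        have := T.map_smul c ⟨x, hx⟩
        rw [SetLike.mk_smul_mk] at this
        rw [this]
        exact S.domain.smul_mem c hx' }
  toFun :=
    { toFun := fun x => S ⟨T ⟨x.1, x.2.1⟩, x.2.2⟩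
      map_add' := by
        rintro ⟨x, hx, hx'⟩ ⟨y, hy, hy'⟩
        rw [← S.map_add]
        congr 1
        exact Subtype.ext (T.map_add ⟨x, hx⟩ ⟨y, hy⟩)
      map_smul' := by
        rintro c ⟨x, hx, hx'⟩
        rw [RingHom.id_apply, ← S.map_smul]
        congr 1
        exact Subtype.ext (T.map_smul c ⟨x, hx⟩) }

/-- The generator `X` of a family `U t = e^{i t X}`: `X ψ = -i (d/dt) U t ψ` at `t = 0`, on the
domain of all `ψ` for which this derivative exists. For a strongly continuous unitary group this is
the selfadjoint operator of Stone's theorem. -/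
def generator (U : ℝ → H →L[ℂ] H) : H →ₗ.[ℂ] H where
  domain :=
    { carrier := {ψ | DifferentiableAt ℝ (fun t => U t ψ) 0}
      add_mem' := by
        intro x y hx hy
        have := DifferentiableAt.add hx hy
        simpa [Pi.add_def] using this
      zero_mem' := by simp
      smul_mem' := by
        intro c x hx
        have := DifferentiableAt.const_smul hx c
        simpa [Pi.smul_def] using this }
  toFun :=
    { toFun := fun ψ => (-Complex.I) • deriv (fun t => U t ψ.1) 0
      map_add' := by
        rintro ⟨x, hx⟩ ⟨y, hy⟩
        have := deriv_add (𝕜 := ℝ) hx hy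
        rw [← smul_add, ← this]
        simp [Pi.add_def]
      map_smul' := by
        rintro c ⟨x, hx⟩
        have := deriv_const_smul (𝕜 := ℝ) c hx
        rw [RingHom.id_apply, smul_comm c, ← this]
        simp [Pi.smul_def] }

/-- The inequality `X ≤ Y` of symmetric operators, tested on the domain of `Y`. -/
def OpLE (X Y : H →ₗ.[ℂ] H) : Prop :=
  ∃ h : Y.domain ≤ X.domain, ∀ ψ : Y.domain,
    (inner ℂ (ψ : H) (X ⟨ψ, h ψ.2⟩)).re ≤ (inner ℂ (ψ : H) (Y ψ)).re

/-- The unit operator, everywhere defined. -/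
def opOne : H →ₗ.[ℂ] H := (LinearMap.id : H →ₗ[ℂ] H).toPMap ⊤

variable [CompleteSpace H]

/-- A normal operator: closed, densely defined, with `N† N = N N†` (equality of domains
included). -/
structure IsNormalOp (N : H →ₗ.[ℂ] H) : Prop where
  dense : Dense (N.domain : Set H)
  closed : N.IsClosed
  comm : opMul N.adjoint N = opMul N N.adjoint

/-- The sum of the square moduli `∑ l, N l† N l`, on its natural domain. -/
def sumSqModuli (N : Fin 3 → H →ₗ.[ℂ] H) : H →ₗ.[ℂ] H :=
  ∑ l, opMul (N l).adjoint (N l)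

/-- `S` is the square root of the sum of the square moduli of the `N l`: the nonnegative
selfadjoint operator whose square is that sum, where the sum of the (in general unbounded)
operators `N l† N l` is taken in the sense of quadratic forms. That is, the form `ψ ↦ ‖S ψ‖²` of
`S²` is `∑ l, ‖N l ψ‖²`, with domain the intersection of the domains of the `N l`. -/
structure IsSqrtSumSqModuli (N : Fin 3 → H →ₗ.[ℂ] H) (S : H →ₗ.[ℂ] H) : Prop where
  selfAdjoint : IsSelfAdjoint S
  nonneg : OpLE 0 S
  domain_iff : ∀ ψ : H, ψ ∈ S.domain ↔ ∀ l, ψ ∈ (N l).domain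
  norm_sq : ∀ (ψ : S.domain) (h : ∀ l, (ψ : H) ∈ (N l).domain),
    ‖S ψ‖ ^ 2 = ∑ l, ‖N l ⟨ψ, h l⟩‖ ^ 2

end Operators

/-! ### The joint spectrum of the commutators -/

/-- The electric components `e_j = Q^{0j}` of a two-tensor. -/
def elec (Q : Matrix (Fin 4) (Fin 4) ℝ) (j : Fin 3) : ℝ := Q 0 j.succ

/-- The magnetic components `m_l = (1/2) ε_{ljk} Q^{jk}` of an antisymmetric two-tensor, that is
`m_1 = Q^{23}`, `m_2 = Q^{31}`, `m_3 = Q^{12}` (the addition in `Fin 3` is cyclic). -/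
def magn (Q : Matrix (Fin 4) (Fin 4) ℝ) (l : Fin 3) : ℝ := Q (l + 1).succ (l + 2).succ

/-- The manifold `Σ` of real antisymmetric two-tensors that fulfil the quantum conditions
`e² = m²`, `e · m = ± 1`. -/
def SigmaSet : Set (Matrix (Fin 4) (Fin 4) ℝ) :=
  {Q | Q.transpose = -Q ∧ ∑ j, elec Q j ^ 2 = ∑ j, magn Q j ^ 2 ∧
    (∑ j, elec Q j * magn Q j = 1 ∨ ∑ j, elec Q j * magn Q j = -1)}

/-- `Σ` as a topological space. -/
abbrev Sig : Type := SigmaSet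

/-- The coordinate function `Q^{μν}` on `Σ`. -/
def coordQ (μ ν : Fin 4) : C(Sig, ℝ) where
  toFun Q := Q.1 μ ν
  continuous_toFun := continuous_subtype_val.matrix_elem μ ν

/-- The function `e_j` on `Σ`. -/
def elecFun (j : Fin 3) : C(Sig, ℝ) := coordQ 0 j.succ

/-- The function `m_l` on `Σ`. -/
def magnFun (l : Fin 3) : C(Sig, ℝ) := coordQ (l + 1).succ (l + 2).succ

/-- The bounded continuous function `e^{i g}` on `Σ`. -/
def expI (g : C(Sig, ℝ)) : BoundedContinuousFunction Sig ℂ :=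
  BoundedContinuousFunction.ofNormedAddCommGroup
    (fun σ => Complex.exp ((g σ : ℂ) * Complex.I)) (by fun_prop) 1
    (fun σ => (Complex.norm_exp_ofReal_mul_I (g σ)).le)

/-- The function `∑_a α_{aμ} Q^{μν} β_{aν}` on `Σ`. -/
def sympl {n : ℕ} (α β : Fin n → Fin 4 → ℝ) : C(Sig, ℝ) :=
  ∑ a, ∑ μ, ∑ ν, (α a μ * β a ν) • coordQ μ ν

/-! ### Quantum spacetime: `n` independent events -/

/-- A nondegenerate representation, on a Hilbert space `H`, of the C*-algebra
`ℰ ⊗ ⋯ ⊗ ℰ` (`n` factors, tensor product over the centre `𝒵 = C_b(Σ)` of the multiplier algebra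
of `ℰ`) of `n` independent events of quantum spacetime. As `ℰ` is the enveloping C*-algebra of the
Weyl relations with central commutators whose joint spectrum lies in `Σ`, such a representation is
a pair of

* a strongly continuous family of unitaries `W α = exp (i ∑_a α_{aμ} q_a^μ)`,
* a representation `Z` of `𝒵 = C_b(Σ)` that is nondegenerate on the functions of compact support,
  hence on `C_0(Σ)`,

which commute and fulfil `W α W β = exp (-(i/2) ∑_a α_{aμ} Q^{μν} β_{aν}) W (α + β)`. The same
central tensor `Q` occurs for each event: `[q_a^μ, q_b^ν] = i δ_{ab} Q^{μν}`. -/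
structure EventRep (n : ℕ) (H : Type*) [NormedAddCommGroup H] [InnerProductSpace ℂ H]
    [CompleteSpace H] where
  W : (Fin n → Fin 4 → ℝ) → H →L[ℂ] H
  Z : BoundedContinuousFunction Sig ℂ →⋆ₐ[ℂ] (H →L[ℂ] H)
  W_unitary : ∀ α, W α ∈ unitary (H →L[ℂ] H)
  W_continuous : ∀ ψ : H, Continuous fun α => W α ψ
  Z_nondegenerate : Dense (Submodule.span ℂ
    {φ : H | ∃ (f : BoundedContinuousFunction Sig ℂ) (ψ : H),
      HasCompactSupport f ∧ Z f ψ = φ} : Set H)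
  W_comm_Z : ∀ α f, W α * Z f = Z f * W α
  weyl : ∀ α β, W α * W β = Z (expI ((-(1 / 2) : ℝ) • sympl α β)) * W (α + β)

namespace EventRep

variable {n : ℕ} {H : Type*} [NormedAddCommGroup H] [InnerProductSpace ℂ H] [CompleteSpace H]

/-- The coordinate `q_a^μ` of the `a`-th event. -/
def q (ρ : EventRep n H) (a : Fin n) (μ : Fin 4) : H →ₗ.[ℂ] H :=
  generator fun t => ρ.W (t • Pi.single a (Pi.single μ 1))

/-- The (in general unbounded) central operator `g(Q)` given by a real continuous function `g`
on `Σ`, that is the generator of `t ↦ e^{i t g}(Q)`. -/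
def centralOp (ρ : EventRep n H) (g : C(Sig, ℝ)) : H →ₗ.[ℂ] H :=
  generator fun t => ρ.Z (expI (t • g))

/-- The central operator `m_l`. -/
def m (ρ : EventRep n H) (l : Fin 3) : H →ₗ.[ℂ] H := ρ.centralOp (magnFun l)

/-- The central operator `e_j`. -/
def e (ρ : EventRep n H) (j : Fin 3) : H →ₗ.[ℂ] H := ρ.centralOp (elecFun j)

/-- The central operator `m² = m_1² + m_2² + m_3²`. -/
def mSq (ρ : EventRep n H) : H →ₗ.[ℂ] H := ρ.centralOp (∑ l, magnFun l ^ 2)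

/-- The central operator `e² = e_1² + e_2² + e_3²`. -/
def eSq (ρ : EventRep n H) : H →ₗ.[ℂ] H := ρ.centralOp (∑ j, elecFun j ^ 2)

/-- The product `dq^μ dq^ν` of the differentials `dq = I ⊗ q - q ⊗ I` in the universal
differential algebra, as an operator of three events. The product there merges the last tensor
factor of `dq^μ` with the first one of `dq^ν`, so it is
`(I ⊗ q^μ ⊗ I - q^μ ⊗ I ⊗ I) (I ⊗ I ⊗ q^ν - I ⊗ q^ν ⊗ I)`. -/
def dqdq (ρ : EventRep 3 H) (μ ν : Fin 4) : H →ₗ.[ℂ] H :=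
  opMul (ρ.q 1 μ - ρ.q 0 μ) (ρ.q 2 ν - ρ.q 1 ν)

/-- `dq^μ ∧ dq^ν = dq^μ dq^ν - dq^ν dq^μ`, as a closed operator. -/
def dqWedge (ρ : EventRep 3 H) (μ ν : Fin 4) : H →ₗ.[ℂ] H :=
  (ρ.dqdq μ ν - ρ.dqdq ν μ).closure

/-- `I ⊗ q^μ ⊗ q^ν - q^μ ⊗ I ⊗ q^ν + q^μ ⊗ q^ν ⊗ I`. -/
def qq (ρ : EventRep 3 H) (μ ν : Fin 4) : H →ₗ.[ℂ] H :=
  opMul (ρ.q 1 μ) (ρ.q 2 ν) - opMul (ρ.q 0 μ) (ρ.q 2 ν) + opMul (ρ.q 0 μ) (ρ.q 1 ν)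

/-- The antisymmetrization of `I ⊗ q^μ ⊗ q^ν - q^μ ⊗ I ⊗ q^ν + q^μ ⊗ q^ν ⊗ I` in `μ, ν`, as a
closed operator. -/
def qqWedge (ρ : EventRep 3 H) (μ ν : Fin 4) : H →ₗ.[ℂ] H :=
  (ρ.qq μ ν - ρ.qq ν μ).closure

/-- The space-space area component `ε_{ljk} dq^j dq^k` (summed over `j, k`), that is
`dq^j ∧ dq^k` for `(l, j, k)` a cyclic permutation of `(1, 2, 3)`. -/
def spaceArea (ρ : EventRep 3 H) (l : Fin 3) : H →ₗ.[ℂ] H :=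
  ρ.dqWedge (l + 1).succ (l + 2).succ

/-- `ε_{ljk} (I ⊗ q^j ⊗ q^k - q^j ⊗ I ⊗ q^k + q^j ⊗ q^k ⊗ I)`. -/
def spaceAreaRe (ρ : EventRep 3 H) (l : Fin 3) : H →ₗ.[ℂ] H :=
  ρ.qqWedge (l + 1).succ (l + 2).succ

/-- The space-time area component `dq^j ∧ dq^0`. -/
def timeArea (ρ : EventRep 3 H) (j : Fin 3) : H →ₗ.[ℂ] H := ρ.dqWedge j.succ 0

/-- `I ⊗ q^j ⊗ q^0 - q^j ⊗ I ⊗ q^0 + q^j ⊗ q^0 ⊗ I` minus the same with `j` and `0`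
interchanged. -/
def timeAreaRe (ρ : EventRep 3 H) (j : Fin 3) : H →ₗ.[ℂ] H := ρ.qqWedge j.succ 0

end EventRep

end QST

end

/-! ### Graphs, mollified operators, and normality of `A - i Q`. -/

noncomputable section

namespace QST

open Filter Topology

section Graph

variable {H : Type*} [NormedAddCommGroup H] [InnerProductSpace ℂ H]

/-! ### Graphs of unbounded operators -/

/-! Formally the theorem is a short computation. In the antisymmetrization of `(q_2 - q_1)^μ (q_3 -
q_2)^ν` the only terms not already in `A^{μν}` come from `-q_2^μ q_2^ν`, and they add up to
`-[q_2^μ, q_2^ν] = -i Q^{μν}`. So a component is `A - i Q` with `A` symmetric and `Q` central,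
whence `‖(A - i Q)ψ‖² = ‖Aψ‖² + ‖Qψ‖² ≥ ‖Qψ‖²`. Summing gives the bounds by `m²` and `e²`, and
Cauchy-Schwarz with `(e·m)² = 1`, `e² = m²` makes these at least `1`. The work lies in the domains.

Essential selfadjointness. Suppose symmetric bounded `T n → 1` map into the domain of `A`, and `T n
A ⊆ A T n` with `A T n` bounded. Then the closure of `A` and its adjoint are described by explicit
bounded equations (`Mollified`), and symmetry of `A T n` gives selfadjointness. Such `T n` are
obtained by integrating Weyl operators over the Heisenberg group of three events in the directions
`μ, ν` against a function of the Euclidean norm. The reason they commute with `A^{μν}` is that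
`A^{μν}` is a combination of the angular momenta `q_a^μ q_b^ν - q_a^ν q_b^μ` with `a ≠ b`, whose
adjoint action rotates the event index and leaves radial functions fixed. Concretely, multiplying `T
n` by coordinates on the left or on the right applies left or right vector fields to the kernel, and
both sides give the same kernel (`wedgeKer_eq`). The same `T n` mollify `Q` and `dq^μ ∧ dq^ν`, so
the three closures can be compared: `closure_eq_sub_and_isNormalOp` yields the decomposition, the
adjoint `A + i Q`, and normality.

Square roots. The joint graph of the three components is a Hilbert space; if `J` is its projection
to `H`, then `R = J J*` is the resolvent `(1 + ∑ N†N)⁻¹` of the form sum (`exists_form_resolvent`).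
The operator with graph `{(R^{1/2} x, (1 - R)^{1/2} x)}` is the root, and every root is recovered
from `R`, which gives uniqueness.

Operator inequalities. That the domain of `S²` lies in that of `m²` does not follow from the form
inequality alone. It uses that the components commute with functions of `Q`: inserting cutoff
functions of `Q` gives `‖m² k(Q) ψ‖ ≤ ‖k(Q) S² ψ‖` (`norm_zr_sumSq_mul_le`), and the cutoffs are
then removed. The statement for the operator sum follows because `S²` extends it. -/

theorem mem_graph_mk {A : H →ₗ.[ℂ] H} {ψ : H} (h : ψ ∈ A.domain) : (ψ, A ⟨ψ, h⟩) ∈ A.graph :=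
  A.mem_graph ⟨ψ, h⟩

theorem apply_eq_of_mem_graph {A : H →ₗ.[ℂ] H} {ψ φ : H} (h : (ψ, φ) ∈ A.graph)
    (h' : ψ ∈ A.domain) : A ⟨ψ, h'⟩ = φ :=
  A.mem_graph_snd_inj (mem_graph_mk h') h rfl

theorem graph_unique {A : H →ₗ.[ℂ] H} {ψ φ φ' : H} (h : (ψ, φ) ∈ A.graph)
    (h' : (ψ, φ') ∈ A.graph) : φ = φ' :=
  A.mem_graph_snd_inj h h' rfl

theorem mem_graph_add {A B : H →ₗ.[ℂ] H} {ψ φ : H} :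
    (ψ, φ) ∈ (A + B).graph ↔ ∃ a b, (ψ, a) ∈ A.graph ∧ (ψ, b) ∈ B.graph ∧ φ = a + b := by
  constructor
  · rw [LinearPMap.mem_graph_iff]
    rintro ⟨⟨x, hx⟩, rfl, h⟩
    exact ⟨_, _, mem_graph_mk hx.1, mem_graph_mk hx.2, h.symm⟩
  · rintro ⟨a, b, ha, hb, rfl⟩
    have hx : ψ ∈ (A + B).domain :=
      ⟨LinearPMap.mem_domain_of_mem_graph ha, LinearPMap.mem_domain_of_mem_graph hb⟩
    rw [LinearPMap.mem_graph_iff]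
    refine ⟨⟨ψ, hx⟩, rfl, ?_⟩
    rw [LinearPMap.add_apply, apply_eq_of_mem_graph ha, apply_eq_of_mem_graph hb]

theorem mem_graph_sub {A B : H →ₗ.[ℂ] H} {ψ φ : H} :
    (ψ, φ) ∈ (A - B).graph ↔ ∃ a b, (ψ, a) ∈ A.graph ∧ (ψ, b) ∈ B.graph ∧ φ = a - b := by
  constructor
  · rw [LinearPMap.mem_graph_iff]
    rintro ⟨⟨x, hx⟩, rfl, h⟩
    exact ⟨_, _, mem_graph_mk hx.1, mem_graph_mk hx.2, h.symm⟩
  · rintro ⟨a, b, ha, hb, rfl⟩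
    have hx : ψ ∈ (A - B).domain :=
      ⟨LinearPMap.mem_domain_of_mem_graph ha, LinearPMap.mem_domain_of_mem_graph hb⟩
    rw [LinearPMap.mem_graph_iff]
    refine ⟨⟨ψ, hx⟩, rfl, ?_⟩
    rw [LinearPMap.sub_apply, apply_eq_of_mem_graph ha, apply_eq_of_mem_graph hb]

theorem mem_graph_smul {A : H →ₗ.[ℂ] H} {c : ℂ} {ψ φ : H} :
    (ψ, φ) ∈ (c • A).graph ↔ ∃ a, (ψ, a) ∈ A.graph ∧ φ = c • a := by
  constructor
  · rw [LinearPMap.mem_graph_iff]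
    rintro ⟨⟨x, hx⟩, rfl, h⟩
    exact ⟨_, mem_graph_mk (A := A) hx, h.symm⟩
  · rintro ⟨a, ha, rfl⟩
    have hx : ψ ∈ A.domain := LinearPMap.mem_domain_of_mem_graph ha
    rw [LinearPMap.mem_graph_iff]
    refine ⟨⟨ψ, hx⟩, rfl, ?_⟩
    rw [LinearPMap.smul_apply, apply_eq_of_mem_graph ha]

theorem mem_graph_opMul {S T : H →ₗ.[ℂ] H} {ψ φ : H} :
    (ψ, φ) ∈ (opMul S T).graph ↔ ∃ η, (ψ, η) ∈ T.graph ∧ (η, φ) ∈ S.graph := by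
  constructor
  · rw [LinearPMap.mem_graph_iff]
    rintro ⟨⟨x, hx, hx'⟩, rfl, h⟩
    have h' : S ⟨T ⟨x, hx⟩, hx'⟩ = φ := h
    exact ⟨_, mem_graph_mk hx, h' ▸ mem_graph_mk hx'⟩
  · rintro ⟨η, h1, h2⟩
    have hx := LinearPMap.mem_domain_of_mem_graph h1
    have e1 := apply_eq_of_mem_graph h1 hx
    have hx' : T ⟨ψ, hx⟩ ∈ S.domain := by
      rw [e1]; exact LinearPMap.mem_domain_of_mem_graph h2
    rw [LinearPMap.mem_graph_iff]
    refine ⟨⟨ψ, hx, hx'⟩, rfl, ?_⟩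
    exact apply_eq_of_mem_graph (by rw [e1]; exact h2) hx'

theorem mem_graph_generator {U : ℝ → H →L[ℂ] H} {ψ φ : H} :
    (ψ, φ) ∈ (generator U).graph ↔ HasDerivAt (fun t => U t ψ) (Complex.I • φ) 0 := by
  constructor
  · rw [LinearPMap.mem_graph_iff]
    rintro ⟨⟨x, hx⟩, rfl, h⟩
    have h' : (-Complex.I) • deriv (fun t => U t x) 0 = φ := h
    have hd : HasDerivAt (fun t => U t x) (deriv (fun t => U t x) 0) 0 :=
      DifferentiableAt.hasDerivAt hx
    rw [← h', smul_smul]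
    simpa using hd
  · intro h
    rw [LinearPMap.mem_graph_iff]
    refine ⟨⟨ψ, h.differentiableAt⟩, rfl, ?_⟩
    change (-Complex.I) • deriv (fun t => U t ψ) 0 = φ
    rw [h.deriv, smul_smul]
    simp

theorem exists_of_mem_graph_sum {ι : Type*} (s : Finset ι) {A : ι → H →ₗ.[ℂ] H} {ψ φ : H}
    (h : (ψ, φ) ∈ (∑ i ∈ s, A i).graph) :
    ∃ a : ι → H, (∀ i ∈ s, (ψ, a i) ∈ (A i).graph) ∧ φ = ∑ i ∈ s, a i := by
  classical
  induction s using Finset.induction_on generalizing φ with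
  | empty =>
    rw [Finset.sum_empty, LinearPMap.mem_graph_iff] at h
    obtain ⟨y, -, h⟩ := h
    exact ⟨fun _ => 0, by simp, by simpa using h.symm⟩
  | insert i s hi ih =>
    rw [Finset.sum_insert hi] at h
    obtain ⟨a, b, ha, hb, rfl⟩ := mem_graph_add.1 h
    obtain ⟨c, hc, rfl⟩ := ih hb
    refine ⟨Function.update c i a, ?_, ?_⟩
    · intro j hj
      rcases Finset.mem_insert.1 hj with rfl | hj
      · simpa using ha
      · have : j ≠ i := fun e => hi (e ▸ hj)
        simpa [this] using hc j hj
    · rw [Finset.sum_insert hi]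
      congr 1
      · simp
      · refine Finset.sum_congr rfl fun j hj => ?_
        have : j ≠ i := fun e => hi (e ▸ hj)
        simp [this]

/-- `C` commutes with the unbounded operator `A`: `C A ⊆ A C`. -/
def CommutesWith (C : H →L[ℂ] H) (A : H →ₗ.[ℂ] H) : Prop :=
  ∀ ψ φ, (ψ, φ) ∈ A.graph → (C ψ, C φ) ∈ A.graph

theorem CommutesWith.sub {C : H →L[ℂ] H} {A B : H →ₗ.[ℂ] H} (hA : CommutesWith C A)
    (hB : CommutesWith C B) : CommutesWith C (A - B) := by
  intro ψ φ h
  obtain ⟨a, b, ha, hb, rfl⟩ := mem_graph_sub.1 h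
  exact mem_graph_sub.2 ⟨_, _, hA _ _ ha, hB _ _ hb, map_sub _ _ _⟩

theorem CommutesWith.add {C : H →L[ℂ] H} {A B : H →ₗ.[ℂ] H} (hA : CommutesWith C A)
    (hB : CommutesWith C B) : CommutesWith C (A + B) := by
  intro ψ φ h
  obtain ⟨a, b, ha, hb, rfl⟩ := mem_graph_add.1 h
  exact mem_graph_add.2 ⟨_, _, hA _ _ ha, hB _ _ hb, map_add _ _ _⟩

theorem CommutesWith.opMul {C : H →L[ℂ] H} {A B : H →ₗ.[ℂ] H} (hA : CommutesWith C A)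
    (hB : CommutesWith C B) : CommutesWith C (opMul A B) := by
  intro ψ φ h
  obtain ⟨a, h1, h2⟩ := mem_graph_opMul.1 h
  exact mem_graph_opMul.2 ⟨_, hB _ _ h1, hA _ _ h2⟩

theorem CommutesWith.generator {C : H →L[ℂ] H} {U : ℝ → H →L[ℂ] H}
    (h : ∀ t ψ, C (U t ψ) = U t (C ψ)) : CommutesWith C (generator U) := by
  intro ψ φ hψ
  rw [mem_graph_generator] at hψ ⊢
  have := (C.restrictScalars ℝ).hasFDerivAt.comp_hasDerivAt (0 : ℝ) hψ
  simpa [Function.comp_def, h] using this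

theorem CommutesWith.closure {C : H →L[ℂ] H} {A : H →ₗ.[ℂ] H} (hA : CommutesWith C A) :
    CommutesWith C A.closure := by
  by_cases hc : A.IsClosable
  · intro ψ φ h
    rw [← hc.graph_closure_eq_closure_graph] at h ⊢
    have hcont : Continuous fun p : H × H => (C p.1, C p.2) := by fun_prop
    exact map_mem_closure (s := (A.graph : Set (H × H))) hcont h fun p hp => hA p.1 p.2 hp
  -- The closure of an operator that is not closable is by convention the operator itself.
  · rwa [LinearPMap.closure_def' hc]

theorem mem_graph_of_tendsto {A : H →ₗ.[ℂ] H} (hA : A.IsClosed) {u v : ℕ → H} {ψ φ : H}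
    (h : ∀ n, (u n, v n) ∈ A.graph) (hu : Tendsto u atTop (𝓝 ψ)) (hv : Tendsto v atTop (𝓝 φ)) :
    (ψ, φ) ∈ A.graph :=
  IsClosed.mem_of_tendsto (s := (A.graph : Set (H × H))) hA (hu.prodMk_nhds hv)
    (Eventually.of_forall h)

theorem mem_graph_adjoint [CompleteSpace H] {A : H →ₗ.[ℂ] H} (hA : Dense (A.domain : Set H))
    {ψ φ : H} :
    (ψ, φ) ∈ A.adjoint.graph ↔ ∀ a b, (a, b) ∈ A.graph → inner ℂ b ψ = inner ℂ a φ := by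
  rw [LinearPMap.adjoint_graph_eq_graph_adjoint hA, Submodule.mem_adjoint_iff]
  exact forall₃_congr fun a b _ => sub_eq_zero

/-- `A` is symmetric on its graph when selfadjoint. -/
theorem inner_eq_of_isSelfAdjoint [CompleteSpace H] {A : H →ₗ.[ℂ] H} (hA : IsSelfAdjoint A)
    {a b ψ φ : H}
    (h : (a, b) ∈ A.graph) (h' : (ψ, φ) ∈ A.graph) : inner ℂ b ψ = inner ℂ a φ := by
  rw [← LinearPMap.isSelfAdjoint_def.1 hA, mem_graph_adjoint hA.dense_domain] at h'
  exact h' a b h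

theorem mem_graph_of_isSelfAdjoint [CompleteSpace H] {A : H →ₗ.[ℂ] H} (hA : IsSelfAdjoint A)
    {ψ φ : H}
    (h : ∀ a b, (a, b) ∈ A.graph → inner ℂ b ψ = inner ℂ a φ) : (ψ, φ) ∈ A.graph := by
  rw [← LinearPMap.isSelfAdjoint_def.1 hA, mem_graph_adjoint hA.dense_domain]
  exact h

/-! ### Mollified operators -/

/-- A sequence of symmetric bounded operators `T n`, tending strongly to `1`, maps into the domain
of `A` and commutes with it; `K n` is the bounded operator `A T n`, and `L n` its adjoint. -/
structure Mollified (A : H →ₗ.[ℂ] H) (T K L : ℕ → H →L[ℂ] H) : Prop where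
  symm : ∀ n ψ φ, inner ℂ (T n ψ) φ = inner ℂ ψ (T n φ)
  adj : ∀ n ψ φ, inner ℂ (K n ψ) φ = inner ℂ ψ (L n φ)
  tendsto : ∀ ψ, Tendsto (fun n => T n ψ) atTop (𝓝 ψ)
  mem : ∀ n ψ, (T n ψ, K n ψ) ∈ A.graph
  comm : ∀ n ψ φ, (ψ, φ) ∈ A.graph → K n ψ = T n φ

namespace Mollified

variable {A : H →ₗ.[ℂ] H} {T K L : ℕ → H →L[ℂ] H}

/-- The equations are closed conditions that hold on the graph. Conversely they turn `(T n ψ, K n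
ψ)`, a point of the graph, into `(T n ψ, T n φ)`, which tends to `(ψ, φ)`. -/
theorem mem_closure_graph_iff (h : Mollified A T K L) {p : H × H} :
    p ∈ A.graph.topologicalClosure ↔ ∀ n, K n p.1 = T n p.2 := by
  constructor
  · intro hp n
    have hc : IsClosed {p : H × H | K n p.1 = T n p.2} := isClosed_eq (by fun_prop) (by fun_prop)
    exact closure_minimal (fun q hq => h.comm n q.1 q.2 hq) hc hp
  · intro hp
    have h1 : Tendsto (fun n => (T n p.1, K n p.1)) atTop (𝓝 (p.1, p.2)) := by
      refine (h.tendsto p.1).prodMk_nhds ?_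
      simp_rw [hp]
      exact h.tendsto p.2
    exact mem_closure_of_tendsto h1 (Eventually.of_forall fun n => h.mem n p.1)

/-- A limit point `(0, y)` of the graph satisfies `T n y = 0` for all `n`, so `y = 0`. -/
theorem isClosable (h : Mollified A T K L) : A.IsClosable := by
  refine ⟨A.graph.topologicalClosure.toLinearPMap, ?_⟩
  rw [Submodule.toLinearPMap_graph_eq]
  rintro ⟨x, y⟩ hx rfl
  rw [h.mem_closure_graph_iff] at hx
  have h0 : ∀ n, T n y = 0 := fun n => by simpa using (hx n).symm
  have h1 := h.tendsto y
  simp_rw [h0] at h1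
  exact (tendsto_nhds_unique h1 tendsto_const_nhds)

theorem mem_graph_closure (h : Mollified A T K L) {ψ φ : H} :
    (ψ, φ) ∈ A.closure.graph ↔ ∀ n, K n ψ = T n φ := by
  rw [← h.isClosable.graph_closure_eq_closure_graph, h.mem_closure_graph_iff]

theorem mem_closure (h : Mollified A T K L) (n : ℕ) (ψ : H) :
    (T n ψ, K n ψ) ∈ A.closure.graph :=
  LinearPMap.le_graph_of_le A.le_closure (h.mem n ψ)

theorem dense_domain (h : Mollified A T K L) : Dense (A.domain : Set H) := fun ψ =>
  mem_closure_of_tendsto (h.tendsto ψ)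
    (Eventually.of_forall fun n => LinearPMap.mem_domain_of_mem_graph (h.mem n ψ))

theorem dense_domain_closure (h : Mollified A T K L) : Dense (A.closure.domain : Set H) :=
  h.dense_domain.mono A.le_closure.1

variable [CompleteSpace H]

/-- The vectors `T n χ` already form enough test vectors: pairing with them moves `K n` to `L n`,
and `T n → 1` extends the resulting identity to the whole domain. -/
theorem mem_graph_adjoint_closure (h : Mollified A T K L) {ψ φ : H} :
    (ψ, φ) ∈ A.closure.adjoint.graph ↔ ∀ n, L n ψ = T n φ := by
  rw [mem_graph_adjoint h.dense_domain_closure]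
  constructor
  · intro hp n
    refine ext_inner_left ℂ fun χ => ?_
    rw [← h.adj, ← h.symm]
    exact hp _ _ (h.mem_closure n χ)
  · intro hp a b hab
    rw [h.mem_graph_closure] at hab
    have h1 : Tendsto (fun n => inner ℂ (T n b) ψ) atTop (𝓝 (inner ℂ b ψ)) :=
      (h.tendsto b).inner tendsto_const_nhds
    have h2 : Tendsto (fun n => inner ℂ (T n a) φ) atTop (𝓝 (inner ℂ a φ)) :=
      (h.tendsto a).inner tendsto_const_nhds
    refine tendsto_nhds_unique h1 (h2.congr fun n => ?_)
    rw [← hab, h.adj, hp, h.symm]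

theorem isSelfAdjoint_closure (h : Mollified A T K K) : IsSelfAdjoint A.closure := by
  rw [LinearPMap.isSelfAdjoint_def]
  apply LinearPMap.eq_of_eq_graph
  ext ⟨ψ, φ⟩
  rw [h.mem_graph_adjoint_closure, h.mem_graph_closure]

end Mollified

/-! ### Normal operators `A ± i Q` -/

section Normal

/-- If the selfadjoint operator `A` commutes with the unitary group generated by `Q`, then
`⟨A ψ, Q φ⟩ = ⟨Q ψ, A φ⟩` on the common domain. -/
theorem inner_comm_of_commutesWith [CompleteSpace H] {A : H →ₗ.[ℂ] H} {U : ℝ → H →L[ℂ] H}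
    (hA : IsSelfAdjoint A)
    (hU : ∀ t ψ φ, inner ℂ (U (-t) ψ) φ = inner ℂ ψ (U t φ)) (h : ∀ t, CommutesWith (U t) A)
    {a a₁ a₂ b b₁ b₂ : H} (ha₁ : (a, a₁) ∈ A.graph) (ha₂ : (a, a₂) ∈ (generator U).graph)
    (hb₁ : (b, b₁) ∈ A.graph) (hb₂ : (b, b₂) ∈ (generator U).graph) :
    inner ℂ a₁ b₂ = inner ℂ a₂ b₁ := by
  rw [mem_graph_generator] at ha₂ hb₂
  -- The claim is the derivative of this identity at `t = 0`, which avoids asking whether `Q φ` lies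
  -- in the domain of `A`.
  have e : ∀ t, inner ℂ a₁ (U t b) = inner ℂ (U (-t) a) b₁ := fun t => by
    rw [← hU]
    exact inner_eq_of_isSelfAdjoint hA (h (-t) _ _ ha₁) hb₁
  have d₁ : HasDerivAt (fun t => inner ℂ a₁ (U t b)) (inner ℂ a₁ (Complex.I • b₂)) 0 := by
    have := (hasDerivAt_const (0 : ℝ) a₁).inner ℂ hb₂
    rwa [inner_zero_left, add_zero] at this
  have d₂ : HasDerivAt (fun t => inner ℂ (U (-t) a) b₁) (inner ℂ (-(Complex.I • a₂)) b₁) 0 := by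
    have h0 : HasDerivAt (fun t => U t a) (Complex.I • a₂) (-0 : ℝ) := by simpa using ha₂
    have h1 := h0.scomp (0 : ℝ) (hasDerivAt_neg (0 : ℝ))
    simpa [Function.comp_def] using h1.inner ℂ (hasDerivAt_const (0 : ℝ) b₁)
  have := d₁.unique (d₂.congr_of_eventuallyEq (Eventually.of_forall e))
  rw [inner_smul_right, inner_neg_left, inner_smul_left, Complex.conj_I, neg_mul, neg_neg] at this
  exact mul_left_cancel₀ Complex.I_ne_zero this

variable {A Q B : H →ₗ.[ℂ] H} {T KA KQ K L : ℕ → H →L[ℂ] H}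

/-- The hypothesis says that `⟨a, q⟩` is real, so the cross term is purely imaginary and drops out.
-/
theorem norm_sq_add_smul {a q : H} {c : ℂ} (hc : c = Complex.I ∨ c = -Complex.I)
    (h : inner ℂ a q = inner ℂ q a) : ‖a + c • q‖ ^ 2 = ‖a‖ ^ 2 + ‖q‖ ^ 2 := by
  have hr : (inner ℂ a q).im = 0 := by
    have := inner_conj_symm (𝕜 := ℂ) a q
    rw [← h] at this
    exact Complex.conj_eq_iff_im.1 this
  have hn : ‖c‖ = 1 := by rcases hc with rfl | rfl <;> simp
  rw [norm_add_sq (𝕜 := ℂ), norm_smul, hn, one_mul, inner_smul_right]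
  rcases hc with rfl | rfl <;> simp [hr]

/-- This shows that the closure of the combination has no larger domain than `D(A) ∩ D(Q)`: by
Pythagoras, convergence of the sum forces each summand to converge separately. -/
theorem mollified_add_smul_iff [CompleteSpace H] (hA : Mollified A T KA KA)
    (hQ : Mollified Q T KQ KQ)
    (hcl : Q.IsClosed) {c : ℂ} (hc : c = Complex.I ∨ c = -Complex.I)
    (hcomm : ∀ a a₁ a₂, (a, a₁) ∈ A.closure.graph → (a, a₂) ∈ Q.graph →
      inner ℂ a₁ a₂ = inner ℂ a₂ a₁) {ψ φ : H} :
    (∀ n, KA n ψ + c • KQ n ψ = T n φ) ↔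
      ∃ a q, (ψ, a) ∈ A.closure.graph ∧ (ψ, q) ∈ Q.graph ∧ φ = a + c • q := by
  constructor
  · intro h
    have key : ∀ n m, ‖KA n ψ - KA m ψ‖ ^ 2 + ‖KQ n ψ - KQ m ψ‖ ^ 2 = ‖T n φ - T m φ‖ ^ 2 := by
      intro n m
      have h1 := A.closure.graph.sub_mem (hA.mem_closure n ψ) (hA.mem_closure m ψ)
      have h2 := Q.graph.sub_mem (hQ.mem n ψ) (hQ.mem m ψ)
      rw [← norm_sq_add_smul hc (hcomm _ _ _ h1 h2), ← h n, ← h m, smul_sub]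
      congr 2
      abel
    have hcau := (hA.tendsto φ).cauchySeq
    have c1 : CauchySeq fun n => KA n ψ := by
      rw [Metric.cauchySeq_iff] at hcau ⊢
      intro ε hε
      obtain ⟨N, hN⟩ := hcau ε hε
      refine ⟨N, fun m hm n hn => lt_of_le_of_lt ?_ (hN m hm n hn)⟩
      rw [dist_eq_norm, dist_eq_norm]
      refine le_of_sq_le_sq ?_ (norm_nonneg _)
      nlinarith [key m n, sq_nonneg ‖KQ m ψ - KQ n ψ‖]
    have c2 : CauchySeq fun n => KQ n ψ := by
      rw [Metric.cauchySeq_iff] at hcau ⊢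
      intro ε hε
      obtain ⟨N, hN⟩ := hcau ε hε
      refine ⟨N, fun m hm n hn => lt_of_le_of_lt ?_ (hN m hm n hn)⟩
      rw [dist_eq_norm, dist_eq_norm]
      refine le_of_sq_le_sq ?_ (norm_nonneg _)
      nlinarith [key m n, sq_nonneg ‖KA m ψ - KA n ψ‖]
    obtain ⟨a, ha⟩ := cauchySeq_tendsto_of_complete c1
    obtain ⟨q, hq⟩ := cauchySeq_tendsto_of_complete c2
    refine ⟨a, q, mem_graph_of_tendsto hA.isClosable.closure_isClosed
      (fun n => hA.mem_closure n ψ) (hA.tendsto ψ) ha,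
      mem_graph_of_tendsto hcl (fun n => hQ.mem n ψ) (hQ.tendsto ψ) hq, ?_⟩
    refine tendsto_nhds_unique (hA.tendsto φ) ?_
    simp_rw [← h]
    exact ha.add (hq.const_smul c)
  · rintro ⟨a, q, ha, hq, rfl⟩ n
    rw [hA.mem_graph_closure.1 ha n, hQ.comm n _ _ hq, map_add, map_smul]

/-- The closure of an operator with the mollification of `A - i Q`, with selfadjoint `A`, `Q` that
commute, is `A - i Q`, and is normal. -/
theorem closure_eq_sub_and_isNormalOp [CompleteSpace H] (hA : Mollified A T KA KA)
    (hQ : Mollified Q T KQ KQ)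
    (hcl : Q.IsClosed) (hB : Mollified B T K L)
    (hK : ∀ n ψ, K n ψ = KA n ψ + (-Complex.I) • KQ n ψ)
    (hL : ∀ n ψ, L n ψ = KA n ψ + Complex.I • KQ n ψ)
    (hcomm : ∀ a a₁ a₂ b b₁ b₂, (a, a₁) ∈ A.closure.graph → (a, a₂) ∈ Q.graph →
      (b, b₁) ∈ A.closure.graph → (b, b₂) ∈ Q.graph → inner ℂ a₁ b₂ = inner ℂ a₂ b₁) :
    B.closure = A.closure - Complex.I • Q ∧ IsNormalOp B.closure := by
  have hcomm' : ∀ a a₁ a₂, (a, a₁) ∈ A.closure.graph → (a, a₂) ∈ Q.graph →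
      inner ℂ a₁ a₂ = inner ℂ a₂ a₁ := fun a a₁ a₂ h1 h2 => hcomm _ _ _ _ _ _ h1 h2 h1 h2
  have gN : ∀ ψ φ, (ψ, φ) ∈ B.closure.graph ↔
      ∃ a q, (ψ, a) ∈ A.closure.graph ∧ (ψ, q) ∈ Q.graph ∧ φ = a + (-Complex.I) • q := by
    intro ψ φ
    rw [hB.mem_graph_closure]
    simp_rw [hK]
    exact mollified_add_smul_iff hA hQ hcl (Or.inr rfl) hcomm'
  have gN' : ∀ ψ φ, (ψ, φ) ∈ B.closure.adjoint.graph ↔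
      ∃ a q, (ψ, a) ∈ A.closure.graph ∧ (ψ, q) ∈ Q.graph ∧ φ = a + Complex.I • q := by
    intro ψ φ
    rw [hB.mem_graph_adjoint_closure]
    simp_rw [hL]
    exact mollified_add_smul_iff hA hQ hcl (Or.inl rfl) hcomm'
  -- The polarized form of `‖Nψ‖ = ‖N†ψ‖`; it drives both inclusions between `N†N` and `N N†`.
  have pol : ∀ a a₁ a₂ b b₁ b₂, (a, a₁) ∈ A.closure.graph → (a, a₂) ∈ Q.graph →
      (b, b₁) ∈ A.closure.graph → (b, b₂) ∈ Q.graph →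
      inner ℂ (a₁ + (-Complex.I) • a₂) (b₁ + (-Complex.I) • b₂) =
        inner ℂ (a₁ + Complex.I • a₂) (b₁ + Complex.I • b₂) := by
    intro a a₁ a₂ b b₁ b₂ h1 h2 h3 h4
    have := hcomm _ _ _ _ _ _ h1 h2 h3 h4
    simp only [inner_add_left, inner_add_right, inner_smul_left, inner_smul_right, map_neg,
      Complex.conj_I, this]
    ring
  refine ⟨?_, hB.dense_domain_closure, hB.isClosable.closure_isClosed, ?_⟩
  · apply LinearPMap.eq_of_eq_graph
    ext ⟨ψ, φ⟩
    rw [gN, mem_graph_sub]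
    constructor
    · rintro ⟨a, q, ha, hq, rfl⟩
      exact ⟨a, _, ha, mem_graph_smul.2 ⟨q, hq, rfl⟩, by rw [neg_smul, sub_eq_add_neg]⟩
    · rintro ⟨a, _, ha, hq', rfl⟩
      obtain ⟨q, hq, rfl⟩ := mem_graph_smul.1 hq'
      exact ⟨a, q, ha, hq, by rw [neg_smul, sub_eq_add_neg]⟩
  · apply LinearPMap.eq_of_eq_graph
    ext ⟨ψ, φ⟩
    rw [mem_graph_opMul, mem_graph_opMul]
    constructor
    · rintro ⟨η, h1, h2⟩
      obtain ⟨a, q, ha, hq, rfl⟩ := (gN _ _).1 h1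
      refine ⟨_, (gN' _ _).2 ⟨a, q, ha, hq, rfl⟩, ?_⟩
      rw [hB.mem_graph_closure]
      intro n
      -- `K n (N†ψ)` is tested against `χ`: `⟨L n χ, N†ψ⟩ = ⟨N† T n χ, N†ψ⟩ = ⟨N T n χ, N ψ⟩ = ⟨T n
      -- χ, N†N ψ⟩`.
      refine ext_inner_left ℂ fun χ => ?_
      have hL' : inner ℂ χ (K n (a + Complex.I • q)) =
          inner ℂ (L n χ) (a + Complex.I • q) := by
        rw [← inner_conj_symm, hB.adj, inner_conj_symm]
      rw [hL', hL, ← pol _ _ _ _ _ _ (hA.mem_closure n χ) (hQ.mem n χ) ha hq, ← hK, ← hB.symm]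
      exact (mem_graph_adjoint hB.dense_domain_closure).1 h2 _ _ (hB.mem_closure n χ)
    · rintro ⟨η, h1, h2⟩
      obtain ⟨a, q, ha, hq, rfl⟩ := (gN' _ _).1 h1
      refine ⟨_, (gN _ _).2 ⟨a, q, ha, hq, rfl⟩, ?_⟩
      rw [mem_graph_adjoint hB.dense_domain_closure]
      intro x y hxy
      obtain ⟨b, p, hb, hp, rfl⟩ := (gN _ _).1 hxy
      rw [pol _ _ _ _ _ _ hb hp ha hq]
      have h3 := (mem_graph_adjoint hB.dense_domain_closure).1
        ((gN' _ _).2 ⟨b, p, hb, hp, rfl⟩) _ _ h2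
      rw [← inner_conj_symm, ← h3, inner_conj_symm]

end Normal

end Graph

end QST

end

noncomputable section

namespace QST

open Filter Topology

section SquareRoot

variable {H : Type*} [NormedAddCommGroup H] [InnerProductSpace ℂ H]

/-! ### The square root of a form sum -/

/-- The joint graph of a family of operators. -/
def jointGraph (N : Fin 3 → H →ₗ.[ℂ] H) : Submodule ℂ (PiLp 2 fun _ : Fin 4 => H) where
  carrier := {v | ∀ l, (v 0, v (Fin.succ l)) ∈ (N l).graph}
  add_mem' := fun ha hb l => (N l).graph.add_mem (ha l) (hb l)
  zero_mem' := fun l => (N l).graph.zero_mem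
  smul_mem' := fun c _ ha l => (N l).graph.smul_mem c (ha l)

theorem mem_jointGraph {N : Fin 3 → H →ₗ.[ℂ] H} {v : PiLp 2 fun _ : Fin 4 => H} :
    v ∈ jointGraph N ↔ ∀ l, (v 0, v (Fin.succ l)) ∈ (N l).graph := Iff.rfl

theorem isClosed_jointGraph {N : Fin 3 → H →ₗ.[ℂ] H} (hN : ∀ l, (N l).IsClosed) :
    IsClosed (jointGraph N : Set (PiLp 2 fun _ : Fin 4 => H)) := by
  have : (jointGraph N : Set (PiLp 2 fun _ : Fin 4 => H)) =
      ⋂ l, (fun v : PiLp 2 fun _ : Fin 4 => H => (v 0, v (Fin.succ l))) ⁻¹'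
        ((N l).graph : Set (H × H)) := by
    ext v
    simp [mem_jointGraph]
  rw [this]
  exact isClosed_iInter fun l => (hN l).preimage (by fun_prop)

theorem norm_sq_four {H : Type*} [NormedAddCommGroup H] (v : PiLp 2 fun _ : Fin 4 => H) :
    ‖v‖ ^ 2 = ‖v 0‖ ^ 2 + ∑ l : Fin 3, ‖v (Fin.succ l)‖ ^ 2 := by
  rw [PiLp.norm_sq_eq_of_L2, Fin.sum_univ_succ]

theorem inner_four (v w : PiLp 2 fun _ : Fin 4 => H) :
    inner ℂ v w = inner ℂ (v 0) (w 0) + ∑ l : Fin 3, inner ℂ (v (Fin.succ l)) (w (Fin.succ l)) := by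
  rw [PiLp.inner_apply, Fin.sum_univ_succ]

/-- The vector of the joint graph over `ψ`. -/
theorem exists_mem_jointGraph {N : Fin 3 → H →ₗ.[ℂ] H} {ψ : H} {φ : Fin 3 → H}
    (h : ∀ l, (ψ, φ l) ∈ (N l).graph) :
    ∃ v ∈ jointGraph N, v 0 = ψ ∧ ∀ l, v (Fin.succ l) = φ l :=
  ⟨WithLp.toLp 2 (Fin.cons ψ φ), fun l => by simpa using h l, by simp, fun l => by simp⟩

/-- The projection of the joint graph to the first component. -/
def jointGraphFst (N : Fin 3 → H →ₗ.[ℂ] H) : jointGraph N →L[ℂ] H :=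
  (PiLp.proj 2 (fun _ : Fin 4 => H) 0).comp (jointGraph N).subtypeL

theorem jointGraphFst_apply (N : Fin 3 → H →ₗ.[ℂ] H) (v : jointGraph N) :
    jointGraphFst N v = v.1 0 := rfl

theorem jointGraphFst_injective (N : Fin 3 → H →ₗ.[ℂ] H) :
    Function.Injective (jointGraphFst N) := by
  refine (injective_iff_map_eq_zero _).2 fun v hv => ?_
  rw [jointGraphFst_apply] at hv
  ext i
  refine Fin.cases hv (fun l => ?_) i
  exact (N l).graph_fst_eq_zero_snd (v.2 l) hv

/-- Polarization of the norm identity. The three components are collected into one vector of `H³`,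
so that the complex polarization formula applies to both sides at once. -/
theorem inner_of_isSqrtSumSqModuli [CompleteSpace H] {N : Fin 3 → H →ₗ.[ℂ] H} {S : H →ₗ.[ℂ] H}
    (hS : IsSqrtSumSqModuli N S) {a b ψ φ : H} {α β : Fin 3 → H} (hab : (a, b) ∈ S.graph)
    (hψφ : (ψ, φ) ∈ S.graph) (hα : ∀ l, (a, α l) ∈ (N l).graph)
    (hβ : ∀ l, (ψ, β l) ∈ (N l).graph) : inner ℂ b φ = ∑ l, inner ℂ (α l) (β l) := by
  have key : ∀ (a b : H) (α : Fin 3 → H), (a, b) ∈ S.graph → (∀ l, (a, α l) ∈ (N l).graph) →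
      ‖b‖ ^ 2 = ‖(WithLp.toLp 2 α : PiLp 2 fun _ : Fin 3 => H)‖ ^ 2 := by
    intro a b α hab hα
    have ha := LinearPMap.mem_domain_of_mem_graph hab
    have := hS.norm_sq ⟨a, ha⟩ fun l => LinearPMap.mem_domain_of_mem_graph (hα l)
    rw [apply_eq_of_mem_graph hab] at this
    rw [this, PiLp.norm_sq_eq_of_L2]
    exact Finset.sum_congr rfl fun l _ => by rw [apply_eq_of_mem_graph (hα l)]
  have key' : ∀ c : ℂ, ‖b + c • φ‖ = ‖(WithLp.toLp 2 α : PiLp 2 fun _ : Fin 3 => H) +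
      c • (WithLp.toLp 2 β : PiLp 2 fun _ : Fin 3 => H)‖ := by
    intro c
    have := key _ _ (α + c • β) (S.graph.add_mem hab (S.graph.smul_mem c hψφ))
      fun l => (N l).graph.add_mem (hα l) ((N l).graph.smul_mem c (hβ l))
    exact (sq_eq_sq₀ (norm_nonneg _) (norm_nonneg _)).1 this
  have e : inner ℂ b φ = inner ℂ (WithLp.toLp 2 α : PiLp 2 fun _ : Fin 3 => H)
      (WithLp.toLp 2 β : PiLp 2 fun _ : Fin 3 => H) := by
    rw [inner_eq_sum_norm_sq_div_four, inner_eq_sum_norm_sq_div_four]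
    have h1 := key' 1
    have h2 := key' (-1)
    have h3 := key' Complex.I
    have h4 := key' (-Complex.I)
    simp only [one_smul, neg_smul, ← sub_eq_add_neg] at h1 h2 h3 h4
    simp only [RCLike.I_to_complex, h1, h2, h3, h4]
  rw [e, PiLp.inner_apply]

section Existence

variable [CompleteSpace H]

/-- A nonnegative selfadjoint operator built from a resolvent `0 ≤ R ≤ 1`: its graph consists of
all `(R^{1/2} x, (1 - R)^{1/2} x)`. -/
theorem exists_isSelfAdjoint_of_resolvent {R : H →L[ℂ] H} (h0 : 0 ≤ R) (h1 : R ≤ 1)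
    (hinj : Function.Injective R) :
    ∃ (B C : H →L[ℂ] H) (S : H →ₗ.[ℂ] H), B * B = R ∧ IsSelfAdjoint B ∧
      (∀ x, ‖B x‖ ^ 2 + ‖C x‖ ^ 2 = ‖x‖ ^ 2) ∧
      (∀ ψ φ, (ψ, φ) ∈ S.graph ↔ ∃ x, B x = ψ ∧ C x = φ) ∧ IsSelfAdjoint S ∧
      (∀ x, 0 ≤ (inner ℂ (B x) (C x)).re) ∧
      ((∀ x, ‖B x‖ ≤ ‖C x‖) → ∀ x, (inner ℂ (B x) (B x)).re ≤ (inner ℂ (B x) (C x)).re) := by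
  have hR : IsSelfAdjoint R := IsSelfAdjoint.of_nonneg h0
  have hs0 : ∀ x ∈ spectrum ℝ R, 0 ≤ x := fun x hx => spectrum_nonneg_of_nonneg h0 hx
  have hs1 : ∀ x ∈ spectrum ℝ R, x ≤ 1 := by
    have : R ≤ algebraMap ℝ (H →L[ℂ] H) 1 := by simpa using h1
    exact (le_algebraMap_iff_spectrum_le (a := R)).1 this
  set B : H →L[ℂ] H := cfc (fun x : ℝ => √x) R with hB
  set C : H →L[ℂ] H := cfc (fun x : ℝ => √(1 - x)) R with hC
  have hBB : B * B = R := by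
    rw [hB, ← cfc_mul (fun x : ℝ => √x) (fun x : ℝ => √x) R]
    conv_rhs => rw [← cfc_id ℝ R]
    exact cfc_congr fun x hx => Real.mul_self_sqrt (hs0 x hx)
  have hCC : C * C = 1 - R := by
    rw [hC, ← cfc_mul (fun x : ℝ => √(1 - x)) (fun x : ℝ => √(1 - x)) R]
    have : cfc (fun x : ℝ => 1 - x) R = 1 - R := by
      rw [cfc_sub (fun _ : ℝ => (1 : ℝ)) (fun x : ℝ => x) R, cfc_const_one ℝ R, cfc_id' ℝ R]
    rw [← this]
    exact cfc_congr fun x hx => Real.mul_self_sqrt (by linarith [hs1 x hx])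
  have hBs : IsSelfAdjoint B := cfc_predicate _ R
  have hCs : IsSelfAdjoint C := cfc_predicate _ R
  have hBC : B * C = C * B := (cfc_commute_cfc (fun x : ℝ => √x) (fun x : ℝ => √(1 - x)) R).eq
  have hBC0 : 0 ≤ B * C := by
    rw [hB, hC, ← cfc_mul (fun x : ℝ => √x) (fun x : ℝ => √(1 - x)) R]
    exact cfc_nonneg fun x _ => by positivity
  have symB : ∀ x y, inner ℂ (B x) y = inner ℂ x (B y) := fun x y =>
    (ContinuousLinearMap.isSelfAdjoint_iff_isSymmetric.1 hBs) x y
  have symC : ∀ x y, inner ℂ (C x) y = inner ℂ x (C y) := fun x y =>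
    (ContinuousLinearMap.isSelfAdjoint_iff_isSymmetric.1 hCs) x y
  have aBB : ∀ x, B (B x) = R x := fun x => by rw [← hBB]; rfl
  have aCC : ∀ x, C (C x) = x - R x := fun x => by
    have := congrArg (fun A : H →L[ℂ] H => A x) hCC
    simpa using this
  have aBC : ∀ x, B (C x) = C (B x) := fun x => by
    have := congrArg (fun A : H →L[ℂ] H => A x) hBC
    simpa using this
  have hBinj : Function.Injective B := by
    intro x y hxy
    apply hinj
    rw [← aBB, ← aBB, hxy]
  have hnorm : ∀ x, ‖B x‖ ^ 2 + ‖C x‖ ^ 2 = ‖x‖ ^ 2 := by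
    intro x
    have e : (inner ℂ (B x) (B x) + inner ℂ (C x) (C x) : ℂ) = inner ℂ x x := by
      rw [symB, symC, aBB, aCC, ← inner_add_right]
      congr 1
      abel
    simp only [inner_self_eq_norm_sq_to_K] at e
    exact_mod_cast e
  set g : Submodule ℂ (H × H) := LinearMap.range ((B : H →ₗ[ℂ] H).prod (C : H →ₗ[ℂ] H)) with hg
  have hgm : ∀ ψ φ, (ψ, φ) ∈ g ↔ ∃ x, B x = ψ ∧ C x = φ := by
    intro ψ φ
    simp [hg, LinearMap.mem_range]
  have hgraph : g.toLinearPMap.graph = g := by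
    apply Submodule.toLinearPMap_graph_eq
    rintro ⟨ψ, φ⟩ hx h0'
    obtain ⟨x, hx1, hx2⟩ := (hgm _ _).1 hx
    have : x = 0 := hBinj (by rw [hx1, map_zero]; exact h0')
    rw [← hx2, this, map_zero]
  have hS : ∀ ψ φ, (ψ, φ) ∈ g.toLinearPMap.graph ↔ ∃ x, B x = ψ ∧ C x = φ := by
    rw [hgraph]; exact hgm
  -- The range of a selfadjoint injective operator is dense.
  have hdense : Dense (g.toLinearPMap.domain : Set H) := by
    have hr : Dense (LinearMap.range (B : H →ₗ[ℂ] H) : Set H) := by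
      rw [← Submodule.dense_iff_topologicalClosure_eq_top.symm.eq,
        Submodule.topologicalClosure_eq_top_iff, Submodule.eq_bot_iff]
      intro y hy
      rw [Submodule.mem_orthogonal] at hy
      apply hBinj
      rw [map_zero]
      refine ext_inner_left ℂ fun x => ?_
      rw [← symB, inner_zero_right]
      exact hy _ ⟨x, rfl⟩
    refine hr.mono ?_
    rintro _ ⟨x, rfl⟩
    exact LinearPMap.mem_domain_of_mem_graph ((hS _ _).2 ⟨x, rfl, rfl⟩)
  refine ⟨B, C, g.toLinearPMap, hBB, hBs, hnorm, hS, ?_, ?_, ?_⟩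
  · rw [LinearPMap.isSelfAdjoint_def]
    apply LinearPMap.eq_of_eq_graph
    ext ⟨φ, η⟩
    rw [mem_graph_adjoint hdense, hS]
    constructor
    · intro h
      have e : C φ = B η := by
        refine ext_inner_left ℂ fun x => ?_
        rw [← symB, ← symC]
        exact h _ _ ((hS _ _).2 ⟨x, rfl, rfl⟩)
      -- Since `B² + C² = 1`, the only candidate for `x` with `φ = B x`, `η = C x` is `B φ + C η`.
      refine ⟨B φ + C η, ?_, ?_⟩
      · rw [map_add, aBB, aBC, ← e, aCC]
        abel
      · rw [map_add, ← aBC, e, aBB, aCC]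
        abel
    · rintro ⟨x, rfl, rfl⟩ a b hab
      obtain ⟨y, rfl, rfl⟩ := (hS _ _).1 hab
      rw [symC, symB, aBC]
  · intro x
    have := ((ContinuousLinearMap.nonneg_iff_isPositive _).1 hBC0).re_inner_nonneg_right x
    rw [symB]
    exact this
  · intro hle x
    -- With `‖Bx‖² + ‖Cx‖² = ‖x‖²`, the bound `‖Bx‖ ≤ ‖Cx‖` reads `‖Bx‖² ≤ ‖x‖²/2`. On `[0, 1/2]`
    -- one has `√x ≤ √(1 - x)`, hence `B² ≤ B C`.
    have h2 : R ≤ algebraMap ℝ (H →L[ℂ] H) (1 / 2) := by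
      rw [ContinuousLinearMap.le_def, ContinuousLinearMap.isPositive_def']
      refine ⟨(IsSelfAdjoint.algebraMap _ (IsSelfAdjoint.all _)).sub hR, fun y => ?_⟩
      have e1 : (inner ℂ (R y) y).re = ‖B y‖ ^ 2 := by
        rw [← aBB, symB, inner_self_eq_norm_sq_to_K]
        norm_cast
      have e2 : (inner ℂ ((algebraMap ℝ (H →L[ℂ] H) (1 / 2)) y) y).re = 1 / 2 * ‖y‖ ^ 2 := by
        rw [ContinuousLinearMap.algebraMap_apply, inner_smul_left_eq_smul, Complex.real_smul,
          Complex.re_ofReal_mul, inner_self_eq_norm_sq_to_K]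
        norm_cast
      rw [ContinuousLinearMap.reApplyInnerSelf, _root_.sub_apply, inner_sub_left,
        map_sub]
      change 0 ≤ (inner ℂ ((algebraMap ℝ (H →L[ℂ] H) (1 / 2)) y) y).re - (inner ℂ (R y) y).re
      rw [e1, e2]
      have := pow_le_pow_left₀ (norm_nonneg _) (hle y) 2
      linarith [hnorm y]
    have hs2 : ∀ x ∈ spectrum ℝ R, x ≤ 1 / 2 := (le_algebraMap_iff_spectrum_le (a := R)).1 h2
    have hpos : 0 ≤ B * C - B * B := by
      rw [hB, hC, ← cfc_mul (fun x : ℝ => √x) (fun x : ℝ => √(1 - x)) R,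
        ← cfc_mul (fun x : ℝ => √x) (fun x : ℝ => √x) R,
        ← cfc_sub (fun x : ℝ => √x * √(1 - x)) (fun x : ℝ => √x * √x) R]
      refine cfc_nonneg fun y hy => ?_
      have : √y ≤ √(1 - y) := Real.sqrt_le_sqrt (by linarith [hs2 y hy])
      nlinarith [Real.sqrt_nonneg y]
    have := ((ContinuousLinearMap.nonneg_iff_isPositive _).1 hpos).re_inner_nonneg_right x
    rw [symB, symB]
    rw [_root_.sub_apply, inner_sub_right, map_sub] at this
    exact sub_nonneg.1 this

/-- The resolvent of the form `∑ l, ‖N l ψ‖²`. -/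
theorem exists_form_resolvent {N : Fin 3 → H →ₗ.[ℂ] H} (hN : ∀ l, (N l).IsClosed)
    (hd : Dense {ψ : H | ∀ l, ψ ∈ (N l).domain}) :
    ∃ R : H →L[ℂ] H, 0 ≤ R ∧ R ≤ 1 ∧ Function.Injective R ∧ (∀ x, ∃ φ : Fin 3 → H,
      (∀ l, (R x, φ l) ∈ (N l).graph) ∧ ∀ (a : H) (α : Fin 3 → H),
        (∀ l, (a, α l) ∈ (N l).graph) → inner ℂ a (R x) + ∑ l, inner ℂ (α l) (φ l) = inner ℂ a x) ∧
      ∀ B : H →L[ℂ] H, B * B = R → IsSelfAdjoint B →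
        (∀ x, ∃ φ : Fin 3 → H, (∀ l, (B x, φ l) ∈ (N l).graph) ∧
          ‖x‖ ^ 2 = ‖B x‖ ^ 2 + ∑ l, ‖φ l‖ ^ 2) ∧
        ∀ ψ, (∀ l, ψ ∈ (N l).domain) → ∃ x, B x = ψ := by
  have : CompleteSpace (jointGraph N) := (isClosed_jointGraph hN).completeSpace_coe
  set J := jointGraphFst N with hJ
  set J' := ContinuousLinearMap.adjoint J with hJ'
  have hadj : ∀ (v : jointGraph N) x, inner ℂ v (J' x) = inner ℂ (J v) x := fun v x =>
    ContinuousLinearMap.adjoint_inner_right J v x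
  have hRpos : (J.comp J').IsPositive := ContinuousLinearMap.isPositive_self_comp_adjoint J
  have hJ'norm : ∀ x, (inner ℂ x (J (J' x))).re = ‖J' x‖ ^ 2 := by
    intro x
    rw [← inner_conj_symm, ← hadj, Complex.conj_re]
    exact inner_self_eq_norm_sq (𝕜 := ℂ) (J' x)
  have hJle : ∀ v, ‖J v‖ ≤ ‖v‖ := by
    intro v
    refine le_of_sq_le_sq ?_ (norm_nonneg _)
    rw [← Submodule.norm_coe v, norm_sq_four, hJ, jointGraphFst_apply]
    exact le_add_of_nonneg_right (Finset.sum_nonneg fun _ _ => sq_nonneg _)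
  have hJ'le : ∀ x, ‖J' x‖ ≤ ‖x‖ := by
    intro x
    have h1 : ‖J‖ ≤ 1 := ContinuousLinearMap.opNorm_le_bound _ zero_le_one fun v => by
      simpa using hJle v
    have h2 : ‖J'‖ ≤ 1 := by rw [hJ', LinearIsometryEquiv.norm_map]; exact h1
    simpa using J'.le_of_opNorm_le h2 x
  refine ⟨J.comp J', (ContinuousLinearMap.nonneg_iff_isPositive _).2 hRpos, ?_, ?_, ?_, ?_⟩
  · rw [ContinuousLinearMap.le_def, ContinuousLinearMap.isPositive_def']
    refine ⟨(IsSelfAdjoint.one _).sub hRpos.isSelfAdjoint, fun y => ?_⟩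
    rw [ContinuousLinearMap.reApplyInnerSelf, _root_.sub_apply, inner_sub_left,
      map_sub]
    have e1 : RCLike.re (inner ℂ ((J.comp J') y) y) = ‖J' y‖ ^ 2 := by
      rw [← hJ'norm, ← inner_conj_symm]
      exact Complex.conj_re _
    have e2 : RCLike.re (inner ℂ ((1 : H →L[ℂ] H) y) y) = ‖y‖ ^ 2 := by
      rw [one_apply_eq_self]
      exact inner_self_eq_norm_sq y
    rw [e1, e2]
    exact sub_nonneg.2 (pow_le_pow_left₀ (norm_nonneg _) (hJ'le y) 2)
  -- If `J J* x = 0` then `J* x = 0`, so `x` is orthogonal to the range of `J`, which is the common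
  -- domain and is dense.
  · refine (injective_iff_map_eq_zero _).2 fun x hx => ?_
    have h0 : J' x = 0 := by
      have := hJ'norm x
      rw [show J (J' x) = 0 from hx, inner_zero_right] at this
      simpa using this.symm
    refine hd.eq_zero_of_inner_right ℂ fun ψ hψ => ?_
    obtain ⟨v, hv, hv0, -⟩ := exists_mem_jointGraph fun l => mem_graph_mk (hψ l)
    have := hadj ⟨v, hv⟩ x
    rw [h0, inner_zero_right, hJ, jointGraphFst_apply, hv0] at this
    exact this.symm
  · intro x
    refine ⟨fun l => (J' x).1 (Fin.succ l), (J' x).2, fun a α hα => ?_⟩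
    obtain ⟨v, hv, hv0, hvl⟩ := exists_mem_jointGraph hα
    have := hadj ⟨v, hv⟩ x
    rw [Submodule.coe_inner, inner_four, hJ, jointGraphFst_apply, hv0] at this
    simp_rw [hvl] at this
    exact this
  · intro B hBB hBs
    have symB : ∀ x y, inner ℂ (B x) y = inner ℂ x (B y) := fun x y =>
      (ContinuousLinearMap.isSelfAdjoint_iff_isSymmetric.1 hBs) x y
    have aBB : ∀ x, B (B x) = J (J' x) := fun x => by
      have := congrArg (fun A : H →L[ℂ] H => A x) hBB
      simpa using this
    -- Polar decomposition: `B x ↦ J* x` is isometric. As `B` and `J*` both have dense range, it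
    -- extends to a unitary from `H` onto the joint graph, which carries `B` to `J`. Hence the range
    -- of `B` is the form domain.
    have hiso : ∀ x, ‖B x‖ = ‖J' x‖ := by
      intro x
      refine (sq_eq_sq₀ (norm_nonneg _) (norm_nonneg _)).1 ?_
      rw [← hJ'norm, ← aBB, ← symB, inner_self_eq_norm_sq_to_K]
      norm_cast
    have dB : DenseRange B := by
      have : Dense (LinearMap.range (B : H →ₗ[ℂ] H) : Set H) := by
        rw [← Submodule.dense_iff_topologicalClosure_eq_top.symm.eq,
          Submodule.topologicalClosure_eq_top_iff, Submodule.eq_bot_iff]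
        intro y hy
        rw [Submodule.mem_orthogonal] at hy
        have hBy : B y = 0 := by
          refine ext_inner_left ℂ fun x => ?_
          rw [← symB, inner_zero_right]
          exact hy _ ⟨x, rfl⟩
        have h0 : J' y = 0 := by rw [← norm_eq_zero, ← hiso, hBy, norm_zero]
        refine hd.eq_zero_of_inner_right ℂ fun ψ hψ => ?_
        obtain ⟨v, hv, hv0, -⟩ := exists_mem_jointGraph fun l => mem_graph_mk (hψ l)
        have := hadj ⟨v, hv⟩ y
        rw [h0, inner_zero_right, hJ, jointGraphFst_apply, hv0] at this
        exact this.symm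
      exact this
    have dJ' : DenseRange J' := by
      have : Dense (LinearMap.range (J' : H →ₗ[ℂ] jointGraph N) : Set (jointGraph N)) := by
        rw [← Submodule.dense_iff_topologicalClosure_eq_top.symm.eq,
          Submodule.topologicalClosure_eq_top_iff, Submodule.eq_bot_iff]
        intro v hv
        rw [Submodule.mem_orthogonal] at hv
        apply jointGraphFst_injective N
        rw [map_zero]
        refine ext_inner_right ℂ fun x => ?_
        rw [inner_zero_left, ← hJ, ← hadj]
        exact inner_eq_zero_symm.1 (hv _ ⟨x, rfl⟩)
      exact this
    constructor
    -- The vector `v` constructed below is the image of `x` under this unitary, obtained as a limit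
    -- along `B (y n) → x`.
    · intro x
      obtain ⟨u, hu, hux⟩ := mem_closure_iff_seq_limit.1 (dB x)
      choose y hy using hu
      have hcau : CauchySeq fun n => J' (y n) := by
        have hc := hux.cauchySeq
        rw [Metric.cauchySeq_iff] at hc ⊢
        intro ε hε
        obtain ⟨k, hk⟩ := hc ε hε
        refine ⟨k, fun m hm n hn => ?_⟩
        have := hk m hm n hn
        rwa [dist_eq_norm, ← hy, ← hy, ← map_sub, hiso, map_sub, ← dist_eq_norm] at this
      obtain ⟨v, hv⟩ := cauchySeq_tendsto_of_complete hcau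
      have hv0 : J v = B x := by
        refine tendsto_nhds_unique ((J.continuous.tendsto v).comp hv) ?_
        refine ((B.continuous.tendsto x).comp hux).congr fun n => ?_
        simp only [Function.comp_apply]
        rw [← hy, aBB]
      have hn : ‖v‖ = ‖x‖ := by
        refine tendsto_nhds_unique hv.norm (hux.norm.congr fun n => ?_)
        rw [← hy, hiso]
      rw [hJ, jointGraphFst_apply] at hv0
      refine ⟨fun l => v.1 (Fin.succ l), fun l => hv0 ▸ v.2 l, ?_⟩
      rw [← hn, ← Submodule.norm_coe v, norm_sq_four, hv0]
    · intro ψ hψ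
      obtain ⟨w, hw, hw0, -⟩ := exists_mem_jointGraph fun l => mem_graph_mk (hψ l)
      obtain ⟨u, hu, huw⟩ := mem_closure_iff_seq_limit.1 (dJ' ⟨w, hw⟩)
      choose y hy using hu
      have hcau : CauchySeq fun n => B (y n) := by
        have hc := huw.cauchySeq
        rw [Metric.cauchySeq_iff] at hc ⊢
        intro ε hε
        obtain ⟨k, hk⟩ := hc ε hε
        refine ⟨k, fun m hm n hn => ?_⟩
        have := hk m hm n hn
        rwa [dist_eq_norm, ← hy, ← hy, ← map_sub, ← hiso, map_sub, ← dist_eq_norm] at this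
      obtain ⟨x, hx⟩ := cauchySeq_tendsto_of_complete hcau
      refine ⟨x, ?_⟩
      refine tendsto_nhds_unique ((B.continuous.tendsto x).comp hx) ?_
      have := (J.continuous.tendsto _).comp huw
      rw [hJ, jointGraphFst_apply, hw0] at this
      refine this.congr fun n => ?_
      simp only [Function.comp_apply]
      rw [← hy, aBB]

/-- The square root of a form sum of square moduli exists. -/
theorem exists_isSqrtSumSqModuli {N : Fin 3 → H →ₗ.[ℂ] H} (hN : ∀ l, (N l).IsClosed)
    (hd : Dense {ψ : H | ∀ l, ψ ∈ (N l).domain}) :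
    ∃ S, IsSqrtSumSqModuli N S ∧
      ((∀ (ψ : H) (φ : Fin 3 → H), (∀ l, (ψ, φ l) ∈ (N l).graph) →
        ‖ψ‖ ^ 2 ≤ ∑ l, ‖φ l‖ ^ 2) → OpLE opOne S) := by
  obtain ⟨R, h0, h1, hinj, -, hB⟩ := exists_form_resolvent hN hd
  obtain ⟨B, C, S, hBB, hBs, hn, hg, hsa, hpos, hge⟩ := exists_isSelfAdjoint_of_resolvent h0 h1 hinj
  obtain ⟨hB1, hB2⟩ := hB B hBB hBs
  have hdom : ∀ ψ : H, ψ ∈ S.domain ↔ ∀ l, ψ ∈ (N l).domain := by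
    intro ψ
    constructor
    · intro h l
      obtain ⟨x, rfl, -⟩ := (hg _ _).1 (mem_graph_mk h)
      obtain ⟨φ, hφ, -⟩ := hB1 x
      exact LinearPMap.mem_domain_of_mem_graph (hφ l)
    · intro h
      obtain ⟨x, rfl⟩ := hB2 ψ h
      exact LinearPMap.mem_domain_of_mem_graph ((hg _ _).2 ⟨x, rfl, rfl⟩)
  refine ⟨S, ⟨hsa, ⟨fun _ _ => trivial, fun ψ => ?_⟩, hdom, fun ψ h => ?_⟩, fun hN1 => ?_⟩
  · obtain ⟨x, hx1, hx2⟩ := (hg _ _).1 (mem_graph_mk ψ.2)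
    have e : S ψ = C x := hx2.symm
    rw [e, ← hx1]
    simpa using hpos x
  · obtain ⟨x, hx1, hx2⟩ := (hg _ _).1 (mem_graph_mk ψ.2)
    have e : S ψ = C x := hx2.symm
    obtain ⟨φ, hφ, hφn⟩ := hB1 x
    have e2 : ∀ l, N l ⟨ψ, h l⟩ = φ l := fun l => apply_eq_of_mem_graph (by rw [← hx1]; exact hφ l)
      _
    simp_rw [e2, e]
    linarith [hn x]
  · refine ⟨fun _ _ => trivial, fun ψ => ?_⟩
    obtain ⟨x, hx1, hx2⟩ := (hg _ _).1 (mem_graph_mk ψ.2)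
    have e : S ψ = C x := hx2.symm
    have := hge (fun y => ?_) x
    · rw [e, ← hx1]
      exact this
    · obtain ⟨φ, hφ, hφn⟩ := hB1 y
      -- `‖Cy‖²` is the form at `By`, so the lower bound of the form by `1` is exactly `‖By‖ ≤
      -- ‖Cy‖`.
      refine le_of_sq_le_sq ?_ (norm_nonneg _)
      have := hN1 _ _ hφ
      linarith [hn y]

/-- The square root of a form sum of square moduli is unique. -/
theorem isSqrtSumSqModuli_unique {N : Fin 3 → H →ₗ.[ℂ] H} (hN : ∀ l, (N l).IsClosed)
    (hd : Dense {ψ : H | ∀ l, ψ ∈ (N l).domain}) {S S' : H →ₗ.[ℂ] H}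
    (hS : IsSqrtSumSqModuli N S) (hS' : IsSqrtSumSqModuli N S') : S = S' := by
  obtain ⟨R, h0, h1, hinj, hR, -⟩ := exists_form_resolvent hN hd
  have symR : ∀ x y, inner ℂ (R x) y = inner ℂ x (R y) := fun x y =>
    ContinuousLinearMap.isSelfAdjoint_iff_isSymmetric.1 (IsSelfAdjoint.of_nonneg h0) x y
  -- The right side depends on the form only. Formally it is `S R = (R (1 - R))^{1/2}` with `R = (1
  -- + S²)⁻¹`.
  suffices key : ∀ S : H →ₗ.[ℂ] H, IsSqrtSumSqModuli N S → ∀ ψ φ, (ψ, φ) ∈ S.graph ↔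
      CFC.sqrt (R * (1 - R)) ψ = R φ by
    apply LinearPMap.eq_of_eq_graph
    ext ⟨ψ, φ⟩
    rw [key S hS, key S' hS']
  clear hS hS' S S'
  intro S hS
  -- This is `(1 + S²) R = 1`: the weak equation defining `R`, read through the selfadjointness of
  -- `S`.
  have hRS : ∀ x, ∃ y, (R x, y) ∈ S.graph ∧ (y, x - R x) ∈ S.graph := by
    intro x
    obtain ⟨φ, hφ, hφ2⟩ := hR x
    have hdom : R x ∈ S.domain :=
      (hS.domain_iff _).2 fun l => LinearPMap.mem_domain_of_mem_graph (hφ l)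
    refine ⟨S ⟨R x, hdom⟩, mem_graph_mk hdom, mem_graph_of_isSelfAdjoint hS.selfAdjoint ?_⟩
    intro a b hab
    have ha := (hS.domain_iff a).1 (LinearPMap.mem_domain_of_mem_graph hab)
    have e := inner_of_isSqrtSumSqModuli hS hab (mem_graph_mk hdom)
      (fun l => mem_graph_mk (ha l)) hφ
    rw [e, inner_sub_right, ← hφ2 a _ (fun l => mem_graph_mk (ha l))]
    abel
  choose E₀ hE1 hE2 using hRS
  have hE₀ : ∀ x, ‖E₀ x‖ ≤ ‖x‖ := by
    intro x
    have e1 := inner_eq_of_isSelfAdjoint hS.selfAdjoint (hE1 x) (hE2 x)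
    have e2 : ‖E₀ x‖ ^ 2 = (inner ℂ (R x) x).re - ‖R x‖ ^ 2 := by
      have := congrArg Complex.re e1
      rw [inner_sub_right, Complex.sub_re] at this
      have h2 : (inner ℂ (E₀ x) (E₀ x)).re = ‖E₀ x‖ ^ 2 := inner_self_eq_norm_sq (𝕜 := ℂ) (E₀ x)
      have h3 : (inner ℂ (R x) (R x)).re = ‖R x‖ ^ 2 := inner_self_eq_norm_sq (𝕜 := ℂ) (R x)
      rw [← h2, ← h3, this]
    have e3 : (inner ℂ (R x) x).re ≤ ‖R x‖ * ‖x‖ :=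
      (Complex.re_le_norm _).trans (norm_inner_le_norm _ _)
    refine le_of_sq_le_sq ?_ (norm_nonneg _)
    nlinarith [sq_nonneg (‖R x‖ - ‖x‖), sq_nonneg ‖R x‖, sq_nonneg ‖x‖]
  let E : H →L[ℂ] H := LinearMap.mkContinuous
    { toFun := E₀
      map_add' := fun x y => graph_unique (hE1 (x + y)) (by
        have := S.graph.add_mem (hE1 x) (hE1 y)
        rwa [Prod.mk_add_mk, ← map_add] at this)
      map_smul' := fun c x => graph_unique (hE1 (c • x)) (by
        have := S.graph.smul_mem c (hE1 x)
        rwa [Prod.smul_mk, ← map_smul] at this) } 1 (fun x => by simpa using hE₀ x)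
  have hE1' : ∀ x, (R x, E x) ∈ S.graph := hE1
  have hE2' : ∀ x, (E x, x - R x) ∈ S.graph := hE2
  have symE : ∀ x y, inner ℂ (E x) y = inner ℂ x (E y) := by
    intro x y
    have e1 := inner_eq_of_isSelfAdjoint hS.selfAdjoint (hE1' x) (hE1' y)
    have e2 := inner_eq_of_isSelfAdjoint hS.selfAdjoint (hE2' x) (hE2' y)
    rw [inner_sub_left, inner_sub_right, e1, sub_left_inj] at e2
    exact e2.symm
  have hEsa : IsSelfAdjoint E := ContinuousLinearMap.isSelfAdjoint_iff_isSymmetric.2 symE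
  have hnn : ∀ a b, (a, b) ∈ S.graph → 0 ≤ (inner ℂ a b).re := by
    intro a b hab
    obtain ⟨h, h'⟩ := hS.nonneg
    have hd := LinearPMap.mem_domain_of_mem_graph hab
    have := h' ⟨a, hd⟩
    rw [apply_eq_of_mem_graph hab] at this
    simpa using this
  -- `⟨Ex, x⟩` is the sum of `⟨Ex, Rx⟩` and `⟨Ex, x - Rx⟩`, whose real parts are nonnegative because
  -- `S` is; positivity selects the square root.
  have hEpos : 0 ≤ E := by
    rw [ContinuousLinearMap.nonneg_iff_isPositive, ContinuousLinearMap.isPositive_def']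
    refine ⟨hEsa, fun x => ?_⟩
    have h1 := hnn _ _ (hE1' x)
    have h2 := hnn _ _ (hE2' x)
    rw [inner_sub_right, Complex.sub_re] at h2
    have h3 : (inner ℂ (E x) (R x)).re = (inner ℂ (R x) (E x)).re := by
      rw [← inner_conj_symm]; exact Complex.conj_re _
    change 0 ≤ (inner ℂ (E x) x).re
    linarith
  have hRE : ∀ ψ φ, (ψ, φ) ∈ S.graph → E ψ = R φ := by
    intro ψ φ h
    refine ext_inner_left ℂ fun x => ?_
    rw [← symE, ← symR]
    exact inner_eq_of_isSelfAdjoint hS.selfAdjoint (hE1' x) h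
  have hEE : E * E = R * (1 - R) := by
    ext x
    exact hRE _ _ (hE2' x)
  have hsq : CFC.sqrt (R * (1 - R)) = E := CFC.sqrt_unique hEE hEpos
  rw [hsq]
  intro ψ φ
  refine ⟨hRE ψ φ, fun h => ?_⟩
  -- The orthogonal projection onto the graph of `S` has the entries `R`, `E`, `E`, `1 - R`; the
  -- equation `E ψ = R φ` says that it fixes `(ψ, φ)`.
  have h1 : (ψ, φ) = (R ψ, E ψ) + (E φ, φ - R φ) := by
    have h2 : E (E ψ) = R (ψ - R ψ) := hRE _ _ (hE2' ψ)
    have h3 : E (R φ) = R (E φ) := hRE _ _ (hE1' φ)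
    have h4 : R ψ + E φ = ψ := by
      apply hinj
      rw [map_add, ← h3, ← h, h2, map_sub]
      abel
    rw [Prod.mk_add_mk, h4, h]
    congr 1
    abel
  rw [h1]
  exact S.graph.add_mem (hE1' ψ) (hE2' φ)

/-- The square of the square root extends the operator sum. -/
theorem sumSqModuli_le_opMul {N : Fin 3 → H →ₗ.[ℂ] H} (hN : ∀ l, Dense ((N l).domain : Set H))
    {S : H →ₗ.[ℂ] H} (hS : IsSqrtSumSqModuli N S) : sumSqModuli N ≤ opMul S S := by
  apply LinearPMap.le_of_le_graph
  rintro ⟨ψ, χ⟩ h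
  obtain ⟨c, hc, rfl⟩ := exists_of_mem_graph_sum _ h
  choose β hβ hβ2 using fun l => mem_graph_opMul.1 (hc l (Finset.mem_univ l))
  have hdom : ψ ∈ S.domain :=
    (hS.domain_iff _).2 fun l => LinearPMap.mem_domain_of_mem_graph (hβ l)
  refine mem_graph_opMul.2 ⟨_, mem_graph_mk hdom, mem_graph_of_isSelfAdjoint hS.selfAdjoint ?_⟩
  intro a b hab
  have ha := (hS.domain_iff a).1 (LinearPMap.mem_domain_of_mem_graph hab)
  rw [inner_of_isSqrtSumSqModuli hS hab (mem_graph_mk hdom) (fun l => mem_graph_mk (ha l)) hβ,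
    inner_sum]
  exact Finset.sum_congr rfl fun l _ =>
    (mem_graph_adjoint (hN l)).1 (hβ2 l) _ _ (mem_graph_mk (ha l))

end Existence

end SquareRoot

end QST

end

/-! ### Closedness of generators and the functional calculus of the centre. -/

noncomputable section

namespace QST

open Filter Topology

section Generators

variable {H : Type*} [NormedAddCommGroup H] [InnerProductSpace ℂ H]

/-! ### Generators of one-parameter groups -/

theorem hasDerivAt_of_mem_graph_generator {U : ℝ → H →L[ℂ] H}
    (hadd : ∀ s t ψ, U (s + t) ψ = U s (U t ψ)) {ψ φ : H} (h : (ψ, φ) ∈ (generator U).graph)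
    (t : ℝ) : HasDerivAt (fun s => U s ψ) (U t (Complex.I • φ)) t := by
  rw [mem_graph_generator] at h
  have h0 : HasDerivAt (fun s => U s ψ) (Complex.I • φ) (t - t) := by simpa using h
  have h1 := h0.comp_sub_const t t
  have h2 := ((U t).restrictScalars ℝ).hasFDerivAt.comp_hasDerivAt t h1
  refine h2.congr_of_eventuallyEq (Eventually.of_forall fun s => ?_)
  simp only [Function.comp_apply, ContinuousLinearMap.coe_restrictScalars']
  rw [← hadd]
  congr 2
  ring

/-- The generator of a strongly continuous group of contractions is closed. -/
theorem isClosed_generator {U : ℝ → H →L[ℂ] H} (hadd : ∀ s t ψ, U (s + t) ψ = U s (U t ψ))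
    (h0 : ∀ ψ, U 0 ψ = ψ) (hn : ∀ t ψ, ‖U t ψ‖ ≤ ‖ψ‖) (hc : ∀ ψ, Continuous fun t => U t ψ) :
    (generator U).IsClosed := by
  refine IsSeqClosed.isClosed ?_
  rintro p ⟨ψ, φ⟩ hp hlim
  have hψ : Tendsto (fun n => (p n).1) atTop (𝓝 ψ) := (continuous_fst.tendsto _).comp hlim
  have hφ : Tendsto (fun n => (p n).2) atTop (𝓝 φ) := (continuous_snd.tendsto _).comp hlim
  change (ψ, φ) ∈ (generator U).graph
  rw [mem_graph_generator, hasDerivAt_iff_isLittleO, Asymptotics.isLittleO_iff]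
  intro ε hε
  have hcont : ContinuousAt (fun t => U t φ) 0 := (hc φ).continuousAt
  rw [Metric.continuousAt_iff] at hcont
  obtain ⟨δ, hδ, hδε⟩ := hcont ε hε
  filter_upwards [Metric.ball_mem_nhds (0 : ℝ) hδ] with t ht
  -- Mean value inequality for the orbit of the `n`-th vector. The bound is uniform in `n` up to
  -- `‖φ_n - φ‖`, so it survives the limit and gives differentiability of the limit orbit.
  have key : ∀ n, ‖(U t (p n).1 - t • (Complex.I • φ)) - (U 0 (p n).1 - (0 : ℝ) • (Complex.I • φ))‖
    ≤
      (‖(p n).2 - φ‖ + ε) * ‖t - 0‖ := by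
    intro n
    refine (convex_ball (0 : ℝ) δ).norm_image_sub_le_of_norm_hasDerivWithin_le
      (f := fun s => U s (p n).1 - s • (Complex.I • φ))
      (f' := fun s => U s (Complex.I • (p n).2) - (1 : ℝ) • (Complex.I • φ)) ?_ ?_
      (Metric.mem_ball_self hδ) ht
    · intro s _
      exact ((hasDerivAt_of_mem_graph_generator hadd (hp n) s).sub
        ((hasDerivAt_id s).smul_const (Complex.I • φ))).hasDerivWithinAt
    · intro s hs
      have e : U s (Complex.I • (p n).2) - (1 : ℝ) • (Complex.I • φ) =
          Complex.I • (U s ((p n).2 - φ) + (U s φ - U 0 φ)) := by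
        rw [h0, one_smul, map_smul, map_sub, ← smul_sub]
        congr 1
        abel
      rw [e, norm_smul, Complex.norm_I, one_mul]
      refine (norm_add_le _ _).trans (add_le_add (hn _ _) ?_)
      have := hδε (Metric.mem_ball.1 hs)
      rw [dist_eq_norm] at this
      exact this.le
  have lim1 : Tendsto (fun n => ‖(U t (p n).1 - t • (Complex.I • φ)) -
      (U 0 (p n).1 - (0 : ℝ) • (Complex.I • φ))‖) atTop
      (𝓝 ‖(U t ψ - t • (Complex.I • φ)) - (U 0 ψ - (0 : ℝ) • (Complex.I • φ))‖) := by
    refine Tendsto.norm (Tendsto.sub (Tendsto.sub ?_ tendsto_const_nhds)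
      (Tendsto.sub ?_ tendsto_const_nhds))
    · exact ((U t).continuous.tendsto ψ).comp hψ
    · exact ((U 0).continuous.tendsto ψ).comp hψ
  have lim2 : Tendsto (fun n => (‖(p n).2 - φ‖ + ε) * ‖t - 0‖) atTop
      (𝓝 ((‖φ - φ‖ + ε) * ‖t - 0‖)) :=
    ((((hφ.sub tendsto_const_nhds).norm).add tendsto_const_nhds).mul tendsto_const_nhds)
  have := le_of_tendsto_of_tendsto' lim1 lim2 key
  rw [sub_self, norm_zero, zero_add] at this
  refine le_trans (le_of_eq ?_) this
  congr 1
  rw [zero_smul, sub_zero, sub_zero]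
  abel

theorem closure_eq_self {A : H →ₗ.[ℂ] H} (hA : A.IsClosed) : A.closure = A := by
  apply LinearPMap.eq_of_eq_graph
  rw [← hA.isClosable.graph_closure_eq_closure_graph]
  exact IsClosed.submodule_topologicalClosure_eq hA

/-- Strong convergence of contractions may be tested on a total set. -/
theorem tendsto_of_dense_span {ι : Type*} {l : Filter ι} {F : ι → H →L[ℂ] H} {F₀ : H →L[ℂ] H}
    (hF : ∀ i ψ, ‖F i ψ‖ ≤ ‖ψ‖) (hF₀ : ∀ ψ, ‖F₀ ψ‖ ≤ ‖ψ‖) {s : Set H}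
    (hs : Dense (Submodule.span ℂ s : Set H))
    (h : ∀ ψ ∈ s, Tendsto (fun i => F i ψ) l (𝓝 (F₀ ψ))) (ψ : H) :
    Tendsto (fun i => F i ψ) l (𝓝 (F₀ ψ)) := by
  have hspan : ∀ χ ∈ Submodule.span ℂ s, Tendsto (fun i => F i χ) l (𝓝 (F₀ χ)) := by
    intro χ hχ
    induction hχ using Submodule.span_induction with
    | mem x hx => exact h x hx
    | zero => simpa using tendsto_const_nhds
    | add x y _ _ hx hy => simpa using hx.add hy
    | smul c x _ hx => simpa using hx.const_smul c
  rw [Metric.tendsto_nhds]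
  intro ε hε
  obtain ⟨χ, hχ, hd⟩ := hs.exists_dist_lt ψ (show 0 < ε / 3 by positivity)
  filter_upwards [(Metric.tendsto_nhds.1 (hspan χ hχ)) (ε / 3) (by positivity)] with i hi
  have h1 : dist (F i ψ) (F i χ) ≤ dist ψ χ := by
    rw [dist_eq_norm, dist_eq_norm, ← map_sub]; exact hF _ _
  have h2 : dist (F₀ χ) (F₀ ψ) ≤ dist ψ χ := by
    rw [dist_comm, dist_eq_norm, dist_eq_norm, ← map_sub]; exact hF₀ _
  calc dist (F i ψ) (F₀ ψ) ≤ dist (F i ψ) (F i χ) + dist (F i χ) (F₀ χ) + dist (F₀ χ) (F₀ ψ) :=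
        dist_triangle4 _ _ _ _
    _ < ε := by linarith

end Generators

/-! ### Functions on `Σ` -/

theorem expI_apply (g : C(Sig, ℝ)) (σ : Sig) : expI g σ = Complex.exp ((g σ : ℂ) * Complex.I) := rfl

theorem expI_zero : expI 0 = 1 := by
  ext σ
  simp [expI_apply]

theorem expI_add (g h : C(Sig, ℝ)) : expI (g + h) = expI g * expI h := by
  ext σ
  rw [BoundedContinuousFunction.mul_apply]
  simp only [expI_apply, ContinuousMap.add_apply, Complex.ofReal_add, add_mul, Complex.exp_add]

theorem star_expI (g : C(Sig, ℝ)) : star (expI g) = expI (-g) := by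
  ext σ
  rw [BoundedContinuousFunction.star_apply, expI_apply, expI_apply, Complex.star_def,
    ← Complex.exp_conj]
  simp

theorem norm_expI_le (g : C(Sig, ℝ)) : ‖expI g‖ ≤ 1 :=
  (BoundedContinuousFunction.norm_le zero_le_one).2 fun σ =>
    (Complex.norm_exp_ofReal_mul_I (g σ)).le

/-- Boundedness of a real function on `Σ`. -/
def BddFun (k : C(Sig, ℝ)) : Prop := ∃ C, ∀ σ, |k σ| ≤ C

theorem BddFun.mul {k k' : C(Sig, ℝ)} (h : BddFun k) (h' : BddFun k') : BddFun (k * k') := by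
  obtain ⟨C, hC⟩ := h
  obtain ⟨C', hC'⟩ := h'
  refine ⟨C * C', fun σ => ?_⟩
  rw [ContinuousMap.mul_apply, abs_mul]
  exact mul_le_mul (hC σ) (hC' σ) (abs_nonneg _) ((abs_nonneg _).trans (hC σ))

theorem BddFun.sub {k k' : C(Sig, ℝ)} (h : BddFun k) (h' : BddFun k') : BddFun (k - k') := by
  obtain ⟨C, hC⟩ := h
  obtain ⟨C', hC'⟩ := h'
  exact ⟨C + C', fun σ => (abs_sub _ _).trans (add_le_add (hC σ) (hC' σ))⟩

theorem BddFun.add {k k' : C(Sig, ℝ)} (h : BddFun k) (h' : BddFun k') : BddFun (k + k') := by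
  obtain ⟨C, hC⟩ := h
  obtain ⟨C', hC'⟩ := h'
  exact ⟨C + C', fun σ => (abs_add_le _ _).trans (add_le_add (hC σ) (hC' σ))⟩

/-- If `p` is bounded on the support of the bounded function `k`, then `p k` is bounded. -/
theorem BddFun.mul_of_support {k p : C(Sig, ℝ)} (h : BddFun k) {C : ℝ}
    (hp : ∀ σ, k σ ≠ 0 → |p σ| ≤ C) : BddFun (p * k) := by
  obtain ⟨D, hD⟩ := h
  refine ⟨|C| * D, fun σ => ?_⟩
  rw [ContinuousMap.mul_apply, abs_mul]
  by_cases h0 : k σ = 0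
  · rw [h0, abs_zero, mul_zero]
    exact mul_nonneg (abs_nonneg _) ((abs_nonneg _).trans (hD σ))
  · exact mul_le_mul ((hp σ h0).trans (le_abs_self C)) (hD σ) (abs_nonneg _) (abs_nonneg _)

open Classical in
/-- A bounded real function as a bounded continuous complex function (and `0` if unbounded). -/
def toBCF (k : C(Sig, ℝ)) : BoundedContinuousFunction Sig ℂ :=
  if h : BddFun k then BoundedContinuousFunction.ofNormedAddCommGroup
    (fun σ => (k σ : ℂ)) (by fun_prop) h.choose
    (fun σ => by rw [Complex.norm_real]; exact h.choose_spec σ) else 0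

theorem toBCF_apply {k : C(Sig, ℝ)} (h : BddFun k) (σ : Sig) : toBCF k σ = (k σ : ℂ) := by
  rw [toBCF, dif_pos h]
  rfl

theorem toBCF_mul {k k' : C(Sig, ℝ)} (h : BddFun k) (h' : BddFun k') :
    toBCF (k * k') = toBCF k * toBCF k' := by
  ext σ
  rw [BoundedContinuousFunction.mul_apply, toBCF_apply (h.mul h'), toBCF_apply h, toBCF_apply h',
    ContinuousMap.mul_apply, Complex.ofReal_mul]

theorem toBCF_sub {k k' : C(Sig, ℝ)} (h : BddFun k) (h' : BddFun k') :
    toBCF (k - k') = toBCF k - toBCF k' := by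
  ext σ
  rw [BoundedContinuousFunction.sub_apply, toBCF_apply (h.sub h'), toBCF_apply h, toBCF_apply h',
    ContinuousMap.sub_apply, Complex.ofReal_sub]

theorem star_toBCF {k : C(Sig, ℝ)} (h : BddFun k) : star (toBCF k) = toBCF k := by
  ext σ
  rw [BoundedContinuousFunction.star_apply, toBCF_apply h]
  simp

/-- The cutoff function `max 0 (min 1 (n + 1 - |g|))`. -/
def cutoff (g : C(Sig, ℝ)) (n : ℕ) : C(Sig, ℝ) where
  toFun σ := max 0 (min 1 (n + 1 - |g σ|))
  continuous_toFun := by fun_prop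

theorem abs_cutoff_le (g : C(Sig, ℝ)) (n : ℕ) (σ : Sig) : |cutoff g n σ| ≤ 1 := by
  change |max 0 (min 1 ((n : ℝ) + 1 - |g σ|))| ≤ 1
  rw [abs_of_nonneg (le_max_left _ _)]
  exact max_le zero_le_one (min_le_left _ _)

theorem bddFun_cutoff (g : C(Sig, ℝ)) (n : ℕ) : BddFun (cutoff g n) := ⟨1, abs_cutoff_le g n⟩

theorem cutoff_support {g : C(Sig, ℝ)} {n : ℕ} {σ : Sig} (h : cutoff g n σ ≠ 0) :
    |g σ| ≤ n + 1 := by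
  by_contra hlt
  push Not at hlt
  refine h (max_eq_left ((min_le_right _ _).trans ?_))
  linarith

theorem cutoff_eq_one {g : C(Sig, ℝ)} {n : ℕ} {σ : Sig} (h : |g σ| ≤ n) : cutoff g n σ = 1 := by
  change max 0 (min 1 ((n : ℝ) + 1 - |g σ|)) = 1
  rw [min_eq_left (by linarith), max_eq_right zero_le_one]

/-! ### Central operators -/

namespace EventRep

variable {n : ℕ} {H : Type*} [NormedAddCommGroup H] [InnerProductSpace ℂ H] [CompleteSpace H]
  (ρ : EventRep n H)

theorem norm_Z_apply_le (f : BoundedContinuousFunction Sig ℂ) (ψ : H) :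
    ‖ρ.Z f ψ‖ ≤ ‖f‖ * ‖ψ‖ :=
  (ρ.Z f).le_of_opNorm_le (NonUnitalStarAlgHom.norm_apply_le ρ.Z f) ψ

theorem norm_Z_expI_apply_le (g : C(Sig, ℝ)) (ψ : H) : ‖ρ.Z (expI g) ψ‖ ≤ ‖ψ‖ :=
  (ρ.norm_Z_apply_le _ ψ).trans (mul_le_of_le_one_left (norm_nonneg _) (norm_expI_le g))

theorem Z_mul_apply (f g : BoundedContinuousFunction Sig ℂ) (ψ : H) :
    ρ.Z (f * g) ψ = ρ.Z f (ρ.Z g ψ) := by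
  rw [map_mul]; rfl

theorem Z_comm (f g : BoundedContinuousFunction Sig ℂ) (ψ : H) :
    ρ.Z f (ρ.Z g ψ) = ρ.Z g (ρ.Z f ψ) := by
  rw [← Z_mul_apply, mul_comm, Z_mul_apply]

theorem inner_Z_left (f : BoundedContinuousFunction Sig ℂ) (ψ φ : H) :
    inner ℂ (ρ.Z f ψ) φ = inner ℂ ψ (ρ.Z (star f) φ) := by
  rw [map_star, ContinuousLinearMap.star_eq_adjoint, ContinuousLinearMap.adjoint_inner_right]

theorem Z_expI_zero (ψ : H) : ρ.Z (expI 0) ψ = ψ := by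
  rw [expI_zero, map_one]; rfl

theorem Z_expI_add (g h : C(Sig, ℝ)) (ψ : H) :
    ρ.Z (expI (g + h)) ψ = ρ.Z (expI g) (ρ.Z (expI h) ψ) := by
  rw [expI_add, Z_mul_apply]

/-- Strong continuity of `g ↦ e^{i g}(Q)` for locally uniform convergence of `g`. -/
theorem continuous_Z_expI {X : Type*} [TopologicalSpace X] {g : X → C(Sig, ℝ)}
    (hg : Continuous g) (ψ : H) : Continuous fun x => ρ.Z (expI (g x)) ψ := by
  rw [continuous_iff_continuousAt]
  intro x₀
  refine tendsto_of_dense_span (fun x => ρ.norm_Z_expI_apply_le (g x))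
    (ρ.norm_Z_expI_apply_le (g x₀)) ρ.Z_nondegenerate ?_ ψ
  rintro _ ⟨f, χ, hf, rfl⟩
  rw [Metric.tendsto_nhds]
  intro ε hε
  -- Nondegeneracy enters here: on the total set of vectors `f(Q) χ` with `f` of compact support,
  -- only uniform convergence on that support matters.
  have hu := ContinuousMap.tendsto_iff_forall_isCompact_tendstoUniformlyOn.1 (hg.tendsto x₀)
    (tsupport f) hf
  have hM : 0 < ‖f‖ * ‖χ‖ + 1 := by positivity
  rw [Metric.tendstoUniformlyOn_iff] at hu
  filter_upwards [hu (ε / (‖f‖ * ‖χ‖ + 1)) (by positivity)] with x hx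
  rw [dist_eq_norm, ← Z_mul_apply, ← Z_mul_apply, ← _root_.sub_apply, ← map_sub, ← sub_mul]
  have hb : ‖(expI (g x) - expI (g x₀)) * f‖ ≤ ε / (‖f‖ * ‖χ‖ + 1) * ‖f‖ := by
    refine (BoundedContinuousFunction.norm_le (by positivity)).2 fun σ => ?_
    rw [BoundedContinuousFunction.mul_apply, norm_mul]
    by_cases hσ : σ ∈ tsupport f
    · refine mul_le_mul ?_ (f.norm_coe_le_norm σ) (norm_nonneg _) (by positivity)
      have h1 := hx σ hσ
      rw [dist_comm, Real.dist_eq] at h1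
      rw [BoundedContinuousFunction.sub_apply, expI_apply, expI_apply]
      have e : Complex.exp ((g x σ : ℂ) * Complex.I) - Complex.exp ((g x₀ σ : ℂ) * Complex.I) =
          Complex.exp ((g x₀ σ : ℂ) * Complex.I) *
            (Complex.exp (Complex.I * ((g x σ - g x₀ σ : ℝ) : ℂ)) - 1) := by
        rw [mul_sub, ← Complex.exp_add, mul_one]
        congr 2
        push_cast
        ring
      rw [e, norm_mul, Complex.norm_exp_ofReal_mul_I, one_mul]
      exact (Real.norm_exp_I_mul_ofReal_sub_one_le).trans h1.le
    · rw [image_eq_zero_of_notMem_tsupport hσ, norm_zero, mul_zero]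
      positivity
  calc _ ≤ ‖(expI (g x) - expI (g x₀)) * f‖ * ‖χ‖ := ρ.norm_Z_apply_le _ _
    _ ≤ ε / (‖f‖ * ‖χ‖ + 1) * ‖f‖ * ‖χ‖ := mul_le_mul_of_nonneg_right hb (norm_nonneg _)
    _ < ε := by
      rw [mul_assoc, div_mul_eq_mul_div, div_lt_iff₀ hM]
      nlinarith

/-- The bounded operator `k(Q)` for a bounded real function `k`. -/
def zr (k : C(Sig, ℝ)) : H →L[ℂ] H := ρ.Z (toBCF k)

theorem zr_mul {k k' : C(Sig, ℝ)} (h : BddFun k) (h' : BddFun k') (ψ : H) :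
    ρ.zr (k * k') ψ = ρ.zr k (ρ.zr k' ψ) := by
  rw [zr, toBCF_mul h h', Z_mul_apply]; rfl

theorem zr_sub {k k' : C(Sig, ℝ)} (h : BddFun k) (h' : BddFun k') (ψ : H) :
    ρ.zr (k - k') ψ = ρ.zr k ψ - ρ.zr k' ψ := by
  rw [zr, toBCF_sub h h', map_sub]; rfl

theorem inner_zr {k : C(Sig, ℝ)} (h : BddFun k) (ψ φ : H) :
    inner ℂ (ρ.zr k ψ) φ = inner ℂ ψ (ρ.zr k φ) := by
  rw [zr, inner_Z_left, star_toBCF h]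

theorem norm_zr_le {k : C(Sig, ℝ)} (h : ∀ σ, |k σ| ≤ 1) (ψ : H) : ‖ρ.zr k ψ‖ ≤ ‖ψ‖ := by
  refine (ρ.norm_Z_apply_le _ ψ).trans (mul_le_of_le_one_left (norm_nonneg _) ?_)
  refine (BoundedContinuousFunction.norm_le zero_le_one).2 fun σ => ?_
  rw [toBCF_apply ⟨1, h⟩, Complex.norm_real]
  exact h σ

/-- On `f(Q) χ` with `f` of compact support the sequence is eventually constant, since `g` is
bounded on the support. -/
theorem tendsto_zr_cutoff (g : C(Sig, ℝ)) (ψ : H) :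
    Tendsto (fun m => ρ.zr (cutoff g m) ψ) atTop (𝓝 ψ) := by
  refine tendsto_of_dense_span (F₀ := ContinuousLinearMap.id ℂ H)
    (fun m => ρ.norm_zr_le (abs_cutoff_le g m)) (fun _ => le_rfl) ρ.Z_nondegenerate ?_ ψ
  rintro _ ⟨f, χ, hf, rfl⟩
  obtain ⟨C, hC⟩ := hf.exists_bound_of_continuousOn (f := g) g.continuous.continuousOn
  obtain ⟨N, hN⟩ := exists_nat_ge C
  refine tendsto_const_nhds.congr' ?_
  filter_upwards [eventually_ge_atTop N] with m hm
  rw [zr, ← Z_mul_apply, ContinuousLinearMap.id_apply]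
  congr 2
  ext σ
  rw [BoundedContinuousFunction.mul_apply, toBCF_apply (bddFun_cutoff g m)]
  by_cases hσ : σ ∈ tsupport f
  · have h1 : |g σ| ≤ m := (hC σ hσ).trans (hN.trans (by exact_mod_cast hm))
    rw [cutoff_eq_one h1, Complex.ofReal_one, one_mul]
  · rw [image_eq_zero_of_notMem_tsupport hσ, mul_zero]

/-- On vectors `k(Q) ψ`, with `g` bounded on the support of `k`, the operator `g(Q)` acts by
`(g k)(Q) ψ`. -/
theorem zr_mem_graph_centralOp {g k : C(Sig, ℝ)} (hk : BddFun k) {C : ℝ}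
    (hC : ∀ σ, k σ ≠ 0 → |g σ| ≤ C) (ψ : H) :
    (ρ.zr k ψ, ρ.zr (g * k) ψ) ∈ (ρ.centralOp g).graph := by
  rw [centralOp, mem_graph_generator, hasDerivAt_iff_isLittleO]
  have hgk : BddFun (g * k) := hk.mul_of_support hC
  obtain ⟨D, hD⟩ := id hk
  have hD0 : 0 ≤ |D| := abs_nonneg D
  -- The quadratic Taylor remainder of `e^{i t g}`, uniform on the support of `k`; the restriction
  -- on `t` is the one required by the bound for `exp`.
  have hest : ∀ t : ℝ, |t| * |C| ≤ 1 →
      ‖ρ.Z (expI (t • g)) (ρ.zr k ψ) - ρ.Z (expI ((0 : ℝ) • g)) (ρ.zr k ψ) -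
        (t - 0) • Complex.I • ρ.zr (g * k) ψ‖ ≤ (|C| ^ 2 * |D| * ‖ψ‖) * ‖t ^ 2‖ := by
    intro t ht
    have e : ρ.Z (expI (t • g)) (ρ.zr k ψ) - ρ.Z (expI ((0 : ℝ) • g)) (ρ.zr k ψ) -
        (t - 0) • Complex.I • ρ.zr (g * k) ψ =
        ρ.Z (expI (t • g) * toBCF k - toBCF k - ((t : ℂ) * Complex.I) • toBCF (g * k)) ψ := by
      rw [zero_smul, Z_expI_zero, sub_zero, map_sub, map_sub, map_smul, _root_.sub_apply,
        _root_.sub_apply, Z_mul_apply, _root_.smul_apply, mul_smul]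
      rfl
    rw [e]
    refine (ρ.norm_Z_apply_le _ ψ).trans ?_
    have hb : ‖expI (t • g) * toBCF k - toBCF k - ((t : ℂ) * Complex.I) • toBCF (g * k)‖ ≤
        |C| ^ 2 * |D| * ‖t ^ 2‖ := by
      refine (BoundedContinuousFunction.norm_le (by positivity)).2 fun σ => ?_
      rw [BoundedContinuousFunction.sub_apply, BoundedContinuousFunction.sub_apply,
        BoundedContinuousFunction.mul_apply, BoundedContinuousFunction.smul_apply,
        toBCF_apply hk, toBCF_apply hgk, expI_apply, ContinuousMap.mul_apply]
      by_cases h0 : k σ = 0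
      · rw [h0]
        simp only [mul_zero, Complex.ofReal_zero, smul_zero, sub_zero, norm_zero]
        positivity
      have hg : |g σ| ≤ |C| := (hC σ h0).trans (le_abs_self C)
      have hx : ‖((t * g σ : ℝ) : ℂ) * Complex.I‖ ≤ |t| * |C| := by
        rw [norm_mul, Complex.norm_I, mul_one, Complex.norm_real, Real.norm_eq_abs, abs_mul]
        exact mul_le_mul_of_nonneg_left hg (abs_nonneg _)
      have hexp := Complex.norm_exp_sub_one_sub_id_le (hx.trans ht)
      have e2 : Complex.exp (((t • g) σ : ℝ) * Complex.I) * (k σ : ℂ) - (k σ : ℂ) -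
          ((t : ℂ) * Complex.I) • ((g σ * k σ : ℝ) : ℂ) =
          (Complex.exp (((t * g σ : ℝ) : ℂ) * Complex.I) - 1 -
            ((t * g σ : ℝ) : ℂ) * Complex.I) * (k σ : ℂ) := by
        rw [ContinuousMap.smul_apply, smul_eq_mul, smul_eq_mul]
        push_cast
        ring
      rw [e2, norm_mul, Complex.norm_real, Real.norm_eq_abs]
      calc _ ≤ (|t| * |C|) ^ 2 * |D| := mul_le_mul
            (hexp.trans (pow_le_pow_left₀ (norm_nonneg _) hx 2))
            ((hD σ).trans (le_abs_self D)) (abs_nonneg _) (by positivity)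
        _ = |C| ^ 2 * |D| * ‖t ^ 2‖ := by
            rw [norm_pow, Real.norm_eq_abs]; ring
    calc _ ≤ |C| ^ 2 * |D| * ‖t ^ 2‖ * ‖ψ‖ := mul_le_mul_of_nonneg_right hb (norm_nonneg _)
      _ = _ := by ring
  have hO : (fun t : ℝ => ρ.Z (expI (t • g)) (ρ.zr k ψ) - ρ.Z (expI ((0 : ℝ) • g)) (ρ.zr k ψ) -
        (t - 0) • Complex.I • ρ.zr (g * k) ψ) =O[𝓝 0] fun t : ℝ => t ^ 2 := by
    refine Asymptotics.IsBigO.of_bound (|C| ^ 2 * |D| * ‖ψ‖) ?_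
    have hcont : ContinuousAt (fun t : ℝ => |t| * |C|) 0 := by fun_prop
    have hev : ∀ᶠ t : ℝ in 𝓝 0, |t| * |C| < 1 :=
      hcont.eventually_lt continuousAt_const (by simp)
    filter_upwards [hev] with t ht
    exact hest t ht.le
  refine hO.trans_isLittleO ?_
  simpa using Asymptotics.isLittleO_pow_id (𝕜 := ℝ) (n := 2) one_lt_two

theorem commutesWith_Z_centralOp (f : BoundedContinuousFunction Sig ℂ) (g : C(Sig, ℝ)) :
    CommutesWith (ρ.Z f) (ρ.centralOp g) :=
  CommutesWith.generator fun t ψ => ρ.Z_comm f (expI (t • g)) ψ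

theorem zr_eq_of_mem_graph_centralOp {g k : C(Sig, ℝ)} (hk : BddFun k) {C : ℝ}
    (hC : ∀ σ, k σ ≠ 0 → |g σ| ≤ C) {ψ φ : H} (h : (ψ, φ) ∈ (ρ.centralOp g).graph) :
    ρ.zr (g * k) ψ = ρ.zr k φ :=
  graph_unique (ρ.zr_mem_graph_centralOp hk hC ψ) (ρ.commutesWith_Z_centralOp _ g _ _ h)

theorem isClosed_centralOp (g : C(Sig, ℝ)) : (ρ.centralOp g).IsClosed := by
  refine isClosed_generator (fun s t ψ => ?_) (fun ψ => ?_)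
    (fun t => ρ.norm_Z_expI_apply_le (t • g)) (fun ψ => ρ.continuous_Z_expI (by fun_prop) ψ)
  · rw [add_smul, Z_expI_add]
  · rw [zero_smul, Z_expI_zero]

/-- Spectral cutoffs mollify any central operator; since the operator is already closed, this gives
its selfadjointness. -/
theorem mollified_centralOp (g : C(Sig, ℝ)) : Mollified (ρ.centralOp g)
    (fun m => ρ.zr (cutoff g m)) (fun m => ρ.zr (g * cutoff g m))
    (fun m => ρ.zr (g * cutoff g m)) where
  symm m := ρ.inner_zr (bddFun_cutoff g m)
  adj m := ρ.inner_zr ((bddFun_cutoff g m).mul_of_support fun _ => cutoff_support)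
  tendsto := ρ.tendsto_zr_cutoff g
  mem m ψ := ρ.zr_mem_graph_centralOp (bddFun_cutoff g m) (fun _ => cutoff_support) ψ
  comm m _ _ h := ρ.zr_eq_of_mem_graph_centralOp (bddFun_cutoff g m) (fun _ => cutoff_support) h

theorem isSelfAdjoint_centralOp (g : C(Sig, ℝ)) : IsSelfAdjoint (ρ.centralOp g) := by
  have := (ρ.mollified_centralOp g).isSelfAdjoint_closure
  rwa [closure_eq_self (ρ.isClosed_centralOp g)] at this

end EventRep

end QST

end

noncomputable section

namespace QST

open Filter Topology

namespace EventRep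

variable {n : ℕ} {H : Type*} [NormedAddCommGroup H] [InnerProductSpace ℂ H] [CompleteSpace H]
  (ρ : EventRep n H)

/-! ### Central lower bounds -/

theorem norm_sq_eq_re_inner {E : Type*} [NormedAddCommGroup E] [InnerProductSpace ℂ E] (ψ : E) :
    ‖ψ‖ ^ 2 = (inner ℂ ψ ψ).re :=
  (inner_self_eq_norm_sq (𝕜 := ℂ) ψ).symm

theorem zr_add {k k' : C(Sig, ℝ)} (h : BddFun k) (h' : BddFun k') (ψ : H) :
    ρ.zr (k + k') ψ = ρ.zr k ψ + ρ.zr k' ψ := by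
  have := ρ.zr_sub (h.add h') h' ψ
  rw [add_sub_cancel_right] at this
  rw [this, sub_add_cancel]

/-- `√g` as a function on `Σ`. -/
def sqrtFun (g : C(Sig, ℝ)) : C(Sig, ℝ) := ⟨fun σ => √(g σ), by fun_prop⟩

variable {g : Fin 3 → C(Sig, ℝ)}

theorem sumSq_apply (g : Fin 3 → C(Sig, ℝ)) (σ : Sig) :
    (∑ l, g l ^ 2) σ = g 0 σ ^ 2 + g 1 σ ^ 2 + g 2 σ ^ 2 := by
  rw [Fin.sum_univ_three]; rfl

theorem sumSq_nonneg (g : Fin 3 → C(Sig, ℝ)) (σ : Sig) : 0 ≤ (∑ l, g l ^ 2) σ := by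
  rw [sumSq_apply]; positivity

/-- Uses `|x| ≤ 1 + x²`, which avoids a square root in the bound. -/
theorem abs_le_of_sumSq_le {C : ℝ} {σ : Sig} (h : |(∑ l, g l ^ 2) σ| ≤ C) (l : Fin 3) :
    |g l σ| ≤ 1 + C := by
  have h1 : g l σ ^ 2 ≤ C := by
    refine le_trans ?_ ((le_abs_self _).trans h)
    rw [sumSq_apply]
    fin_cases l <;> simp <;> nlinarith [sq_nonneg (g 0 σ), sq_nonneg (g 1 σ), sq_nonneg (g 2 σ)]
  rw [← sq_abs] at h1
  nlinarith [sq_nonneg (|g l σ| - 1), abs_nonneg (g l σ)]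

/-- All functions involved are bounded on the support of `h`, so the identity is `∑ (g l h)² = (∑ g
l²) h · h` in the bounded calculus. -/
theorem sum_norm_sq_zr {h : C(Sig, ℝ)} (hh : BddFun h) {C : ℝ}
    (hC : ∀ σ, h σ ≠ 0 → |(∑ l, g l ^ 2) σ| ≤ C) (ψ : H) :
    ∑ l, ‖ρ.zr (g l * h) ψ‖ ^ 2 = (inner ℂ (ρ.zr ((∑ l, g l ^ 2) * h) ψ) (ρ.zr h ψ)).re := by
  have hb : ∀ l, BddFun (g l * h) := fun l =>
    hh.mul_of_support fun σ hσ => abs_le_of_sumSq_le (hC σ hσ) l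
  have hb2 : ∀ l, BddFun (g l ^ 2 * h) := fun l => by
    refine hh.mul_of_support (C := (1 + C) ^ 2) fun σ hσ => ?_
    rw [ContinuousMap.pow_apply, abs_pow]
    exact pow_le_pow_left₀ (abs_nonneg _) (abs_le_of_sumSq_le (hC σ hσ) l) 2
  have e : ∀ l, ‖ρ.zr (g l * h) ψ‖ ^ 2 = (inner ℂ (ρ.zr (g l ^ 2 * h) ψ) (ρ.zr h ψ)).re := by
    intro l
    rw [norm_sq_eq_re_inner, ρ.inner_zr (hb l), ← ρ.zr_mul (hb l) (hb l), ρ.inner_zr (hb2 l),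
      ← ρ.zr_mul (hb2 l) hh]
    congr 4
    ring
  simp_rw [e]
  rw [Fin.sum_univ_three, Fin.sum_univ_three, add_mul, add_mul,
    ρ.zr_add ((hb2 0).add (hb2 1)) (hb2 2), ρ.zr_add (hb2 0) (hb2 1), inner_add_left,
    inner_add_left, Complex.add_re, Complex.add_re]

/-- The difference of the two sides is `‖w h ψ‖²`, where `w` is the square root of `∑ g l² - 1`. -/
theorem norm_sq_zr_le {h : C(Sig, ℝ)} (hh : BddFun h) {C : ℝ}
    (hC : ∀ σ, h σ ≠ 0 → |(∑ l, g l ^ 2) σ| ≤ C) (h1 : ∀ σ, 1 ≤ (∑ l, g l ^ 2) σ) (ψ : H) :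
    ‖ρ.zr h ψ‖ ^ 2 ≤ (inner ℂ (ρ.zr ((∑ l, g l ^ 2) * h) ψ) (ρ.zr h ψ)).re := by
  set G := ∑ l, g l ^ 2 with hG
  set w := sqrtFun (G - 1) with hw
  have hb : BddFun (G * h) := hh.mul_of_support hC
  have hwb : BddFun (w * h) := by
    refine hh.mul_of_support (C := 1 + C) fun σ hσ => ?_
    have h2 : |w σ| ^ 2 = G σ - 1 := by
      rw [sq_abs]; exact Real.sq_sqrt (sub_nonneg.2 (h1 σ))
    have h3 := (le_abs_self _).trans (hC σ hσ)
    nlinarith [abs_nonneg (w σ), sq_nonneg (|w σ| - 1)]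
  have e : (inner ℂ (ρ.zr (G * h) ψ) (ρ.zr h ψ)).re - ‖ρ.zr h ψ‖ ^ 2 = ‖ρ.zr (w * h) ψ‖ ^ 2 := by
    rw [norm_sq_eq_re_inner, norm_sq_eq_re_inner, ρ.inner_zr hwb, ← ρ.zr_mul hwb hwb,
      ← Complex.sub_re, ← inner_sub_left, ← ρ.zr_sub hb hh, ρ.inner_zr (hb.sub hh),
      ← ρ.zr_mul (hb.sub hh) hh]
    congr 4
    ext σ
    have : w σ * w σ = G σ - 1 := Real.mul_self_sqrt (sub_nonneg.2 (h1 σ))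
    simp only [ContinuousMap.mul_apply, ContinuousMap.sub_apply]
    linear_combination (-(h σ) ^ 2) * this
  linarith [sq_nonneg ‖ρ.zr (w * h) ψ‖]

theorem norm_sq_le_re_inner_centralOp (h1 : ∀ σ, 1 ≤ (∑ l, g l ^ 2) σ) {ψ μ : H}
    (h : (ψ, μ) ∈ (ρ.centralOp (∑ l, g l ^ 2)).graph) : ‖ψ‖ ^ 2 ≤ (inner ℂ ψ μ).re := by
  set G := ∑ l, g l ^ 2 with hG
  have hlim := ρ.tendsto_zr_cutoff G
  have l1 : Tendsto (fun m => ‖ρ.zr (cutoff G m) ψ‖ ^ 2) atTop (𝓝 (‖ψ‖ ^ 2)) := (hlim ψ).norm.pow 2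
  have l2 : Tendsto (fun m => (inner ℂ (ρ.zr (cutoff G m) ψ) (ρ.zr (cutoff G m) μ)).re) atTop
      (𝓝 (inner ℂ ψ μ).re) :=
    (Complex.continuous_re.tendsto _).comp ((hlim ψ).inner (hlim μ))
  refine le_of_tendsto_of_tendsto' l1 l2 fun m => ?_
  have := ρ.norm_sq_zr_le (bddFun_cutoff G m) (fun _ => cutoff_support) h1 ψ
  rw [ρ.zr_eq_of_mem_graph_centralOp (bddFun_cutoff G m) (fun _ => cutoff_support) h] at this
  rw [← inner_conj_symm, Complex.conj_re]
  exact this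

theorem sum_norm_sq_zr_cutoff_le {ψ : H} {χ : Fin 3 → H}
    (hχ : ∀ l, (ψ, χ l) ∈ (ρ.centralOp (g l)).graph) (m : ℕ) :
    (inner ℂ (ρ.zr ((∑ l, g l ^ 2) * cutoff (∑ l, g l ^ 2) m) ψ)
      (ρ.zr (cutoff (∑ l, g l ^ 2) m) ψ)).re ≤ ∑ l, ‖χ l‖ ^ 2 := by
  rw [← ρ.sum_norm_sq_zr (bddFun_cutoff _ m) fun _ => cutoff_support]
  refine Finset.sum_le_sum fun l _ => pow_le_pow_left₀ (norm_nonneg _) ?_ 2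
  rw [ρ.zr_eq_of_mem_graph_centralOp (bddFun_cutoff _ m)
    (fun σ hσ => abs_le_of_sumSq_le (cutoff_support hσ) l) (hχ l)]
  exact ρ.norm_zr_le (abs_cutoff_le _ m) _

theorem re_inner_centralOp_le_sum {ψ μ : H} {χ : Fin 3 → H}
    (h : (ψ, μ) ∈ (ρ.centralOp (∑ l, g l ^ 2)).graph)
    (hχ : ∀ l, (ψ, χ l) ∈ (ρ.centralOp (g l)).graph) : (inner ℂ ψ μ).re ≤ ∑ l, ‖χ l‖ ^ 2 := by
  set G := ∑ l, g l ^ 2 with hG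
  have hlim := ρ.tendsto_zr_cutoff G
  have l2 : Tendsto (fun m => (inner ℂ (ρ.zr (cutoff G m) ψ) (ρ.zr (cutoff G m) μ)).re) atTop
      (𝓝 (inner ℂ ψ μ).re) :=
    (Complex.continuous_re.tendsto _).comp ((hlim ψ).inner (hlim μ))
  refine le_of_tendsto' l2 fun m => ?_
  have := ρ.sum_norm_sq_zr_cutoff_le hχ m
  rw [ρ.zr_eq_of_mem_graph_centralOp (bddFun_cutoff _ m) (fun _ => cutoff_support) h] at this
  rw [← inner_conj_symm, Complex.conj_re]
  exact this

/-- Here `ψ` need not lie in the domain of the operator `∑ g l²`; comparing at a finite cutoff makes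
its form value available. -/
theorem norm_sq_le_sum (h1 : ∀ σ, 1 ≤ (∑ l, g l ^ 2) σ) {ψ : H} {χ : Fin 3 → H}
    (hχ : ∀ l, (ψ, χ l) ∈ (ρ.centralOp (g l)).graph) : ‖ψ‖ ^ 2 ≤ ∑ l, ‖χ l‖ ^ 2 := by
  refine le_of_tendsto' ((ρ.tendsto_zr_cutoff (∑ l, g l ^ 2) ψ).norm.pow 2) fun m => ?_
  exact (ρ.norm_sq_zr_le (bddFun_cutoff _ m) (fun _ => cutoff_support) h1 ψ).trans
    (ρ.sum_norm_sq_zr_cutoff_le hχ m)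

theorem opLE_opOne_centralOp (h1 : ∀ σ, 1 ≤ (∑ l, g l ^ 2) σ) :
    OpLE opOne (ρ.centralOp (∑ l, g l ^ 2)) := by
  refine ⟨fun _ _ => trivial, fun ψ => ?_⟩
  have := ρ.norm_sq_le_re_inner_centralOp h1 (mem_graph_mk ψ.2)
  rw [norm_sq_eq_re_inner] at this
  exact this

/-- With `G = ∑ g l²` and `r = √G`, pair `S²ψ` with `(r k)² ψ`. Since the components commute with `r
k`, the result is `∑ ‖r k N_l ψ‖² ≥ ∑ ‖g_l r k ψ‖² = ‖G k ψ‖²`. It also equals `⟨G k ψ, k S²ψ⟩`, so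
Cauchy-Schwarz and division by `‖G k ψ‖` finish. -/
theorem norm_zr_sumSq_mul_le {N : Fin 3 → H →ₗ.[ℂ] H}
    (hc : ∀ l ψ φ, (ψ, φ) ∈ (N l).graph → ∃ χ, (ψ, χ) ∈ (ρ.centralOp (g l)).graph ∧ ‖χ‖ ≤ ‖φ‖)
    (hz : ∀ f l, CommutesWith (ρ.Z f) (N l)) {S : H →ₗ.[ℂ] H} (hS : IsSqrtSumSqModuli N S)
    {k : C(Sig, ℝ)} (hk : BddFun k) {C : ℝ}
    (hC : ∀ σ, k σ ≠ 0 → |(∑ l, g l ^ 2) σ| ≤ C) {ψ φ χ : H} (h : (ψ, φ) ∈ S.graph)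
    (h' : (φ, χ) ∈ S.graph) : ‖ρ.zr ((∑ l, g l ^ 2) * k) ψ‖ ≤ ‖ρ.zr k χ‖ := by
  set G := ∑ l, g l ^ 2 with hG
  set r := sqrtFun G with hr
  have hrr : r * r = G := by
    ext σ
    exact Real.mul_self_sqrt (sumSq_nonneg g σ)
  have hGk : BddFun (G * k) := hk.mul_of_support hC
  have hrk : BddFun (r * k) := by
    refine hk.mul_of_support (C := 1 + C) fun σ hσ => ?_
    have h2 : |r σ| ^ 2 = G σ := by rw [sq_abs]; exact Real.sq_sqrt (sumSq_nonneg g σ)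
    have h3 := (le_abs_self _).trans (hC σ hσ)
    nlinarith [abs_nonneg (r σ), sq_nonneg (|r σ| - 1)]
  have hrkC : ∀ σ, (r * k) σ ≠ 0 → |G σ| ≤ C := fun σ hσ => hC σ (right_ne_zero_of_mul hσ)
  have hψ := (hS.domain_iff ψ).1 (LinearPMap.mem_domain_of_mem_graph h)
  set β : Fin 3 → H := fun l => N l ⟨ψ, hψ l⟩ with hβ
  have hβg : ∀ l, (ψ, β l) ∈ (N l).graph := fun l => mem_graph_mk (hψ l)
  have hβ1 : ∀ l, (ρ.zr (r * k) ψ, ρ.zr (r * k) (β l)) ∈ (N l).graph := fun l => hz _ l _ _ (hβg l)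
  have hβ2 : ∀ l, (ρ.zr (r * k) (ρ.zr (r * k) ψ), ρ.zr (r * k) (ρ.zr (r * k) (β l))) ∈
      (N l).graph := fun l => hz _ l _ _ (hβ1 l)
  have hdom : ρ.zr (r * k) (ρ.zr (r * k) ψ) ∈ S.domain :=
    (hS.domain_iff _).2 fun l => LinearPMap.mem_domain_of_mem_graph (hβ2 l)
  have e1 := inner_of_isSqrtSumSqModuli hS (mem_graph_mk hdom) h hβ2 hβg
  rw [inner_eq_of_isSelfAdjoint hS.selfAdjoint (mem_graph_mk hdom) h'] at e1
  have e2 : ρ.zr (r * k) (ρ.zr (r * k) ψ) = ρ.zr k (ρ.zr (G * k) ψ) := by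
    rw [← ρ.zr_mul hrk hrk, ← ρ.zr_mul hk hGk, ← hrr]
    congr 2
    ring
  rw [e2, ρ.inner_zr hk] at e1
  have e3 : (inner ℂ (ρ.zr (G * k) ψ) (ρ.zr k χ)).re = ∑ l, ‖ρ.zr (r * k) (β l)‖ ^ 2 := by
    rw [e1, Complex.re_sum]
    refine Finset.sum_congr rfl fun l _ => ?_
    rw [norm_sq_eq_re_inner, ρ.inner_zr hrk]
  have e4 : ‖ρ.zr (G * k) ψ‖ ^ 2 = ∑ l, ‖ρ.zr (g l * (r * k)) ψ‖ ^ 2 := by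
    have hGrk : BddFun (G * (r * k)) := hrk.mul_of_support hrkC
    rw [ρ.sum_norm_sq_zr hrk hrkC, norm_sq_eq_re_inner, ρ.inner_zr hGk, ← ρ.zr_mul hGk hGk,
      ρ.inner_zr hGrk, ← ρ.zr_mul hGrk hrk]
    congr 4
    linear_combination (-(G * k * k)) * hrr
  have e5 : ∑ l, ‖ρ.zr (g l * (r * k)) ψ‖ ^ 2 ≤ ∑ l, ‖ρ.zr (r * k) (β l)‖ ^ 2 := by
    refine Finset.sum_le_sum fun l _ => pow_le_pow_left₀ (norm_nonneg _) ?_ 2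
    obtain ⟨η, hη, hle⟩ := hc l _ _ (hβ1 l)
    rwa [graph_unique hη (ρ.zr_mem_graph_centralOp hrk
      (fun σ hσ => abs_le_of_sumSq_le (hrkC σ hσ) l) ψ)] at hle
  have e6 : (inner ℂ (ρ.zr (G * k) ψ) (ρ.zr k χ)).re ≤ ‖ρ.zr (G * k) ψ‖ * ‖ρ.zr k χ‖ :=
    (Complex.re_le_norm _).trans (norm_inner_le_norm _ _)
  rcases (norm_nonneg (ρ.zr (G * k) ψ)).eq_or_lt with h0 | h0
  · rw [← h0]; exact norm_nonneg _
  · refine le_of_mul_le_mul_left ?_ h0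
    rw [← sq]
    linarith

/-- The norm estimate for a difference of two cutoffs makes `G k_m ψ` Cauchy, because `k_m S²ψ`
converges; closedness of `G(Q)` then puts `ψ` in its domain. -/
theorem mem_domain_centralOp_sumSq {N : Fin 3 → H →ₗ.[ℂ] H}
    (hc : ∀ l ψ φ, (ψ, φ) ∈ (N l).graph → ∃ χ, (ψ, χ) ∈ (ρ.centralOp (g l)).graph ∧ ‖χ‖ ≤ ‖φ‖)
    (hz : ∀ f l, CommutesWith (ρ.Z f) (N l)) {S : H →ₗ.[ℂ] H} (hS : IsSqrtSumSqModuli N S)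
    {ψ φ χ : H} (h : (ψ, φ) ∈ S.graph) (h' : (φ, χ) ∈ S.graph) :
    ∃ μ, (ψ, μ) ∈ (ρ.centralOp (∑ l, g l ^ 2)).graph := by
  set G := ∑ l, g l ^ 2 with hG
  have hb : ∀ m, BddFun (G * cutoff G m) := fun m =>
    (bddFun_cutoff G m).mul_of_support fun _ => cutoff_support
  have hcau : CauchySeq fun m => ρ.zr (G * cutoff G m) ψ := by
    have hχ := (ρ.tendsto_zr_cutoff G χ).cauchySeq
    rw [Metric.cauchySeq_iff] at hχ ⊢
    intro ε hε
    obtain ⟨M, hM⟩ := hχ ε hε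
    refine ⟨M, fun p hp q hq => lt_of_le_of_lt ?_ (hM p hp q hq)⟩
    rw [dist_eq_norm, dist_eq_norm, ← ρ.zr_sub (hb p) (hb q), ← mul_sub,
      ← ρ.zr_sub (bddFun_cutoff G p) (bddFun_cutoff G q)]
    refine ρ.norm_zr_sumSq_mul_le hc hz hS ((bddFun_cutoff G p).sub (bddFun_cutoff G q))
      (C := max ((p : ℝ) + 1) (q + 1)) (fun σ hσ => ?_) h h'
    by_cases hp0 : cutoff G p σ = 0
    · refine (cutoff_support (n := q) fun h0 => hσ ?_).trans (le_max_right _ _)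
      rw [ContinuousMap.sub_apply, hp0, h0, sub_zero]
    · exact (cutoff_support hp0).trans (le_max_left _ _)
  obtain ⟨μ, hμ⟩ := cauchySeq_tendsto_of_complete hcau
  exact ⟨μ, mem_graph_of_tendsto (ρ.isClosed_centralOp G)
    (fun m => ρ.zr_mem_graph_centralOp (bddFun_cutoff G m) (fun _ => cutoff_support) ψ)
    (ρ.tendsto_zr_cutoff G ψ) hμ⟩

theorem opLE_centralOp_opMul {N : Fin 3 → H →ₗ.[ℂ] H}
    (hc : ∀ l ψ φ, (ψ, φ) ∈ (N l).graph → ∃ χ, (ψ, χ) ∈ (ρ.centralOp (g l)).graph ∧ ‖χ‖ ≤ ‖φ‖)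
    (hz : ∀ f l, CommutesWith (ρ.Z f) (N l)) {S : H →ₗ.[ℂ] H} (hS : IsSqrtSumSqModuli N S) :
    OpLE (ρ.centralOp (∑ l, g l ^ 2)) (opMul S S) := by
  have hdom : (opMul S S).domain ≤ (ρ.centralOp (∑ l, g l ^ 2)).domain := by
    intro ψ hψ
    obtain ⟨φ, h1, h2⟩ := mem_graph_opMul.1 (mem_graph_mk hψ)
    obtain ⟨μ, hμ⟩ := ρ.mem_domain_centralOp_sumSq hc hz hS h1 h2
    exact LinearPMap.mem_domain_of_mem_graph hμ
  refine ⟨hdom, fun ψ => ?_⟩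
  obtain ⟨φ, h1, h2⟩ := mem_graph_opMul.1 (mem_graph_mk ψ.2)
  have hψ := (hS.domain_iff _).1 (LinearPMap.mem_domain_of_mem_graph h1)
  have e1 := inner_eq_of_isSelfAdjoint hS.selfAdjoint h1 h2
  have e2 := hS.norm_sq ⟨ψ, LinearPMap.mem_domain_of_mem_graph h1⟩ hψ
  rw [apply_eq_of_mem_graph h1] at e2
  choose χ hχ hle using fun l => hc l _ _ (mem_graph_mk (hψ l))
  have e3 := ρ.re_inner_centralOp_le_sum (mem_graph_mk (hdom ψ.2)) hχ
  have e4 : ∑ l, ‖χ l‖ ^ 2 ≤ ∑ l, ‖N l ⟨ψ, hψ l⟩‖ ^ 2 :=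
    Finset.sum_le_sum fun l _ => pow_le_pow_left₀ (norm_nonneg _) (hle l) 2
  have e5 : (inner ℂ (ψ : H) (opMul S S ψ)).re = ‖φ‖ ^ 2 := by
    rw [norm_sq_eq_re_inner, e1]
  rw [e5, e2]
  exact e3.trans e4

/-- The consequences for the area operators of the bounds `‖g l ψ‖ ≤ ‖N l ψ‖` of the components
by central operators with `∑ l, g l ² ≥ 1`. -/
theorem area_bounds {N : Fin 3 → H →ₗ.[ℂ] H} (h1 : ∀ σ, 1 ≤ (∑ l, g l ^ 2) σ)
    (hc : ∀ l ψ φ, (ψ, φ) ∈ (N l).graph → ∃ χ, (ψ, χ) ∈ (ρ.centralOp (g l)).graph ∧ ‖χ‖ ≤ ‖φ‖)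
    (hz : ∀ f l, CommutesWith (ρ.Z f) (N l)) (hcl : ∀ l, (N l).IsClosed)
    (hd : ∀ l, Dense ((N l).domain : Set H)) (hdd : Dense {ψ : H | ∀ l, ψ ∈ (N l).domain}) :
    OpLE (ρ.centralOp (∑ l, g l ^ 2)) (sumSqModuli N) ∧
    OpLE opOne (ρ.centralOp (∑ l, g l ^ 2)) ∧
    (∃! S : H →ₗ.[ℂ] H, IsSqrtSumSqModuli N S) ∧
    (∀ S : H →ₗ.[ℂ] H, IsSqrtSumSqModuli N S →
      sumSqModuli N ≤ opMul S S ∧ OpLE (ρ.centralOp (∑ l, g l ^ 2)) (opMul S S) ∧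
      OpLE opOne S) := by
  obtain ⟨S, hS, hS1⟩ := exists_isSqrtSumSqModuli hcl hdd
  have huniq : ∀ S', IsSqrtSumSqModuli N S' → S' = S := fun S' hS' =>
    isSqrtSumSqModuli_unique hcl hdd hS' hS
  have hle := sumSqModuli_le_opMul hd hS
  have hop := ρ.opLE_centralOp_opMul hc hz hS
  refine ⟨?_, ρ.opLE_opOne_centralOp h1, ⟨S, hS, huniq⟩, fun S' hS' => ?_⟩
  · obtain ⟨hdom, hin⟩ := hop
    -- The inequality for the operator sum is inherited from `S²`, which extends it.
    refine ⟨hle.1.trans hdom, fun ψ => ?_⟩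
    have e : sumSqModuli N ψ = opMul S S ⟨ψ, hle.1 ψ.2⟩ := hle.2 rfl
    rw [e]
    exact hin ⟨ψ, hle.1 ψ.2⟩
  · obtain rfl := huniq S' hS'
    refine ⟨hle, hop, hS1 fun ψ φ hφ => ?_⟩
    choose χ hχ hn using fun l => hc l _ _ (hφ l)
    exact (ρ.norm_sq_le_sum h1 hχ).trans
      (Finset.sum_le_sum fun l _ => pow_le_pow_left₀ (norm_nonneg _) (hn l) 2)

end EventRep

end QST

end

noncomputable section

namespace QST

open Filter Topology MeasureTheory
open scoped ContDiff

section Smearing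

variable {V : Type*} [NormedAddCommGroup V] [NormedSpace ℝ V]
  {H : Type*} [NormedAddCommGroup H] [InnerProductSpace ℂ H]

/-! ### Smeared operators -/

/-- A strongly continuous family of contractions on `H`. -/
structure ContractionFamily (V : Type*) [TopologicalSpace V] (H : Type*) [NormedAddCommGroup H]
    [InnerProductSpace ℂ H] where
  U : V → H →L[ℂ] H
  cont : ∀ ψ, Continuous fun x => U x ψ
  norm_le : ∀ x ψ, ‖U x ψ‖ ≤ ‖ψ‖

/-- Smooth functions of compact support. -/
structure IsTest (f : V → ℝ) : Prop where
  smooth : ContDiff ℝ ∞ f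
  supp : HasCompactSupport f

/-- The derivative of `f` along the vector field `X`. -/
def lieDeriv (X : V → V) (f : V → ℝ) (x : V) : ℝ := fderiv ℝ f x (X x)

theorem IsTest.lieDeriv {f : V → ℝ} (hf : IsTest f) {X : V → V} (hX : ContDiff ℝ ∞ X) :
    IsTest (lieDeriv X f) where
  smooth := (hf.smooth.fderiv_right (m := ∞) le_rfl).clm_apply hX
  supp := hf.supp.fderiv (𝕜 := ℝ) |>.mono' fun x hx => by
    refine subset_tsupport _ fun h0 => hx ?_
    rw [QST.lieDeriv, h0]
    rfl

theorem IsTest.sub {f g : V → ℝ} (hf : IsTest f) (hg : IsTest g) : IsTest (f - g) :=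
  ⟨hf.smooth.sub hg.smooth, by
    rw [sub_eq_add_neg]
    exact hf.supp.add (hg.supp.neg)⟩

theorem IsTest.add {f g : V → ℝ} (hf : IsTest f) (hg : IsTest g) : IsTest (f + g) :=
  ⟨hf.smooth.add hg.smooth, hf.supp.add hg.supp⟩

variable [MeasureSpace V] [BorelSpace V]

/-- A smooth vector field whose flow is `x ↦ x + t X(x)` and preserves the volume. -/
structure IsLinearFlow (X : V → V) : Prop where
  smooth : ContDiff ℝ ∞ X
  invariant : ∀ (t : ℝ) x, X (x + t • X x) = X x
  preserving : ∀ t : ℝ, MeasurePreserving (fun x => x + t • X x) volume volume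

/-- Substitute `y = x + t X(x)`. Since `X` is constant along its flow, the inverse is `x = y - t
X(y)`. -/
theorem ContractionFamily.integral_flow (R : ContractionFamily V H) {X : V → V}
    (hX : IsLinearFlow X) {f : V → ℝ} (hf : IsTest f) (t : ℝ)
    (ψ : H) [SecondCountableTopologyEither V H] :
    ∫ x, f x • R.U (x + t • X x) ψ = ∫ x, f (x - t • X x) • R.U x ψ := by
  have hXc := hX.smooth.continuous
  have hfc := hf.smooth.continuous
  have hRc := R.cont ψ
  have hcont : Continuous fun x => f (x - t • X x) • R.U x ψ := by fun_prop
  conv_rhs => rw [← (hX.preserving t).map_eq]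
  rw [integral_map (hX.preserving t).measurable.aemeasurable
    hcont.aestronglyMeasurable]
  congr 1
  ext x
  rw [hX.invariant, add_sub_cancel_right]

variable [IsFiniteMeasureOnCompacts (volume : Measure V)]

theorem ContractionFamily.integrable {V : Type*} [NormedAddCommGroup V] [MeasureSpace V]
    [BorelSpace V] [IsFiniteMeasureOnCompacts (volume : Measure V)] (R : ContractionFamily V H)
    {f : V → ℝ} (hf : Continuous f)
    (hs : HasCompactSupport f) (ψ : H) : Integrable fun x => f x • R.U x ψ :=
  (hf.smul (R.cont ψ)).integrable_of_hasCompactSupport hs.smul_right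

theorem ContractionFamily.norm_integral_le {V : Type*} [NormedAddCommGroup V] [MeasureSpace V]
    [BorelSpace V] [IsFiniteMeasureOnCompacts (volume : Measure V)] (R : ContractionFamily V H)
    {f : V → ℝ}
    (hf : Continuous f) (hs : HasCompactSupport f) (ψ : H) :
    ‖∫ x, f x • R.U x ψ‖ ≤ (∫ x, |f x|) * ‖ψ‖ := by
  rw [← integral_mul_const]
  refine norm_integral_le_of_norm_le ?_ (Eventually.of_forall fun x => ?_)
  · exact ((hf.integrable_of_hasCompactSupport hs).abs).mul_const _
  · rw [norm_smul, Real.norm_eq_abs]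
    exact mul_le_mul_of_nonneg_left (R.norm_le x ψ) (abs_nonneg _)

open Classical in
/-- The operator `∫ f(x) U(x) dx`, for continuous `f` of compact support. -/
def ContractionFamily.smear (R : ContractionFamily V H) (f : V → ℝ) : H →L[ℂ] H :=
  if h : Continuous f ∧ HasCompactSupport f then
    LinearMap.mkContinuous
      { toFun := fun ψ => ∫ x, f x • R.U x ψ
        map_add' := fun ψ φ => by
          rw [← integral_add (R.integrable h.1 h.2 ψ) (R.integrable h.1 h.2 φ)]
          simp only [map_add, smul_add]
        map_smul' := fun c ψ => by
          rw [RingHom.id_apply, ← integral_smul]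
          simp only [map_smul, smul_comm c] }
      (∫ x, |f x|) (R.norm_integral_le h.1 h.2)
  else 0

namespace ContractionFamily

variable (R : ContractionFamily V H)

theorem smear_apply {f : V → ℝ} (hf : IsTest f) (ψ : H) : R.smear f ψ = ∫ x, f x • R.U x ψ := by
  rw [smear, dif_pos ⟨hf.smooth.continuous, hf.supp⟩]
  rfl

theorem integrable_of_isTest {f : V → ℝ} (hf : IsTest f) (ψ : H) :
    Integrable fun x => f x • R.U x ψ :=
  R.integrable hf.smooth.continuous hf.supp ψ

theorem smear_sub {f g : V → ℝ} (hf : IsTest f) (hg : IsTest g) (ψ : H) :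
    R.smear (f - g) ψ = R.smear f ψ - R.smear g ψ := by
  rw [R.smear_apply hf, R.smear_apply hg, R.smear_apply (hf.sub hg),
    ← integral_sub (R.integrable_of_isTest hf ψ) (R.integrable_of_isTest hg ψ)]
  simp only [Pi.sub_apply, sub_smul]

theorem smear_add {f g : V → ℝ} (hf : IsTest f) (hg : IsTest g) (ψ : H) :
    R.smear (f + g) ψ = R.smear f ψ + R.smear g ψ := by
  rw [R.smear_apply hf, R.smear_apply hg, R.smear_apply (hf.add hg),
    ← integral_add (R.integrable_of_isTest hf ψ) (R.integrable_of_isTest hg ψ)]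
  simp only [Pi.add_apply, add_smul]

/-- The adjoint replaces `x` by `-x`, and the kernel is real; hence even kernels give symmetric
operators and odd kernels skew ones. -/
theorem inner_smear [CompleteSpace H] [(volume : Measure V).IsNegInvariant]
    (hadj : ∀ x ψ φ, inner ℂ (R.U x ψ) φ = inner ℂ ψ (R.U (-x) φ)) {f : V → ℝ} (hf : IsTest f)
    {ε : ℝ} (hε : ∀ x, f (-x) = ε * f x) (ψ φ : H) :
    inner ℂ (R.smear f ψ) φ = ε * inner ℂ ψ (R.smear f φ) := by
  rw [R.smear_apply hf, R.smear_apply hf, ← inner_conj_symm,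
    ← integral_inner (R.integrable_of_isTest hf ψ), ← integral_conj,
    ← integral_inner (R.integrable_of_isTest hf φ),
    ← integral_neg_eq_self (fun x => (starRingEnd ℂ) (inner ℂ φ (f x • R.U x ψ))),
    ← integral_const_mul]
  congr 1
  ext x
  rw [inner_conj_symm, hε, inner_smul_left_eq_smul, inner_smul_right_eq_smul, hadj, neg_neg,
    mul_smul, Complex.real_smul]

/-- Approximate units. -/
theorem tendsto_smear [CompleteSpace H] (h0 : ∀ ψ, R.U 0 ψ = ψ) {f : ℕ → V → ℝ}
    (hf : ∀ m, IsTest (f m)) (hpos : ∀ m x, 0 ≤ f m x) (hunit : ∀ m, ∫ x, f m x = 1) {r : ℕ → ℝ}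
    (hr : Tendsto r atTop (𝓝 0)) (hsupp : ∀ m x, f m x ≠ 0 → ‖x‖ ≤ r m) (ψ : H) :
    Tendsto (fun m => R.smear (f m) ψ) atTop (𝓝 ψ) := by
  rw [Metric.tendsto_nhds]
  intro ε hε
  have hc := Metric.continuousAt_iff.1 ((R.cont ψ).continuousAt (x := 0)) (ε / 2) (by positivity)
  obtain ⟨δ, hδ, hδε⟩ := hc
  filter_upwards [(tendsto_order.1 hr).2 δ hδ] with m hm
  have hfi : Integrable (f m) := (hf m).smooth.continuous.integrable_of_hasCompactSupport
    (hf m).supp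
  have e : R.smear (f m) ψ - ψ = ∫ x, f m x • (R.U x ψ - ψ) := by
    simp only [smul_sub]
    rw [integral_sub (R.integrable_of_isTest (hf m) ψ) (hfi.smul_const ψ), integral_smul_const,
      hunit, one_smul, R.smear_apply (hf m)]
  rw [dist_eq_norm, e]
  have hle : ‖∫ x, f m x • (R.U x ψ - ψ)‖ ≤ ∫ x, f m x * (ε / 2) := by
    refine norm_integral_le_of_norm_le (hfi.mul_const _) (Eventually.of_forall fun x => ?_)
    rw [norm_smul, Real.norm_eq_abs, abs_of_nonneg (hpos m x)]
    by_cases hx : f m x = 0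
    · rw [hx, zero_mul, zero_mul]
    · refine mul_le_mul_of_nonneg_left ?_ (hpos m x)
      have := hδε (x := x) (by
        rw [dist_zero_right]
        exact (hsupp m x hx).trans_lt hm)
      rw [h0, dist_eq_norm] at this
      exact this.le
  rw [integral_mul_const, hunit, one_mul] at hle
  linarith

/-- The orbits of `U` need not be differentiable, so the flow is first moved onto the smooth kernel,
where differentiation under the integral is allowed. -/
theorem hasDerivAt_integral_flow [CompleteSpace H] {X : V → V} (hX : IsLinearFlow X) {f : V → ℝ}
    (hf : IsTest f) (ψ : H) [SecondCountableTopologyEither V H] :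
    HasDerivAt (fun t : ℝ => ∫ x, f x • R.U (x + t • X x) ψ) (-R.smear (lieDeriv X f) ψ) 0 := by
  have hXc := hX.smooth.continuous
  have hfc := hf.smooth.continuous
  have hRc := R.cont ψ
  have hdf : Continuous (fderiv ℝ f) := hf.smooth.continuous_fderiv (by simp)
  simp_rw [R.integral_flow hX hf]
  -- A compact set containing the supports of all translated kernels with `|t| ≤ 1`; it carries the
  -- dominating function.
  set K : Set V := (fun p : ℝ × V => p.2 + p.1 • X p.2) '' (Set.Icc (-1) 1 ×ˢ tsupport f) with hK
  have hKc : IsCompact K := (isCompact_Icc.prod hf.supp).image (by fun_prop)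
  have hcF : Continuous fun p : ℝ × V => fderiv ℝ f (p.2 - p.1 • X p.2) (X p.2) :=
    (hdf.comp (by fun_prop)).clm_apply (by fun_prop)
  obtain ⟨C, hC⟩ := (isCompact_Icc.prod hKc).exists_bound_of_continuousOn
    (s := Set.Icc (-1 : ℝ) 1 ×ˢ K) hcF.continuousOn
  have hsupp : ∀ t ∈ Set.Icc (-1 : ℝ) 1, ∀ x, x ∉ K → fderiv ℝ f (x - t • X x) = 0 := by
    intro t ht x hx
    by_contra h0
    refine hx ⟨(t, x - t • X x), ⟨ht, ?_⟩, ?_⟩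
    · exact tsupport_fderiv_subset ℝ (subset_tsupport _ h0)
    · have := hX.invariant (-t) x
      rw [neg_smul, ← sub_eq_add_neg] at this
      simp [this]
  have key := hasDerivAt_integral_of_dominated_loc_of_deriv_le (μ := (volume : Measure V)) (𝕜 := ℝ)
    (F := fun (t : ℝ) x => f (x - t • X x) • R.U x ψ) (x₀ := 0)
    (F' := fun (t : ℝ) x => (-(fderiv ℝ f (x - t • X x) (X x))) • R.U x ψ)
    (bound := K.indicator fun _ => C * ‖ψ‖) (s := Metric.ball 0 1)
    (Metric.ball_mem_nhds 0 one_pos)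
    (Eventually.of_forall fun t =>
      (show Continuous fun x => f (x - t • X x) • R.U x ψ by fun_prop).aestronglyMeasurable)
    (by simpa using R.integrable_of_isTest hf ψ) ?_ ?_ ?_ ?_
  · have h2 := key.2
    rw [R.smear_apply (hf.lieDeriv hX.smooth), ← integral_neg]
    simp only [zero_smul, sub_zero, neg_smul] at h2
    exact h2
  · have hs : Continuous fun x => -(fderiv ℝ f (x - (0 : ℝ) • X x) (X x)) :=
      (hcF.comp (Continuous.prodMk continuous_const continuous_id)).neg
    exact (hs.smul hRc).aestronglyMeasurable
  · refine Eventually.of_forall fun x t ht => ?_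
    have ht' : t ∈ Set.Icc (-1 : ℝ) 1 := by
      rw [Metric.mem_ball, dist_zero_right, Real.norm_eq_abs, abs_lt] at ht
      exact ⟨ht.1.le, ht.2.le⟩
    by_cases hx : x ∈ K
    · rw [Set.indicator_of_mem hx, norm_smul, norm_neg]
      exact mul_le_mul (hC (t, x) ⟨ht', hx⟩) (R.norm_le x ψ) (norm_nonneg _)
        ((norm_nonneg _).trans (hC (t, x) ⟨ht', hx⟩))
    · rw [Set.indicator_of_notMem hx, hsupp t ht' x hx]
      simp
  · rw [integrable_indicator_iff hKc.measurableSet]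
    exact integrableOn_const hKc.measure_lt_top.ne
  · refine Eventually.of_forall fun x t _ => ?_
    refine HasDerivAt.smul_const ?_ _
    have h1 : HasDerivAt (fun t : ℝ => x - t • X x) (-X x) t := by
      simpa using ((hasDerivAt_id t).smul_const (X x)).const_sub x
    have h2 := (hf.smooth.differentiable (by simp) (x - t • X x)).hasFDerivAt.comp_hasDerivAt t h1
    simpa [Function.comp_def] using h2

/-- If `w t U(x) = U(x + t X(x))`, the generator of `w` maps `∫ f U` to `i ∫ (X f) U`. -/
theorem smear_mem_graph_generator [CompleteSpace H] {X : V → V} (hX : IsLinearFlow X)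
    {w : ℝ → H →L[ℂ] H} (hw : ∀ t x ψ, w t (R.U x ψ) = R.U (x + t • X x) ψ) {f : V → ℝ}
    (hf : IsTest f) (ψ : H) [SecondCountableTopologyEither V H] :
    (R.smear f ψ, Complex.I • R.smear (lieDeriv X f) ψ) ∈ (generator w).graph := by
  rw [mem_graph_generator, smul_smul, Complex.I_mul_I, neg_one_smul]
  refine (R.hasDerivAt_integral_flow hX hf ψ).congr_of_eventuallyEq
    (Eventually.of_forall fun t => ?_)
  change w t (R.smear f ψ) = _
  rw [R.smear_apply hf, ← ContinuousLinearMap.integral_comp_comm _ (R.integrable_of_isTest hf ψ)]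
  congr 1
  ext x
  rw [← hw, (w t).map_smul_of_tower]

/-- If `U(x) w t = U(x + t X(x))`, then `∫ f U` times the generator of `w` is `i ∫ (X f) U`. -/
theorem smear_eq_of_mem_graph_generator [CompleteSpace H] {X : V → V} (hX : IsLinearFlow X)
    {w : ℝ → H →L[ℂ] H} (hw : ∀ t x ψ, R.U x (w t ψ) = R.U (x + t • X x) ψ) {f : V → ℝ}
    (hf : IsTest f) [SecondCountableTopologyEither V H] {ψ φ : H}
    (h : (ψ, φ) ∈ (generator w).graph) :
    R.smear f φ = Complex.I • R.smear (lieDeriv X f) ψ := by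
  rw [mem_graph_generator] at h
  have h1 := ((R.smear f).restrictScalars ℝ).hasFDerivAt.comp_hasDerivAt (0 : ℝ) h
  have h2 := (R.hasDerivAt_integral_flow hX hf ψ).congr_of_eventuallyEq
    (f₁ := (R.smear f).restrictScalars ℝ ∘ fun t => w t ψ) (Eventually.of_forall fun t => by
      change R.smear f (w t ψ) = _
      rw [R.smear_apply hf]
      simp only [hw])
  have h3 := h1.unique h2
  simp only [ContinuousLinearMap.coe_restrictScalars', map_smul] at h3
  have h4 : -R.smear (lieDeriv X f) ψ = Complex.I • Complex.I • R.smear (lieDeriv X f) ψ := by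
    rw [smul_smul, Complex.I_mul_I, neg_one_smul]
  rw [h4] at h3
  exact smul_right_injective H Complex.I_ne_zero h3

end ContractionFamily

end Smearing

end QST

end

noncomputable section

namespace QST

open Filter Topology MeasureTheory
open scoped ContDiff

/-! ### Shear flows -/

section Shear

variable {A B : Type*} [NormedAddCommGroup A] [NormedSpace ℝ A] [MeasureSpace A] [BorelSpace A]
  [SFinite (volume : Measure A)]
  [(volume : Measure A).IsAddRightInvariant]
  [NormedAddCommGroup B] [NormedSpace ℝ B] [MeasureSpace B] [BorelSpace B]
  [SecondCountableTopology B] [SFinite (volume : Measure B)]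
  [(volume : Measure B).IsAddRightInvariant]

/-- The vector field `(v, θ) ↦ (u, b v)` generates a volume preserving flow if `b u = 0`. -/
theorem isLinearFlow_shear (u : A) (b : A →L[ℝ] B) (hb : b u = 0) :
    IsLinearFlow fun p : A × B => (u, b p.1) where
  smooth := contDiff_const.prodMk (b.contDiff.comp contDiff_fst)
  invariant t p := by simp [hb]
  preserving t := by
    -- The flow translates the base by `t u` and each fibre by `t b v`, so it is a skew product of
    -- translations.
    have h := (measurePreserving_add_right (volume : Measure A) (t • u)).skew_product
      (μc := (volume : Measure B)) (μd := (volume : Measure B))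
      (g := fun v θ => θ + t • b v) (by fun_prop)
      (Eventually.of_forall fun v =>
        (measurePreserving_add_right (volume : Measure B) (t • b v)).map_eq)
    exact h

end Shear

/-! ### Weyl operators -/

theorem sympl_apply {n : ℕ} (α β : Fin n → Fin 4 → ℝ) (σ : Sig) :
    sympl α β σ = ∑ a, ∑ μ, ∑ ν, α a μ * β a ν * σ.1 μ ν := by
  simp [sympl, coordQ]

theorem sig_antisymm (σ : Sig) (μ ν : Fin 4) : σ.1 μ ν = -σ.1 ν μ := by
  have := congrFun (congrFun σ.2.1 ν) μ
  simpa using this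

namespace EventRep

variable {n : ℕ} {H : Type*} [NormedAddCommGroup H] [InnerProductSpace ℂ H] [CompleteSpace H]
  (ρ : EventRep n H)

theorem weyl_apply (α β : Fin n → Fin 4 → ℝ) (ψ : H) :
    ρ.W α (ρ.W β ψ) = ρ.Z (expI ((-(1 / 2) : ℝ) • sympl α β)) (ρ.W (α + β) ψ) :=
  congrArg (fun T : H →L[ℂ] H => T ψ) (ρ.weyl α β)

theorem W_comm_Z_apply (α : Fin n → Fin 4 → ℝ) (f) (ψ : H) :
    ρ.W α (ρ.Z f ψ) = ρ.Z f (ρ.W α ψ) :=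
  congrArg (fun T : H →L[ℂ] H => T ψ) (ρ.W_comm_Z α f)

theorem sympl_zero_left (β : Fin n → Fin 4 → ℝ) : sympl 0 β = 0 := by
  ext σ
  simp [sympl_apply]

theorem W_zero (ψ : H) : ρ.W 0 ψ = ψ := by
  have h := ρ.weyl_apply 0 0 ψ
  rw [sympl_zero_left, smul_zero, Z_expI_zero, add_zero] at h
  -- The Weyl relation gives only `W(0)² = W(0)`; injectivity of the isometry `W(0)` makes it the
  -- identity.
  have hn := ContinuousLinearMap.norm_map_of_mem_unitary (ρ.W_unitary 0) (ρ.W 0 ψ - ψ)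
  rw [map_sub, h, sub_self, norm_zero] at hn
  exact sub_eq_zero.1 (norm_eq_zero.1 hn.symm)

theorem sympl_self (α : Fin n → Fin 4 → ℝ) : sympl α α = 0 := by
  ext σ
  rw [sympl_apply]
  refine Finset.sum_eq_zero fun a _ => ?_
  have h : ∑ μ, ∑ ν, α a μ * α a ν * σ.1 μ ν = -∑ μ, ∑ ν, α a μ * α a ν * σ.1 μ ν := by
    conv_lhs => rw [Finset.sum_comm]
    rw [← Finset.sum_neg_distrib]
    refine Finset.sum_congr rfl fun μ _ => ?_
    rw [← Finset.sum_neg_distrib]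
    refine Finset.sum_congr rfl fun ν _ => ?_
    rw [sig_antisymm σ ν μ]
    ring
  linarith

theorem sympl_neg_right (α β : Fin n → Fin 4 → ℝ) : sympl α (-β) = -sympl α β := by
  ext σ
  simp [sympl_apply]

theorem inner_W_left (α : Fin n → Fin 4 → ℝ) (ψ φ : H) :
    inner ℂ (ρ.W α ψ) φ = inner ℂ ψ (ρ.W (-α) φ) := by
  have h : ρ.W α (ρ.W (-α) φ) = φ := by
    rw [weyl_apply, sympl_neg_right, sympl_self, neg_zero, smul_zero, Z_expI_zero, add_neg_cancel,
      W_zero]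
  conv_lhs => rw [← h]
  exact ContinuousLinearMap.inner_map_map_of_mem_unitary (ρ.W_unitary α) _ _

section WeylFamily

variable {A B : Type*} [NormedAddCommGroup A] [NormedSpace ℝ A] [NormedAddCommGroup B]
  [NormedSpace ℝ B]

/-- The operators `W(j v) e^{i c(θ)}`. -/
def weylFamily (j : A →L[ℝ] (Fin n → Fin 4 → ℝ)) (c : B →L[ℝ] C(Sig, ℝ)) :
    ContractionFamily (A × B) H where
  U p := ρ.Z (expI (c p.2)) * ρ.W (j p.1)
  cont ψ := by
    rw [continuous_iff_continuousAt]
    intro p₀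
    have h1 : Tendsto (fun p : A × B => ρ.W (j p.1) ψ) (𝓝 p₀) (𝓝 (ρ.W (j p₀.1) ψ)) :=
      ((ρ.W_continuous ψ).comp (by fun_prop : Continuous fun p : A × B => j p.1)).tendsto p₀
    have h2 : Tendsto (fun p : A × B => ρ.Z (expI (c p.2)) (ρ.W (j p₀.1) ψ)) (𝓝 p₀)
        (𝓝 (ρ.Z (expI (c p₀.2)) (ρ.W (j p₀.1) ψ))) :=
      (ρ.continuous_Z_expI (g := fun p : A × B => c p.2) (by fun_prop) _).tendsto p₀
    have h3 : Tendsto (fun p : A × B => ρ.Z (expI (c p.2)) (ρ.W (j p.1) ψ - ρ.W (j p₀.1) ψ))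
        (𝓝 p₀) (𝓝 0) := by
      refine squeeze_zero_norm (fun p => ρ.norm_Z_expI_apply_le _ _) ?_
      simpa using (h1.sub_const (ρ.W (j p₀.1) ψ)).norm
    have := h3.add h2
    rw [zero_add] at this
    refine this.congr fun p => ?_
    rw [map_sub, sub_add_cancel]
    rfl
  norm_le p ψ := (ρ.norm_Z_expI_apply_le _ _).trans
    (ContinuousLinearMap.norm_map_of_mem_unitary (ρ.W_unitary _) ψ).le

variable (j : A →L[ℝ] (Fin n → Fin 4 → ℝ)) (c : B →L[ℝ] C(Sig, ℝ))

theorem weylFamily_apply (p : A × B) (ψ : H) :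
    (ρ.weylFamily j c).U p ψ = ρ.Z (expI (c p.2)) (ρ.W (j p.1) ψ) := rfl

theorem weylFamily_zero (ψ : H) : (ρ.weylFamily j c).U 0 ψ = ψ := by
  rw [weylFamily_apply, Prod.fst_zero, Prod.snd_zero, map_zero, map_zero, W_zero, Z_expI_zero]

theorem inner_weylFamily (p : A × B) (ψ φ : H) :
    inner ℂ ((ρ.weylFamily j c).U p ψ) φ = inner ℂ ψ ((ρ.weylFamily j c).U (-p) φ) := by
  rw [weylFamily_apply, weylFamily_apply, inner_Z_left, star_expI, inner_W_left, W_comm_Z_apply,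
    Prod.fst_neg, Prod.snd_neg, map_neg, map_neg]

variable {j c} {β : A →L[ℝ] A →L[ℝ] B}

/-- Left multiplication in the Heisenberg group: the Weyl phase becomes a shift of the central
parameter, with factor `-1/2`. -/
theorem W_weylFamily (hβ : ∀ u v, sympl (j u) (j v) = c (β u v)) (u : A) (t : ℝ) (p : A × B)
    (ψ : H) : ρ.W (t • j u) ((ρ.weylFamily j c).U p ψ) =
      (ρ.weylFamily j c).U (p + t • (u, ((-(1 / 2) : ℝ) • β u) p.1)) ψ := by
  rw [weylFamily_apply, weylFamily_apply, W_comm_Z_apply, weyl_apply, ← map_smul, hβ,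
    ← Z_expI_add, ← map_add, ← map_smul, ← map_add]
  simp only [Prod.fst_add, Prod.snd_add, Prod.smul_fst, Prod.smul_snd]
  rw [add_comm (t • u) p.1]
  congr 4
  congr 1
  rw [map_smul, smul_apply, smul_apply, smul_comm t]

/-- Right multiplication exchanges the arguments of the antisymmetric form, so the factor becomes
`+1/2`. -/
theorem weylFamily_W (hβ : ∀ u v, sympl (j u) (j v) = c (β u v)) (halt : ∀ u v, β u v = -β v u)
    (u : A) (t : ℝ) (p : A × B) (ψ : H) : (ρ.weylFamily j c).U p (ρ.W (t • j u) ψ) =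
      (ρ.weylFamily j c).U (p + t • (u, ((1 / 2 : ℝ) • β u) p.1)) ψ := by
  rw [weylFamily_apply, weylFamily_apply, weyl_apply, ← map_smul, hβ,
    ← Z_expI_add, ← map_add, ← map_smul, ← map_add]
  simp only [Prod.fst_add, Prod.snd_add, Prod.smul_fst, Prod.smul_snd]
  congr 4
  congr 1
  rw [halt, map_smul, smul_apply, smul_apply, smul_comm t]
  simp

theorem Z_weylFamily (b : B) (t : ℝ) (p : A × B) (ψ : H) :
    ρ.Z (expI (t • c b)) ((ρ.weylFamily j c).U p ψ) =
      (ρ.weylFamily j c).U (p + t • ((0 : A), b)) ψ := by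
  rw [weylFamily_apply, weylFamily_apply, ← Z_expI_add, ← map_smul, ← map_add]
  simp [add_comm]

theorem weylFamily_Z (b : B) (t : ℝ) (p : A × B) (ψ : H) :
    (ρ.weylFamily j c).U p (ρ.Z (expI (t • c b)) ψ) =
      (ρ.weylFamily j c).U (p + t • ((0 : A), b)) ψ := by
  rw [← Z_weylFamily, weylFamily_apply, weylFamily_apply, W_comm_Z_apply, Z_comm]

end WeylFamily

end EventRep

end QST

end

/-! ### The seven-dimensional Heisenberg group for two directions, and radial functions on it. -/

noncomputable section

namespace QST

open Filter Topology MeasureTheory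
open scoped ContDiff

theorem measurePreserving_add_right_prod {A B : Type*} [AddGroup A] [MeasureSpace A]
    [MeasurableAdd A] [AddGroup B] [MeasureSpace B] [MeasurableAdd B] [SFinite (volume : Measure A)]
    [SFinite (volume : Measure B)] [(volume : Measure A).IsAddRightInvariant]
    [(volume : Measure B).IsAddRightInvariant] (p : A × B) :
    MeasurePreserving fun x : A × B => x + p :=
  (measurePreserving_add_right (volume : Measure A) p.1).prod
    (measurePreserving_add_right (volume : Measure B) p.2)

/-! ### The Heisenberg group of one pair of directions -/

/-- Parameters `(x, y)` of three events in two directions. -/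
abbrev PairVec : Type := Fin 2 → Fin 3 → ℝ

/-- Parameters of three events in two directions and the centre. -/
abbrev PairSpace : Type := PairVec × ℝ

/-- The unit vector of the event `a` in the direction `i`. -/
def pairUnit (i : Fin 2) (a : Fin 3) : PairVec := Pi.single i (Pi.single a 1)

/-- The inclusion of `PairVec` given by the directions `μ`, `ν`. -/
def pairEmb (μ ν : Fin 4) : PairVec →L[ℝ] (Fin 3 → Fin 4 → ℝ) :=
  LinearMap.toContinuousLinearMap
    { toFun := fun v a => Pi.single μ (v 0 a) + Pi.single ν (v 1 a)
      map_add' := fun v w => by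
        ext a l
        simp only [Pi.add_apply, Pi.single_add]
        ring
      map_smul' := fun r v => by
        ext a l
        simp only [Pi.smul_apply, Pi.add_apply, RingHom.id_apply, Pi.single_smul, smul_add] }

theorem pairEmb_apply (μ ν : Fin 4) (v : PairVec) (a : Fin 3) :
    pairEmb μ ν v a = Pi.single μ (v 0 a) + Pi.single ν (v 1 a) := rfl

/-- The symplectic form on `PairVec`. -/
def pairForm : PairVec →L[ℝ] PairVec →L[ℝ] ℝ :=
  (LinearMap.mk₂ ℝ (fun v w : PairVec => ∑ a, (v 0 a * w 1 a - v 1 a * w 0 a))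
    (fun v v' w => by
      rw [← Finset.sum_add_distrib]
      exact Finset.sum_congr rfl fun a _ => by simp only [Pi.add_apply]; ring)
    (fun r v w => by
      rw [smul_eq_mul, Finset.mul_sum]
      exact Finset.sum_congr rfl fun a _ => by simp only [Pi.smul_apply, smul_eq_mul]; ring)
    (fun v w w' => by
      rw [← Finset.sum_add_distrib]
      exact Finset.sum_congr rfl fun a _ => by simp only [Pi.add_apply]; ring)
    (fun r v w => by
      rw [smul_eq_mul, Finset.mul_sum]
      exact Finset.sum_congr rfl fun a _ => by
        simp only [Pi.smul_apply, smul_eq_mul]; ring)).toContinuousBilinearMap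

theorem pairForm_apply (v w : PairVec) :
    pairForm v w = ∑ a, (v 0 a * w 1 a - v 1 a * w 0 a) := rfl

theorem pairForm_alt (v w : PairVec) : pairForm v w = -pairForm w v := by
  rw [pairForm_apply, pairForm_apply, ← Finset.sum_neg_distrib]
  exact Finset.sum_congr rfl fun a _ => by ring

theorem pairForm_self (v : PairVec) : pairForm v v = 0 := by
  have := pairForm_alt v v
  linarith

theorem pairForm_unit_zero (a : Fin 3) (v : PairVec) : pairForm (pairUnit 0 a) v = v 1 a := by
  rw [pairForm_apply]
  simp [pairUnit, Pi.single_apply]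

theorem pairForm_unit_one (a : Fin 3) (v : PairVec) : pairForm (pairUnit 1 a) v = -v 0 a := by
  rw [pairForm_apply]
  simp [pairUnit, Pi.single_apply]

/-- The central parameter. -/
def pairCentre (μ ν : Fin 4) : ℝ →L[ℝ] C(Sig, ℝ) :=
  ContinuousLinearMap.toSpanSingleton ℝ (coordQ μ ν)

theorem pairCentre_apply (μ ν : Fin 4) (θ : ℝ) : pairCentre μ ν θ = θ • coordQ μ ν := rfl

theorem sympl_pairEmb (μ ν : Fin 4) (u v : PairVec) :
    sympl (pairEmb μ ν u) (pairEmb μ ν v) = pairCentre μ ν (pairForm u v) := by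
  ext σ
  rw [sympl_apply, pairCentre_apply, pairForm_apply, ContinuousMap.smul_apply, smul_eq_mul,
    Finset.sum_mul]
  refine Finset.sum_congr rfl fun a _ => ?_
  -- The diagonal entries of `Q` vanish, so the products within a single direction drop out.
  have hm : σ.1 μ μ = 0 := by have := sig_antisymm σ μ μ; linarith
  have hn : σ.1 ν ν = 0 := by have := sig_antisymm σ ν ν; linarith
  have key : ∀ (p q : ℝ) (F : Fin 4 → ℝ),
      ∑ l, (Pi.single μ p + Pi.single ν q : Fin 4 → ℝ) l * F l = p * F μ + q * F ν := by
    intro p q F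
    simp only [Pi.add_apply, add_mul, Finset.sum_add_distrib]
    simp [Pi.single_apply]
  simp_rw [mul_assoc, ← Finset.mul_sum, pairEmb_apply]
  rw [key, key, key, hm, hn, sig_antisymm σ ν μ]
  change _ = _ * σ.1 μ ν
  ring

theorem pairEmb_unit (μ ν : Fin 4) (i : Fin 2) (a : Fin 3) :
    pairEmb μ ν (pairUnit i a) = Pi.single a (Pi.single (![μ, ν] i) 1) := by
  ext b l
  rw [pairEmb_apply]
  fin_cases i <;> by_cases h : b = a
  · subst h; simp [pairUnit]
  · simp [pairUnit, h]
  · subst h; simp [pairUnit]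
  · simp [pairUnit, h]

/-- The vector field of the left (`κ = -1/2`) and right (`κ = 1/2`) translations. -/
def pairField (κ : ℝ) (u : PairVec) (p : PairSpace) : PairSpace := (u, (κ • pairForm u) p.1)

theorem isLinearFlow_pairField (κ : ℝ) (u : PairVec) : IsLinearFlow (pairField κ u) :=
  isLinearFlow_shear u (κ • pairForm u) (by rw [smul_apply, pairForm_self, smul_zero])

/-- The vector field of the translations of the centre. -/
def centreField (_ : PairSpace) : PairSpace := (0, 1)

theorem isLinearFlow_centreField : IsLinearFlow centreField := by
  refine ⟨contDiff_const, fun _ _ => rfl, fun t => ?_⟩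
  exact measurePreserving_add_right_prod (t • ((0 : PairVec), (1 : ℝ)))

instance isNegInvariant_volume_pairSpace : (volume : Measure PairSpace).IsNegInvariant :=
  ⟨((Measure.measurePreserving_neg (volume : Measure PairVec)).prod
    (Measure.measurePreserving_neg (volume : Measure ℝ))).map_eq⟩

/-- The derivative in the direction of the event `a` and the direction `i`. -/
def pairDeriv (κ : ℝ) (i : Fin 2) (a : Fin 3) (f : PairSpace → ℝ) : PairSpace → ℝ :=
  lieDeriv (pairField κ (pairUnit i a)) f

theorem IsTest.pairDeriv {f : PairSpace → ℝ} (hf : IsTest f) (κ : ℝ) (i : Fin 2) (a : Fin 3) :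
    IsTest (pairDeriv κ i a f) :=
  hf.lieDeriv (isLinearFlow_pairField κ _).smooth

/-! ### Radial functions -/

/-- The square of the Euclidean norm. -/
def radSq (p : PairSpace) : ℝ := ∑ a, p.1 0 a ^ 2 + ∑ a, p.1 1 a ^ 2 + p.2 ^ 2

theorem contDiff_radSq : ContDiff ℝ ∞ radSq := by
  unfold radSq
  fun_prop

theorem sq_norm_le_radSq (p : PairSpace) : ‖p‖ ^ 2 ≤ radSq p := by
  have h0 : ∀ i, 0 ≤ ∑ a, p.1 i a ^ 2 := fun i => Finset.sum_nonneg fun a _ => sq_nonneg _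
  have hle : ‖p‖ ≤ √(radSq p) := by
    rw [Prod.norm_def]
    refine max_le ?_ ?_
    · refine (pi_norm_le_iff_of_nonneg (Real.sqrt_nonneg _)).2 fun i =>
        (pi_norm_le_iff_of_nonneg (Real.sqrt_nonneg _)).2 fun a => ?_
      refine Real.abs_le_sqrt ?_
      have h1 : p.1 i a ^ 2 ≤ ∑ a, p.1 i a ^ 2 :=
        Finset.single_le_sum (fun a _ => sq_nonneg (p.1 i a)) (Finset.mem_univ a)
      have h2 : ∑ a, p.1 i a ^ 2 ≤ ∑ a, p.1 0 a ^ 2 + ∑ a, p.1 1 a ^ 2 := by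
        fin_cases i
        · exact le_add_of_nonneg_right (h0 1)
        · exact le_add_of_nonneg_left (h0 0)
      unfold radSq
      linarith [sq_nonneg p.2]
    · refine Real.abs_le_sqrt ?_
      unfold radSq
      linarith [h0 0, h0 1]
  have hnn : 0 ≤ radSq p := by
    unfold radSq
    linarith [h0 0, h0 1, sq_nonneg p.2]
  calc ‖p‖ ^ 2 ≤ √(radSq p) ^ 2 := pow_le_pow_left₀ (norm_nonneg _) hle 2
    _ = radSq p := Real.sq_sqrt hnn

theorem isTest_radial {h : ℝ → ℝ} (hh : IsTest h) : IsTest fun p => h (radSq p) where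
  smooth := hh.smooth.comp contDiff_radSq
  supp := by
    obtain ⟨C, hC⟩ := hh.supp.isBounded.exists_norm_le
    refine HasCompactSupport.of_support_subset_isCompact
      -- On the support `‖p‖² ≤ radSq p ≤ C`, and `‖p‖ ≤ 1 + ‖p‖²`.
      (isCompact_closedBall (0 : PairSpace) (1 + C)) fun p hp => ?_
    have h1 := (le_abs_self _).trans (hC _ (subset_tsupport _ hp))
    have h2 := sq_norm_le_radSq p
    rw [mem_closedBall_zero_iff]
    nlinarith [norm_nonneg p, sq_nonneg (‖p‖ - 1)]

theorem isTest_deriv {h : ℝ → ℝ} (hh : IsTest h) : IsTest (deriv h) where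
  smooth := (contDiff_infty_iff_deriv.1 hh.smooth).2
  supp := hh.supp.deriv

theorem lieDeriv_eq {V : Type*} [NormedAddCommGroup V] [NormedSpace ℝ V] {f : V → ℝ} {X : V → V}
    {x : V} {d : ℝ} (hf : DifferentiableAt ℝ f x)
    (h : HasDerivAt (fun t : ℝ => f (x + t • X x)) d 0) : lieDeriv X f x = d := by
  have h1 : HasDerivAt (fun t : ℝ => x + t • X x) (X x) 0 := by
    simpa using ((hasDerivAt_id (0 : ℝ)).smul_const (X x)).const_add x
  have hf' : HasFDerivAt f (fderiv ℝ f x) (x + (0 : ℝ) • X x) := by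
    simpa using hf.hasFDerivAt
  have h2 := hf'.comp_hasDerivAt (0 : ℝ) h1
  exact h2.unique h

section Line

variable (p Y : PairSpace)

theorem hasDerivAt_line_fst (i : Fin 2) (a : Fin 3) :
    HasDerivAt (fun t : ℝ => (p + t • Y).1 i a) (Y.1 i a) 0 := by
  have := ((hasDerivAt_id (0 : ℝ)).mul_const (Y.1 i a)).const_add (p.1 i a)
  simpa using this

theorem hasDerivAt_line_snd : HasDerivAt (fun t : ℝ => (p + t • Y).2) Y.2 0 := by
  have := ((hasDerivAt_id (0 : ℝ)).mul_const Y.2).const_add p.2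
  simpa using this

theorem hasDerivAt_line_form (u : PairVec) :
    HasDerivAt (fun t : ℝ => pairForm u (p + t • Y).1) (pairForm u Y.1) 0 := by
  have := ((hasDerivAt_id (0 : ℝ)).mul_const (pairForm u Y.1)).const_add (pairForm u p.1)
  simpa using this

theorem hasDerivAt_line_radSq : HasDerivAt (fun t : ℝ => radSq (p + t • Y))
    (∑ a, 2 * p.1 0 a * Y.1 0 a + ∑ a, 2 * p.1 1 a * Y.1 1 a + 2 * p.2 * Y.2) 0 := by
  have h1 : ∀ i, HasDerivAt (fun t : ℝ => ∑ a, (p + t • Y).1 i a ^ 2)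
      (∑ a, 2 * p.1 i a * Y.1 i a) 0 := fun i =>
    HasDerivAt.fun_sum fun a _ => by simpa using (hasDerivAt_line_fst p Y i a).fun_pow 2
  have h2 : HasDerivAt (fun t : ℝ => (p + t • Y).2 ^ 2) (2 * p.2 * Y.2) 0 := by
    simpa using (hasDerivAt_line_snd p Y).fun_pow 2
  exact ((h1 0).add (h1 1)).add h2

end Line

/-- The derivative of `radSq` along `pairField κ (pairUnit i a)`. -/
def radDeriv (κ : ℝ) (i : Fin 2) (a : Fin 3) (p : PairSpace) : ℝ :=
  2 * p.1 i a + 2 * p.2 * (κ * pairForm (pairUnit i a) p.1)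

theorem hasDerivAt_radSq_pairField (κ : ℝ) (i : Fin 2) (a : Fin 3) (p : PairSpace) :
    HasDerivAt (fun t : ℝ => radSq (p + t • pairField κ (pairUnit i a) p))
      (radDeriv κ i a p) 0 := by
  convert hasDerivAt_line_radSq p (pairField κ (pairUnit i a) p) using 1
  rw [radDeriv]
  congr 1
  fin_cases i <;> simp [pairField, pairUnit, Pi.single_apply]

theorem pairDeriv_radial {h : ℝ → ℝ} (hh : IsTest h) (κ : ℝ) (i : Fin 2) (a : Fin 3) :
    pairDeriv κ i a (fun p => h (radSq p)) = fun p => deriv h (radSq p) * radDeriv κ i a p := by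
  ext p
  refine lieDeriv_eq ((isTest_radial hh).smooth.differentiable (by simp) p) ?_
  have h1 := (hh.smooth.differentiable (by simp) (radSq p)).hasDerivAt
  have h2 := hasDerivAt_radSq_pairField κ i a p
  have e : radSq (p + (0 : ℝ) • pairField κ (pairUnit i a) p) = radSq p := by simp
  rw [← e] at h1
  have := h1.comp (0 : ℝ) h2
  rw [e] at this
  exact this

theorem centreDeriv_radial {h : ℝ → ℝ} (hh : IsTest h) :
    lieDeriv centreField (fun p => h (radSq p)) = fun p => 2 * p.2 * deriv h (radSq p) := by
  ext p
  refine lieDeriv_eq ((isTest_radial hh).smooth.differentiable (by simp) p) ?_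
  have h1 := (hh.smooth.differentiable (by simp) (radSq p)).hasDerivAt
  have h2 := hasDerivAt_line_radSq p (centreField p)
  have e : radSq (p + (0 : ℝ) • centreField p) = radSq p := by simp
  rw [← e] at h1
  have := h1.comp (0 : ℝ) h2
  rw [e] at this
  simpa [centreField, mul_comm, Function.comp_def] using this

theorem pairDeriv_pairDeriv_radial {h : ℝ → ℝ} (hh : IsTest h) (κ : ℝ) (i j : Fin 2)
    (a b : Fin 3) : pairDeriv κ i a (pairDeriv κ j b fun p => h (radSq p)) = fun p =>
      deriv (deriv h) (radSq p) * radDeriv κ i a p * radDeriv κ j b p +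
      deriv h (radSq p) * (2 * pairUnit i a j b + 2 * κ * (κ * pairForm (pairUnit i a) p.1 *
        pairForm (pairUnit j b) p.1 + p.2 * pairForm (pairUnit j b) (pairUnit i a))) := by
  ext p
  refine lieDeriv_eq (((isTest_radial hh).pairDeriv κ j b).smooth.differentiable (by simp) p) ?_
  rw [pairDeriv_radial hh]
  set Y := pairField κ (pairUnit i a) p with hY
  have e : p + (0 : ℝ) • Y = p := by simp
  have h1 := ((isTest_deriv hh).smooth.differentiable (by simp) (radSq p)).hasDerivAt
  have h2 := hasDerivAt_radSq_pairField κ i a p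
  rw [← hY] at h2
  nth_rw 2 [← e] at h1
  have h3 := h1.comp (0 : ℝ) h2
  have h4 : HasDerivAt (fun t : ℝ => radDeriv κ j b (p + t • Y))
      (2 * pairUnit i a j b + 2 * κ * (κ * pairForm (pairUnit i a) p.1 *
        pairForm (pairUnit j b) p.1 + p.2 * pairForm (pairUnit j b) (pairUnit i a))) 0 := by
    have := ((hasDerivAt_line_fst p Y j b).const_mul 2).add
      (((hasDerivAt_line_snd p Y).const_mul 2).mul
        ((hasDerivAt_line_form p Y (pairUnit j b)).const_mul κ))
    have hv : 2 * pairUnit i a j b + 2 * κ * (κ * pairForm (pairUnit i a) p.1 *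
        pairForm (pairUnit j b) p.1 + p.2 * pairForm (pairUnit j b) (pairUnit i a)) =
        2 * Y.1 j b + (2 * Y.2 * (κ * pairForm (pairUnit j b) (p + (0 : ℝ) • Y).1) +
          2 * (p + (0 : ℝ) • Y).2 * (κ * pairForm (pairUnit j b) Y.1)) := by
      rw [e, hY]
      simp only [pairField, smul_apply, smul_eq_mul]
      ring
    rw [hv]
    exact this
  have h5 := h3.mul h4
  simp only [Function.comp_apply, e] at h5
  exact h5

end QST

end

noncomputable section

namespace QST

open Filter Topology MeasureTheory
open scoped ContDiff

/-! ### Kernels of the antisymmetrized products -/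

/-- The kernel of the antisymmetrization of `q_2 q_3 - q_1 q_3 + q_1 q_2`. -/
def wedgeKer (h : ℝ → ℝ) (p : PairSpace) : ℝ :=
  -((4 + p.2 ^ 2) * deriv (deriv h) (radSq p) + 1 / 2 * deriv h (radSq p)) *
    ((p.1 0 1 * p.1 1 2 - p.1 1 1 * p.1 0 2) - (p.1 0 0 * p.1 1 2 - p.1 1 0 * p.1 0 2) +
      (p.1 0 0 * p.1 1 1 - p.1 1 0 * p.1 0 1))

/-- The kernel of the centre. -/
def centreKer (h : ℝ → ℝ) (p : PairSpace) : ℝ := 2 * p.2 * deriv h (radSq p)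

theorem radSq_neg (p : PairSpace) : radSq (-p) = radSq p := by simp [radSq]

theorem wedgeKer_neg (h : ℝ → ℝ) (p : PairSpace) : wedgeKer h (-p) = wedgeKer h p := by
  simp only [wedgeKer, radSq_neg, Prod.fst_neg, Prod.snd_neg, Pi.neg_apply]
  ring

theorem centreKer_neg (h : ℝ → ℝ) (p : PairSpace) : centreKer h (-p) = -centreKer h p := by
  simp only [centreKer, radSq_neg, Prod.snd_neg]
  ring

/-- The second derivatives of the radial function given by `h`. -/
def radial₂ (h : ℝ → ℝ) (κ : ℝ) (i : Fin 2) (a : Fin 3) (j : Fin 2) (b : Fin 3) : PairSpace → ℝ :=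
  pairDeriv κ i a (pairDeriv κ j b fun p => h (radSq p))

section Radial

variable {h : ℝ → ℝ}

theorem isTest_radial₂ (hh : IsTest h) (κ : ℝ) (i : Fin 2) (a : Fin 3) (j : Fin 2) (b : Fin 3) :
    IsTest (radial₂ h κ i a j b) :=
  ((isTest_radial hh).pairDeriv κ j b).pairDeriv κ i a

/-- Coordinates of different events commute, and so do their vector fields. -/
theorem radial₂_comm (hh : IsTest h) (κ : ℝ) {a b : Fin 3} (hab : a ≠ b) (i j : Fin 2) :
    radial₂ h κ i a j b = radial₂ h κ j b i a := by
  ext p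
  rw [radial₂, radial₂, pairDeriv_pairDeriv_radial hh, pairDeriv_pairDeriv_radial hh]
  have e1 : ∀ (i j : Fin 2) {a b : Fin 3}, a ≠ b → pairUnit i a j b = 0 := by
    intro i j a b hab
    by_cases hij : i = j
    · subst hij
      simp [pairUnit, hab]
    · simp [pairUnit, Ne.symm hij]
  have e2 : ∀ (i j : Fin 2) {a b : Fin 3}, a ≠ b → pairForm (pairUnit j b) (pairUnit i a) = 0 := by
    intro i j a b hab
    fin_cases j
    · exact (pairForm_unit_zero _ _).trans (e1 _ _ hab)
    · exact (pairForm_unit_one _ _).trans (by rw [e1 _ _ hab, neg_zero])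
  rw [e1 i j hab, e1 j i hab.symm, e2 i j hab, e2 j i hab.symm]
  ring

theorem radial₂_zero_one (hh : IsTest h) (κ : ℝ) {a b : Fin 3} (hab : a ≠ b) (p : PairSpace) :
    radial₂ h κ 0 a 1 b p =
      deriv (deriv h) (radSq p) * (2 * p.1 0 a + 2 * p.2 * (κ * p.1 1 a)) *
        (2 * p.1 1 b - 2 * p.2 * (κ * p.1 0 b)) -
      deriv h (radSq p) * (2 * κ ^ 2 * p.1 1 a * p.1 0 b) := by
  rw [radial₂, pairDeriv_pairDeriv_radial hh]
  simp only [radDeriv, pairForm_unit_zero, pairForm_unit_one]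
  simp [pairUnit, hab]
  ring

theorem radial₂_one_zero (hh : IsTest h) (κ : ℝ) {a b : Fin 3} (hab : a ≠ b) (p : PairSpace) :
    radial₂ h κ 1 a 0 b p =
      deriv (deriv h) (radSq p) * (2 * p.1 0 b + 2 * p.2 * (κ * p.1 1 b)) *
        (2 * p.1 1 a - 2 * p.2 * (κ * p.1 0 a)) -
      deriv h (radSq p) * (2 * κ ^ 2 * p.1 1 b * p.1 0 a) := by
  rw [radial₂_comm hh κ hab, radial₂_zero_one hh κ hab.symm]

/-- The canonical commutation relation at the level of kernels: the bracket of the two fields of one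
event is `2 κ` times the central derivative. -/
theorem radial₂_commutator (hh : IsTest h) (κ : ℝ) (a : Fin 3) (p : PairSpace) :
    radial₂ h κ 1 a 0 a p - radial₂ h κ 0 a 1 a p = 4 * κ * p.2 * deriv h (radSq p) := by
  rw [radial₂, radial₂, pairDeriv_pairDeriv_radial hh, pairDeriv_pairDeriv_radial hh]
  simp only [pairForm_unit_zero, pairForm_unit_one]
  simp [pairUnit]
  ring

/-- The decisive cancellation. On radial functions the terms linear in `κ` cancel under
antisymmetrization, so the result depends on `κ²` only and is the same for left (`κ = -1/2`) and
right (`κ = 1/2`) fields. The positive sign of the index order `1, 0` comes from `i² = -1`. -/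
theorem wedgeKer_eq (hh : IsTest h) {κ : ℝ} (hκ : κ ^ 2 = 1 / 4) : wedgeKer h =
    (radial₂ h κ 1 1 0 2 - radial₂ h κ 1 0 0 2 + radial₂ h κ 1 0 0 1) -
    (radial₂ h κ 0 1 1 2 - radial₂ h κ 0 0 1 2 + radial₂ h κ 0 0 1 1) := by
  ext p
  simp only [Pi.sub_apply, Pi.add_apply]
  rw [radial₂_one_zero hh κ (by decide), radial₂_one_zero hh κ (by decide),
    radial₂_one_zero hh κ (by decide), radial₂_zero_one hh κ (by decide),
    radial₂_zero_one hh κ (by decide), radial₂_zero_one hh κ (by decide), wedgeKer]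
  linear_combination (deriv (deriv h) (radSq p) * 4 * p.2 ^ 2 + 2 * deriv h (radSq p)) *
    ((p.1 0 1 * p.1 1 2 - p.1 1 1 * p.1 0 2) - (p.1 0 0 * p.1 1 2 - p.1 1 0 * p.1 0 2) +
      (p.1 0 0 * p.1 1 1 - p.1 1 0 * p.1 0 1)) * hκ

theorem isTest_wedgeKer (hh : IsTest h) : IsTest (wedgeKer h) := by
  rw [wedgeKer_eq hh (κ := 1 / 2) (by norm_num)]
  have hT := isTest_radial₂ hh
  exact (((hT _ _ _ _ _).sub (hT _ _ _ _ _)).add (hT _ _ _ _ _)).sub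
    (((hT _ _ _ _ _).sub (hT _ _ _ _ _)).add (hT _ _ _ _ _))

theorem centreKer_eq (hh : IsTest h) :
    centreKer h = lieDeriv centreField fun p => h (radSq p) :=
  (centreDeriv_radial hh).symm

theorem isTest_centreKer (hh : IsTest h) : IsTest (centreKer h) := by
  rw [centreKer_eq hh]
  exact (isTest_radial hh).lieDeriv isLinearFlow_centreField.smooth

/-- The extra terms, with both indices at the middle event, form the commutator responsible for the
central part `-i Q`. -/
theorem wedgeKer_add_centreKer_left (hh : IsTest h) : wedgeKer h + centreKer h =
    ((radial₂ h (-(1 / 2)) 1 1 0 2 - radial₂ h (-(1 / 2)) 1 1 0 1) -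
      (radial₂ h (-(1 / 2)) 1 0 0 2 - radial₂ h (-(1 / 2)) 1 0 0 1)) -
    ((radial₂ h (-(1 / 2)) 0 1 1 2 - radial₂ h (-(1 / 2)) 0 1 1 1) -
      (radial₂ h (-(1 / 2)) 0 0 1 2 - radial₂ h (-(1 / 2)) 0 0 1 1)) := by
  rw [wedgeKer_eq hh (κ := -(1 / 2)) (by norm_num)]
  ext p
  have := radial₂_commutator hh (-(1 / 2)) 1 p
  simp only [Pi.sub_apply, Pi.add_apply, centreKer]
  linear_combination this

/-- Right fields act in the opposite order; this sign compensates the change of sign of `κ`, so the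
central term agrees with that from the left fields. -/
theorem wedgeKer_add_centreKer_right (hh : IsTest h) : wedgeKer h + centreKer h =
    ((radial₂ h (1 / 2) 0 2 1 1 - radial₂ h (1 / 2) 0 1 1 1) -
      (radial₂ h (1 / 2) 0 2 1 0 - radial₂ h (1 / 2) 0 1 1 0)) -
    ((radial₂ h (1 / 2) 1 2 0 1 - radial₂ h (1 / 2) 1 1 0 1) -
      (radial₂ h (1 / 2) 1 2 0 0 - radial₂ h (1 / 2) 1 1 0 0)) := by
  rw [wedgeKer_eq hh (κ := 1 / 2) (by norm_num),
    radial₂_comm hh (1 / 2) (a := 2) (b := 1) (by decide) 0 1,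
    radial₂_comm hh (1 / 2) (a := 2) (b := 1) (by decide) 1 0,
    radial₂_comm hh (1 / 2) (a := 2) (b := 0) (by decide) 0 1,
    radial₂_comm hh (1 / 2) (a := 2) (b := 0) (by decide) 1 0,
    radial₂_comm hh (1 / 2) (a := 1) (b := 0) (by decide) 0 1,
    radial₂_comm hh (1 / 2) (a := 1) (b := 0) (by decide) 1 0]
  ext p
  have := radial₂_commutator hh (1 / 2) 1 p
  simp only [Pi.sub_apply, Pi.add_apply, centreKer]
  linear_combination -this

theorem wedgeKer_eq_right (hh : IsTest h) : wedgeKer h =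
    (radial₂ h (1 / 2) 0 2 1 1 - radial₂ h (1 / 2) 0 2 1 0 + radial₂ h (1 / 2) 0 1 1 0) -
    (radial₂ h (1 / 2) 1 2 0 1 - radial₂ h (1 / 2) 1 2 0 0 + radial₂ h (1 / 2) 1 1 0 0) := by
  rw [wedgeKer_eq hh (κ := 1 / 2) (by norm_num),
    radial₂_comm hh (1 / 2) (a := 2) (b := 1) (by decide) 0 1,
    radial₂_comm hh (1 / 2) (a := 2) (b := 1) (by decide) 1 0,
    radial₂_comm hh (1 / 2) (a := 2) (b := 0) (by decide) 0 1,
    radial₂_comm hh (1 / 2) (a := 2) (b := 0) (by decide) 1 0,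
    radial₂_comm hh (1 / 2) (a := 1) (b := 0) (by decide) 0 1,
    radial₂_comm hh (1 / 2) (a := 1) (b := 0) (by decide) 1 0]

end Radial

end QST

end

/-! ### Left and right action of the area components on radial smearings. -/

noncomputable section

namespace QST

open Filter Topology MeasureTheory
open scoped ContDiff

namespace ContractionFamily

variable {V : Type*} [NormedAddCommGroup V] [NormedSpace ℝ V] [MeasureSpace V] [BorelSpace V]
  [IsFiniteMeasureOnCompacts (volume : Measure V)]
  {H : Type*} [NormedAddCommGroup H] [InnerProductSpace ℂ H] (R : ContractionFamily V H)
  {f₁ f₂ f₃ f₄ g₁ g₂ g₃ g₄ : V → ℝ}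

theorem smear_sub_add_sub (hf₁ : IsTest f₁) (hf₂ : IsTest f₂) (hf₃ : IsTest f₃) (hg₁ : IsTest g₁)
    (hg₂ : IsTest g₂) (hg₃ : IsTest g₃) (ψ : H) :
    R.smear ((f₁ - f₂ + f₃) - (g₁ - g₂ + g₃)) ψ =
      -(R.smear g₁ ψ - R.smear g₂ ψ + R.smear g₃ ψ) -
        -(R.smear f₁ ψ - R.smear f₂ ψ + R.smear f₃ ψ) := by
  rw [R.smear_sub ((hf₁.sub hf₂).add hf₃) ((hg₁.sub hg₂).add hg₃), R.smear_add (hf₁.sub hf₂) hf₃,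
    R.smear_add (hg₁.sub hg₂) hg₃, R.smear_sub hf₁ hf₂, R.smear_sub hg₁ hg₂]
  abel

theorem smear_sub_sub_sub (hf₁ : IsTest f₁) (hf₂ : IsTest f₂) (hf₃ : IsTest f₃) (hf₄ : IsTest f₄)
    (hg₁ : IsTest g₁) (hg₂ : IsTest g₂) (hg₃ : IsTest g₃) (hg₄ : IsTest g₄) (ψ : H) :
    R.smear (((f₁ - f₂) - (f₃ - f₄)) - ((g₁ - g₂) - (g₃ - g₄))) ψ =
      -((R.smear g₁ ψ - R.smear g₂ ψ) - (R.smear g₃ ψ - R.smear g₄ ψ)) -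
        -((R.smear f₁ ψ - R.smear f₂ ψ) - (R.smear f₃ ψ - R.smear f₄ ψ)) := by
  rw [R.smear_sub ((hf₁.sub hf₂).sub (hf₃.sub hf₄)) ((hg₁.sub hg₂).sub (hg₃.sub hg₄)),
    R.smear_sub (hf₁.sub hf₂) (hf₃.sub hf₄), R.smear_sub (hg₁.sub hg₂) (hg₃.sub hg₄),
    R.smear_sub hf₁ hf₂, R.smear_sub hg₁ hg₂, R.smear_sub hf₃ hf₄, R.smear_sub hg₃ hg₄]
  abel

end ContractionFamily

namespace EventRep

variable {H : Type*} [NormedAddCommGroup H] [InnerProductSpace ℂ H] [CompleteSpace H]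
  (ρ : EventRep 3 H) (μ ν : Fin 4)

/-- The Weyl operators of the directions `μ`, `ν`, with the centre. -/
def pairFamily : ContractionFamily PairSpace H := ρ.weylFamily (pairEmb μ ν) (pairCentre μ ν)

variable {f : PairSpace → ℝ}

theorem smear_mem_graph_q (hf : IsTest f) (i : Fin 2) (a : Fin 3) (ψ : H) :
    ((ρ.pairFamily μ ν).smear f ψ,
      Complex.I • (ρ.pairFamily μ ν).smear (pairDeriv (-(1 / 2)) i a f) ψ) ∈
      (ρ.q a (![μ, ν] i)).graph := by
  refine (ρ.pairFamily μ ν).smear_mem_graph_generator (isLinearFlow_pairField _ _)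
    (fun t x φ => ?_) hf ψ
  rw [← pairEmb_unit]
  exact ρ.W_weylFamily (sympl_pairEmb μ ν) _ _ _ _

theorem smear_eq_of_mem_graph_q (hf : IsTest f) {i : Fin 2} {a : Fin 3} {ψ φ : H}
    (h : (ψ, φ) ∈ (ρ.q a (![μ, ν] i)).graph) : (ρ.pairFamily μ ν).smear f φ =
      Complex.I • (ρ.pairFamily μ ν).smear (pairDeriv (1 / 2) i a f) ψ := by
  refine (ρ.pairFamily μ ν).smear_eq_of_mem_graph_generator (isLinearFlow_pairField _ _)
    (fun t x χ => ?_) hf h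
  rw [← pairEmb_unit]
  exact ρ.weylFamily_W (sympl_pairEmb μ ν) pairForm_alt _ _ _ _

theorem smear_mem_graph_coordQ (hf : IsTest f) (ψ : H) :
    ((ρ.pairFamily μ ν).smear f ψ,
      Complex.I • (ρ.pairFamily μ ν).smear (lieDeriv centreField f) ψ) ∈
      (ρ.centralOp (coordQ μ ν)).graph := by
  refine (ρ.pairFamily μ ν).smear_mem_graph_generator isLinearFlow_centreField
    (fun t x φ => ?_) hf ψ
  have := ρ.Z_weylFamily (j := pairEmb μ ν) (c := pairCentre μ ν) 1 t x φ
  rwa [pairCentre_apply, one_smul] at this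

theorem smear_eq_of_mem_graph_coordQ (hf : IsTest f) {ψ φ : H}
    (h : (ψ, φ) ∈ (ρ.centralOp (coordQ μ ν)).graph) : (ρ.pairFamily μ ν).smear f φ =
      Complex.I • (ρ.pairFamily μ ν).smear (lieDeriv centreField f) ψ := by
  refine (ρ.pairFamily μ ν).smear_eq_of_mem_graph_generator isLinearFlow_centreField
    (fun t x χ => ?_) hf h
  have := ρ.weylFamily_Z (j := pairEmb μ ν) (c := pairCentre μ ν) 1 t x χ
  rwa [pairCentre_apply, one_smul] at this

variable {h : ℝ → ℝ}

/-- The smearing with a radial function. -/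
def radSmear (h : ℝ → ℝ) : H →L[ℂ] H := (ρ.pairFamily μ ν).smear fun p => h (radSq p)

/-- The smearing with a second derivative of a radial function. -/
def radSmear₂ (h : ℝ → ℝ) (κ : ℝ) (i : Fin 2) (a : Fin 3) (j : Fin 2) (b : Fin 3) : H →L[ℂ] H :=
  (ρ.pairFamily μ ν).smear (radial₂ h κ i a j b)

theorem radSmear_mem_graph_opMul (hh : IsTest h) (i : Fin 2) (a : Fin 3) (j : Fin 2) (b : Fin 3)
    (ψ : H) : (ρ.radSmear μ ν h ψ, -ρ.radSmear₂ μ ν h (-(1 / 2)) i a j b ψ) ∈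
      (opMul (ρ.q a (![μ, ν] i)) (ρ.q b (![μ, ν] j))).graph := by
  refine mem_graph_opMul.2 ⟨_, ρ.smear_mem_graph_q μ ν (isTest_radial hh) j b ψ, ?_⟩
  have := (ρ.q a (![μ, ν] i)).graph.smul_mem Complex.I
    (ρ.smear_mem_graph_q μ ν ((isTest_radial hh).pairDeriv (-(1 / 2)) j b) i a ψ)
  rwa [Prod.smul_mk, smul_smul, Complex.I_mul_I, neg_one_smul] at this

/-- The smearing absorbs the outer factor first, so the derivatives appear in reverse order. -/
theorem radSmear_eq_of_mem_graph_opMul (hh : IsTest h) {i : Fin 2} {a : Fin 3} {j : Fin 2}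
    {b : Fin 3} {ψ φ : H}
    (hφ : (ψ, φ) ∈ (opMul (ρ.q a (![μ, ν] i)) (ρ.q b (![μ, ν] j))).graph) :
    ρ.radSmear μ ν h φ = -ρ.radSmear₂ μ ν h (1 / 2) j b i a ψ := by
  obtain ⟨η, h1, h2⟩ := mem_graph_opMul.1 hφ
  rw [radSmear, ρ.smear_eq_of_mem_graph_q μ ν (isTest_radial hh) h2,
    ρ.smear_eq_of_mem_graph_q μ ν ((isTest_radial hh).pairDeriv (1 / 2) i a) h1, smul_smul,
    Complex.I_mul_I, neg_one_smul]
  rfl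

/-! #### The selfadjoint part -/

theorem radSmear_mem_graph_qq (hh : IsTest h) (i j : Fin 2) (ψ : H) :
    (ρ.radSmear μ ν h ψ, -(ρ.radSmear₂ μ ν h (-(1 / 2)) i 1 j 2 ψ -
      ρ.radSmear₂ μ ν h (-(1 / 2)) i 0 j 2 ψ + ρ.radSmear₂ μ ν h (-(1 / 2)) i 0 j 1 ψ)) ∈
      (ρ.qq (![μ, ν] i) (![μ, ν] j)).graph :=
  mem_graph_add.2 ⟨_, _, mem_graph_sub.2 ⟨_, _, ρ.radSmear_mem_graph_opMul μ ν hh i 1 j 2 ψ,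
    ρ.radSmear_mem_graph_opMul μ ν hh i 0 j 2 ψ, rfl⟩,
    ρ.radSmear_mem_graph_opMul μ ν hh i 0 j 1 ψ, by abel⟩

theorem radSmear_eq_of_mem_graph_qq (hh : IsTest h) {i j : Fin 2} {ψ φ : H}
    (hφ : (ψ, φ) ∈ (ρ.qq (![μ, ν] i) (![μ, ν] j)).graph) : ρ.radSmear μ ν h φ =
      -(ρ.radSmear₂ μ ν h (1 / 2) j 2 i 1 ψ - ρ.radSmear₂ μ ν h (1 / 2) j 2 i 0 ψ +
        ρ.radSmear₂ μ ν h (1 / 2) j 1 i 0 ψ) := by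
  obtain ⟨w, z, hw, hz, rfl⟩ := mem_graph_add.1 hφ
  obtain ⟨x, y, hx, hy, rfl⟩ := mem_graph_sub.1 hw
  have e1 := ρ.radSmear_eq_of_mem_graph_opMul μ ν hh hx
  have e2 := ρ.radSmear_eq_of_mem_graph_opMul μ ν hh hy
  have e3 := ρ.radSmear_eq_of_mem_graph_opMul μ ν hh hz
  rw [map_add, map_sub, e1, e2, e3, neg_sub_neg, ← neg_sub, ← neg_add]

theorem radSmear_mem_graph_qqWedge (hh : IsTest h) (ψ : H) :
    (ρ.radSmear μ ν h ψ, (ρ.pairFamily μ ν).smear (wedgeKer h) ψ) ∈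
      (ρ.qq μ ν - ρ.qq ν μ).graph := by
  refine mem_graph_sub.2 ⟨_, _, ρ.radSmear_mem_graph_qq μ ν hh 0 1 ψ,
    ρ.radSmear_mem_graph_qq μ ν hh 1 0 ψ, ?_⟩
  have hT := isTest_radial₂ hh
  rw [wedgeKer_eq hh (κ := -(1 / 2)) (by norm_num)]
  exact (ρ.pairFamily μ ν).smear_sub_add_sub (hT _ _ _ _ _) (hT _ _ _ _ _) (hT _ _ _ _ _)
    (hT _ _ _ _ _) (hT _ _ _ _ _) (hT _ _ _ _ _) ψ

/-- Together with `radSmear_mem_graph_qqWedge` this says that radial smearings commute with the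
quadratic operator, including on vectors of the natural domain without further regularity. -/
theorem radSmear_eq_of_mem_graph_qqWedge (hh : IsTest h) {ψ φ : H}
    (hφ : (ψ, φ) ∈ (ρ.qq μ ν - ρ.qq ν μ).graph) :
    (ρ.pairFamily μ ν).smear (wedgeKer h) ψ = ρ.radSmear μ ν h φ := by
  obtain ⟨x, y, hx, hy, rfl⟩ := mem_graph_sub.1 hφ
  have hT := isTest_radial₂ hh
  rw [map_sub, ρ.radSmear_eq_of_mem_graph_qq μ ν hh (i := 0) (j := 1) hx,
    ρ.radSmear_eq_of_mem_graph_qq μ ν hh (i := 1) (j := 0) hy, wedgeKer_eq_right hh]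
  exact (ρ.pairFamily μ ν).smear_sub_add_sub (hT _ _ _ _ _) (hT _ _ _ _ _) (hT _ _ _ _ _)
    (hT _ _ _ _ _) (hT _ _ _ _ _) (hT _ _ _ _ _) ψ

/-! #### The product of differentials -/

theorem radSmear_mem_graph_dqdq (hh : IsTest h) (i j : Fin 2) (ψ : H) :
    (ρ.radSmear μ ν h ψ, -((ρ.radSmear₂ μ ν h (-(1 / 2)) i 1 j 2 ψ -
      ρ.radSmear₂ μ ν h (-(1 / 2)) i 1 j 1 ψ) - (ρ.radSmear₂ μ ν h (-(1 / 2)) i 0 j 2 ψ -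
      ρ.radSmear₂ μ ν h (-(1 / 2)) i 0 j 1 ψ))) ∈ (ρ.dqdq (![μ, ν] i) (![μ, ν] j)).graph := by
  refine mem_graph_opMul.2 ⟨_, mem_graph_sub.2 ⟨_, _,
    ρ.smear_mem_graph_q μ ν (isTest_radial hh) j 2 ψ,
    ρ.smear_mem_graph_q μ ν (isTest_radial hh) j 1 ψ, rfl⟩, ?_⟩
  have key : ∀ a, (Complex.I • (ρ.pairFamily μ ν).smear (pairDeriv (-(1 / 2)) j 2
      fun p => h (radSq p)) ψ - Complex.I • (ρ.pairFamily μ ν).smear (pairDeriv (-(1 / 2)) j 1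
      fun p => h (radSq p)) ψ, -(ρ.radSmear₂ μ ν h (-(1 / 2)) i a j 2 ψ -
        ρ.radSmear₂ μ ν h (-(1 / 2)) i a j 1 ψ)) ∈ (ρ.q a (![μ, ν] i)).graph := by
    intro a
    have h1 : ∀ b, (Complex.I • (ρ.pairFamily μ ν).smear (pairDeriv (-(1 / 2)) j b
        fun p => h (radSq p)) ψ, -ρ.radSmear₂ μ ν h (-(1 / 2)) i a j b ψ) ∈
        (ρ.q a (![μ, ν] i)).graph := by
      intro b
      have := (ρ.q a (![μ, ν] i)).graph.smul_mem Complex.I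
        (ρ.smear_mem_graph_q μ ν ((isTest_radial hh).pairDeriv (-(1 / 2)) j b) i a ψ)
      rwa [Prod.smul_mk, smul_smul, Complex.I_mul_I, neg_one_smul] at this
    have := (ρ.q a (![μ, ν] i)).graph.sub_mem (h1 2) (h1 1)
    rwa [Prod.mk_sub_mk, neg_sub_neg, ← neg_sub (ρ.radSmear₂ μ ν h _ i a j 2 ψ)] at this
  exact mem_graph_sub.2 ⟨_, _, key 1, key 0, by abel⟩

theorem radSmear_eq_of_mem_graph_dqdq (hh : IsTest h) {i j : Fin 2} {ψ φ : H}
    (hφ : (ψ, φ) ∈ (ρ.dqdq (![μ, ν] i) (![μ, ν] j)).graph) : ρ.radSmear μ ν h φ =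
      -((ρ.radSmear₂ μ ν h (1 / 2) j 2 i 1 ψ - ρ.radSmear₂ μ ν h (1 / 2) j 1 i 1 ψ) -
        (ρ.radSmear₂ μ ν h (1 / 2) j 2 i 0 ψ - ρ.radSmear₂ μ ν h (1 / 2) j 1 i 0 ψ)) := by
  obtain ⟨η, h1, h2⟩ := mem_graph_opMul.1 hφ
  obtain ⟨x, y, hx, hy, rfl⟩ := mem_graph_sub.1 h1
  obtain ⟨u, v, hu, hv, rfl⟩ := mem_graph_sub.1 h2
  have key : ∀ a, Complex.I • (ρ.pairFamily μ ν).smear (pairDeriv (1 / 2) i a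
      fun p => h (radSq p)) (x - y) = -(ρ.radSmear₂ μ ν h (1 / 2) j 2 i a ψ -
        ρ.radSmear₂ μ ν h (1 / 2) j 1 i a ψ) := by
    intro a
    have ht := (isTest_radial hh).pairDeriv (1 / 2) i a
    rw [map_sub, ρ.smear_eq_of_mem_graph_q μ ν ht hx, ρ.smear_eq_of_mem_graph_q μ ν ht hy,
      ← smul_sub, smul_smul, Complex.I_mul_I, neg_one_smul]
    rfl
  rw [radSmear, map_sub, ρ.smear_eq_of_mem_graph_q μ ν (isTest_radial hh) hu,
    ρ.smear_eq_of_mem_graph_q μ ν (isTest_radial hh) hv, key, key]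
  abel

theorem radSmear_mem_graph_dqWedge (hh : IsTest h) (ψ : H) :
    (ρ.radSmear μ ν h ψ, (ρ.pairFamily μ ν).smear (wedgeKer h) ψ +
      (ρ.pairFamily μ ν).smear (centreKer h) ψ) ∈ (ρ.dqdq μ ν - ρ.dqdq ν μ).graph := by
  refine mem_graph_sub.2 ⟨_, _, ρ.radSmear_mem_graph_dqdq μ ν hh 0 1 ψ,
    ρ.radSmear_mem_graph_dqdq μ ν hh 1 0 ψ, ?_⟩
  have hT := isTest_radial₂ hh
  rw [← (ρ.pairFamily μ ν).smear_add (isTest_wedgeKer hh) (isTest_centreKer hh),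
    wedgeKer_add_centreKer_left hh]
  exact (ρ.pairFamily μ ν).smear_sub_sub_sub (hT _ _ _ _ _) (hT _ _ _ _ _) (hT _ _ _ _ _)
    (hT _ _ _ _ _) (hT _ _ _ _ _) (hT _ _ _ _ _) (hT _ _ _ _ _) (hT _ _ _ _ _) ψ

theorem radSmear_eq_of_mem_graph_dqWedge (hh : IsTest h) {ψ φ : H}
    (hφ : (ψ, φ) ∈ (ρ.dqdq μ ν - ρ.dqdq ν μ).graph) :
    (ρ.pairFamily μ ν).smear (wedgeKer h) ψ + (ρ.pairFamily μ ν).smear (centreKer h) ψ =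
      ρ.radSmear μ ν h φ := by
  obtain ⟨x, y, hx, hy, rfl⟩ := mem_graph_sub.1 hφ
  have hT := isTest_radial₂ hh
  rw [map_sub, ρ.radSmear_eq_of_mem_graph_dqdq μ ν hh (i := 0) (j := 1) hx,
    ρ.radSmear_eq_of_mem_graph_dqdq μ ν hh (i := 1) (j := 0) hy,
    ← (ρ.pairFamily μ ν).smear_add (isTest_wedgeKer hh) (isTest_centreKer hh),
    wedgeKer_add_centreKer_right hh]
  exact (ρ.pairFamily μ ν).smear_sub_sub_sub (hT _ _ _ _ _) (hT _ _ _ _ _) (hT _ _ _ _ _)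
    (hT _ _ _ _ _) (hT _ _ _ _ _) (hT _ _ _ _ _) (hT _ _ _ _ _) (hT _ _ _ _ _) ψ

end EventRep

end QST

end

/-! ### Mollifiers from radial approximate units; the components are normal. -/

noncomputable section

namespace QST

open Filter Topology MeasureTheory
open scoped ContDiff

/-! ### Radial approximate units -/

theorem exists_isTest_nonneg {r : ℝ} (hr : 0 < r) : ∃ b : ℝ → ℝ, IsTest b ∧ (∀ x, 0 ≤ b x) ∧
    b 0 ≠ 0 ∧ ∀ x, b x ≠ 0 → |x| ≤ r := by
  let b : ContDiffBump (0 : ℝ) := ⟨r / 2, r, by linarith, by linarith⟩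
  refine ⟨b, ⟨b.contDiff, b.hasCompactSupport⟩, fun x => b.nonneg, ?_, fun x hx => ?_⟩
  · rw [b.one_of_mem_closedBall (Metric.mem_closedBall_self b.rIn_pos.le)]
    exact one_ne_zero
  · have : x ∈ Function.support b := hx
    rw [b.support_eq, mem_ball_zero_iff] at this
    exact this.le

theorem exists_radial_unit {r : ℝ} (hr : 0 < r) : ∃ h : ℝ → ℝ, IsTest h ∧ (∀ x, 0 ≤ h x) ∧
    ∫ p, h (radSq p) = 1 ∧ ∀ p, h (radSq p) ≠ 0 → ‖p‖ ≤ r := by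
  -- The radius is `r²` because the bump is evaluated at the square of the norm.
  obtain ⟨b, hb, hb0, hb1, hbr⟩ := exists_isTest_nonneg (pow_pos hr 2)
  have ht := isTest_radial hb
  have hpos : 0 < ∫ p, b (radSq p) :=
    ht.smooth.continuous.integral_pos_of_hasCompactSupport_nonneg_nonzero ht.supp
      (fun p => hb0 _) (x := 0) (by simpa [radSq] using hb1)
  refine ⟨fun x => (∫ p, b (radSq p))⁻¹ * b x,
    ⟨contDiff_const.mul hb.smooth, hb.supp.mul_left⟩,
    fun x => mul_nonneg (inv_nonneg.2 hpos.le) (hb0 x), ?_, fun p hp => ?_⟩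
  · rw [integral_const_mul, inv_mul_cancel₀ hpos.ne']
  · have h1 := hbr _ (right_ne_zero_of_mul hp)
    exact le_of_sq_le_sq ((sq_norm_le_radSq p).trans ((le_abs_self _).trans h1)) hr.le

/-- A radial approximate unit. -/
def radUnit (m : ℕ) : ℝ → ℝ := (exists_radial_unit (Nat.one_div_pos_of_nat (n := m))).choose

theorem radUnit_spec (m : ℕ) : IsTest (radUnit m) ∧ (∀ x, 0 ≤ radUnit m x) ∧
    ∫ p, radUnit m (radSq p) = 1 ∧ ∀ p, radUnit m (radSq p) ≠ 0 → ‖p‖ ≤ 1 / ((m : ℝ) + 1) :=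
  (exists_radial_unit (Nat.one_div_pos_of_nat (n := m))).choose_spec

namespace EventRep

variable {H : Type*} [NormedAddCommGroup H] [InnerProductSpace ℂ H] [CompleteSpace H]
  (ρ : EventRep 3 H) (μ ν : Fin 4)

theorem inner_pairFamily (x : PairSpace) (ψ φ : H) :
    inner ℂ ((ρ.pairFamily μ ν).U x ψ) φ = inner ℂ ψ ((ρ.pairFamily μ ν).U (-x) φ) :=
  ρ.inner_weylFamily _ _ x ψ φ

theorem inner_radSmear {h : ℝ → ℝ} (hh : IsTest h) (ψ φ : H) :
    inner ℂ (ρ.radSmear μ ν h ψ) φ = inner ℂ ψ (ρ.radSmear μ ν h φ) := by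
  have := (ρ.pairFamily μ ν).inner_smear (ρ.inner_pairFamily μ ν) (isTest_radial hh) (ε := 1)
    (fun p => by rw [radSq_neg, one_mul]) ψ φ
  rwa [Complex.ofReal_one, one_mul] at this

theorem tendsto_radSmear (ψ : H) :
    Tendsto (fun m => ρ.radSmear μ ν (radUnit m) ψ) atTop (𝓝 ψ) :=
  (ρ.pairFamily μ ν).tendsto_smear (ρ.weylFamily_zero _ _)
    (fun m => isTest_radial (radUnit_spec m).1) (fun m _ => (radUnit_spec m).2.1 _)
    (fun m => (radUnit_spec m).2.2.1) tendsto_one_div_add_atTop_nhds_zero_nat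
    (fun m => (radUnit_spec m).2.2.2) ψ

/-- The smearing with `wedgeKer`. -/
def wedgeSmear (m : ℕ) : H →L[ℂ] H := (ρ.pairFamily μ ν).smear (wedgeKer (radUnit m))

/-- The smearing with `centreKer`. -/
def centreSmear (m : ℕ) : H →L[ℂ] H := (ρ.pairFamily μ ν).smear (centreKer (radUnit m))

theorem inner_wedgeSmear (m : ℕ) (ψ φ : H) :
    inner ℂ (ρ.wedgeSmear μ ν m ψ) φ = inner ℂ ψ (ρ.wedgeSmear μ ν m φ) := by
  have := (ρ.pairFamily μ ν).inner_smear (ρ.inner_pairFamily μ ν)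
    (isTest_wedgeKer (radUnit_spec m).1) (ε := 1)
    (fun p => by rw [wedgeKer_neg, one_mul]) ψ φ
  rwa [Complex.ofReal_one, one_mul] at this

theorem inner_centreSmear (m : ℕ) (ψ φ : H) :
    inner ℂ (ρ.centreSmear μ ν m ψ) φ = -inner ℂ ψ (ρ.centreSmear μ ν m φ) := by
  have := (ρ.pairFamily μ ν).inner_smear (ρ.inner_pairFamily μ ν)
    (isTest_centreKer (radUnit_spec m).1) (ε := -1)
    (fun p => by rw [centreKer_neg, neg_one_mul]) ψ φ
  rwa [Complex.ofReal_neg, Complex.ofReal_one, neg_one_mul] at this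

theorem mollified_qq : Mollified (ρ.qq μ ν - ρ.qq ν μ) (fun m => ρ.radSmear μ ν (radUnit m))
    (ρ.wedgeSmear μ ν) (ρ.wedgeSmear μ ν) where
  symm m := ρ.inner_radSmear μ ν (radUnit_spec m).1
  adj := ρ.inner_wedgeSmear μ ν
  tendsto := ρ.tendsto_radSmear μ ν
  mem m := ρ.radSmear_mem_graph_qqWedge μ ν (radUnit_spec m).1
  comm m _ _ h := ρ.radSmear_eq_of_mem_graph_qqWedge μ ν (radUnit_spec m).1 h

/-- A second mollification of a central operator, needed because the comparison with `A` requires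
the same `T n`. The central kernel is odd, so its smearing is skew and the factor `i` makes it
symmetric. -/
theorem mollified_coordQ : Mollified (ρ.centralOp (coordQ μ ν))
    (fun m => ρ.radSmear μ ν (radUnit m)) (fun m => Complex.I • ρ.centreSmear μ ν m)
    (fun m => Complex.I • ρ.centreSmear μ ν m) where
  symm m := ρ.inner_radSmear μ ν (radUnit_spec m).1
  adj m ψ φ := by
    rw [smul_apply, smul_apply, inner_smul_left, inner_smul_right, inner_centreSmear,
      Complex.conj_I, neg_mul_neg]
  tendsto := ρ.tendsto_radSmear μ ν
  mem m ψ := by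
    have := ρ.smear_mem_graph_coordQ μ ν (isTest_radial (radUnit_spec m).1) ψ
    rwa [← centreKer_eq (radUnit_spec m).1] at this
  comm m ψ φ h := by
    have := ρ.smear_eq_of_mem_graph_coordQ μ ν (isTest_radial (radUnit_spec m).1) h
    rw [← centreKer_eq (radUnit_spec m).1] at this
    exact this.symm

theorem mollified_dqdq : Mollified (ρ.dqdq μ ν - ρ.dqdq ν μ)
    (fun m => ρ.radSmear μ ν (radUnit m)) (fun m => ρ.wedgeSmear μ ν m + ρ.centreSmear μ ν m)
    (fun m => ρ.wedgeSmear μ ν m - ρ.centreSmear μ ν m) where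
  symm m := ρ.inner_radSmear μ ν (radUnit_spec m).1
  adj m ψ φ := by
    rw [add_apply, sub_apply, inner_add_left, inner_sub_right, inner_wedgeSmear,
      inner_centreSmear, sub_eq_add_neg]
  tendsto := ρ.tendsto_radSmear μ ν
  mem m := ρ.radSmear_mem_graph_dqWedge μ ν (radUnit_spec m).1
  comm m _ _ h := ρ.radSmear_eq_of_mem_graph_dqWedge μ ν (radUnit_spec m).1 h

theorem isSelfAdjoint_qqWedge : IsSelfAdjoint (ρ.qqWedge μ ν) :=
  (ρ.mollified_qq μ ν).isSelfAdjoint_closure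

theorem commutesWith_Z_q (f : BoundedContinuousFunction Sig ℂ) (a : Fin 3) :
    CommutesWith (ρ.Z f) (ρ.q a μ) :=
  .generator fun _ ψ => (ρ.W_comm_Z_apply _ f ψ).symm

theorem commutesWith_Z_qq (f : BoundedContinuousFunction Sig ℂ) :
    CommutesWith (ρ.Z f) (ρ.qq μ ν) :=
  (((ρ.commutesWith_Z_q μ f 1).opMul (ρ.commutesWith_Z_q ν f 2)).sub
    ((ρ.commutesWith_Z_q μ f 0).opMul (ρ.commutesWith_Z_q ν f 2))).add
    ((ρ.commutesWith_Z_q μ f 0).opMul (ρ.commutesWith_Z_q ν f 1))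

theorem commutesWith_Z_dqdq (f : BoundedContinuousFunction Sig ℂ) :
    CommutesWith (ρ.Z f) (ρ.dqdq μ ν) :=
  ((ρ.commutesWith_Z_q μ f 1).sub (ρ.commutesWith_Z_q μ f 0)).opMul
    ((ρ.commutesWith_Z_q ν f 2).sub (ρ.commutesWith_Z_q ν f 1))

theorem commutesWith_Z_qqWedge (f : BoundedContinuousFunction Sig ℂ) :
    CommutesWith (ρ.Z f) (ρ.qqWedge μ ν) :=
  ((ρ.commutesWith_Z_qq μ ν f).sub (ρ.commutesWith_Z_qq ν μ f)).closure

theorem commutesWith_Z_dqWedge (f : BoundedContinuousFunction Sig ℂ) :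
    CommutesWith (ρ.Z f) (ρ.dqWedge μ ν) :=
  ((ρ.commutesWith_Z_dqdq μ ν f).sub (ρ.commutesWith_Z_dqdq ν μ f)).closure

theorem inner_qqWedge_coordQ {a a₁ a₂ b b₁ b₂ : H} (ha₁ : (a, a₁) ∈ (ρ.qqWedge μ ν).graph)
    (ha₂ : (a, a₂) ∈ (ρ.centralOp (coordQ μ ν)).graph) (hb₁ : (b, b₁) ∈ (ρ.qqWedge μ ν).graph)
    (hb₂ : (b, b₂) ∈ (ρ.centralOp (coordQ μ ν)).graph) : inner ℂ a₁ b₂ = inner ℂ a₂ b₁ := by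
  refine inner_comm_of_commutesWith (ρ.isSelfAdjoint_qqWedge μ ν) (fun t ψ φ => ?_)
    (fun t => ρ.commutesWith_Z_qqWedge μ ν _) ha₁ ha₂ hb₁ hb₂
  rw [inner_Z_left, star_expI, neg_smul, neg_neg]

/-- The natural domains of the two quadratic expressions need not agree; their closures are compared
through the common mollifier, where `K = K_A - i K_Q` because `K_Q` is `i` times the central
smearing. -/
theorem dqWedge_eq_and_isNormalOp :
    ρ.dqWedge μ ν = ρ.qqWedge μ ν - Complex.I • ρ.centralOp (coordQ μ ν) ∧
      IsNormalOp (ρ.dqWedge μ ν) := by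
  refine closure_eq_sub_and_isNormalOp (ρ.mollified_qq μ ν) (ρ.mollified_coordQ μ ν)
    (ρ.isClosed_centralOp _) (ρ.mollified_dqdq μ ν) (fun n ψ => ?_) (fun n ψ => ?_)
    fun a a₁ a₂ b b₁ b₂ => ρ.inner_qqWedge_coordQ μ ν
  · rw [add_apply, smul_apply, smul_smul, neg_mul, Complex.I_mul_I, neg_neg, one_smul]
  · rw [sub_apply, smul_apply, smul_smul, Complex.I_mul_I, neg_one_smul, sub_eq_add_neg]

/-- Pythagoras for `A - i Q`; this is how the lower bounds enter the estimates of the area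
operators. -/
theorem exists_coordQ_norm_le {ψ φ : H} (h : (ψ, φ) ∈ (ρ.dqWedge μ ν).graph) :
    ∃ χ, (ψ, χ) ∈ (ρ.centralOp (coordQ μ ν)).graph ∧ ‖χ‖ ≤ ‖φ‖ := by
  rw [(ρ.dqWedge_eq_and_isNormalOp μ ν).1] at h
  obtain ⟨a, _, ha, hq', rfl⟩ := mem_graph_sub.1 h
  obtain ⟨q, hq, rfl⟩ := mem_graph_smul.1 hq'
  refine ⟨q, hq, le_of_sq_le_sq ?_ (norm_nonneg _)⟩
  rw [sub_eq_add_neg, ← neg_smul, norm_sq_add_smul (Or.inr rfl)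
    (ρ.inner_qqWedge_coordQ μ ν ha hq ha hq)]
  exact le_add_of_nonneg_left (sq_nonneg _)

end EventRep

end QST

end

/-! ### A common dense domain of all components, from smearing in all directions. -/

noncomputable section

namespace QST

open Filter Topology MeasureTheory
open scoped ContDiff

/-! ### The Heisenberg group of all directions -/

/-- The parameters of the Weyl operators of three events. -/
abbrev FullVec : Type := Fin 3 → Fin 4 → ℝ

/-- The parameters of the centre. -/
abbrev FullCentre : Type := Fin 4 → Fin 4 → ℝ

/-- The central parameter `∑ θ_{μν} Q^{μν}`. -/
def fullCentre : FullCentre →L[ℝ] C(Sig, ℝ) :=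
  ∑ μ, ∑ ν, (ContinuousLinearMap.toSpanSingleton ℝ (coordQ μ ν)).comp
    ((ContinuousLinearMap.proj (R := ℝ) (φ := fun _ : Fin 4 => ℝ) ν).comp
      (ContinuousLinearMap.proj (R := ℝ) (φ := fun _ : Fin 4 => Fin 4 → ℝ) μ))

theorem fullCentre_apply (θ : FullCentre) (σ : Sig) :
    fullCentre θ σ = ∑ μ, ∑ ν, θ μ ν * σ.1 μ ν := by
  simp [fullCentre, coordQ]

/-- The antisymmetric form `(u, v) ↦ (1/2) ∑_a (u_{aμ} v_{aν} - u_{aν} v_{aμ})`. -/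
def fullForm : FullVec →L[ℝ] FullVec →L[ℝ] FullCentre :=
  (LinearMap.mk₂ ℝ (fun (u v : FullVec) μ ν => 1 / 2 * ∑ a, (u a μ * v a ν - u a ν * v a μ))
    (fun u u' v => by
      ext μ ν
      simp only [Pi.add_apply]
      rw [← mul_add, ← Finset.sum_add_distrib]
      congr 1
      exact Finset.sum_congr rfl fun a _ => by ring)
    (fun r u v => by
      ext μ ν
      simp only [Pi.smul_apply, smul_eq_mul]
      rw [mul_left_comm, Finset.mul_sum _ _ r]
      congr 1
      exact Finset.sum_congr rfl fun a _ => by ring)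
    (fun u v v' => by
      ext μ ν
      simp only [Pi.add_apply]
      rw [← mul_add, ← Finset.sum_add_distrib]
      congr 1
      exact Finset.sum_congr rfl fun a _ => by ring)
    (fun r u v => by
      ext μ ν
      simp only [Pi.smul_apply, smul_eq_mul]
      rw [mul_left_comm, Finset.mul_sum _ _ r]
      congr 1
      exact Finset.sum_congr rfl fun a _ => by ring)).toContinuousBilinearMap

theorem fullForm_apply (u v : FullVec) (μ ν : Fin 4) :
    fullForm u v μ ν = 1 / 2 * ∑ a, (u a μ * v a ν - u a ν * v a μ) := rfl

theorem fullForm_self (u : FullVec) : fullForm u u = 0 := by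
  ext μ ν
  rw [fullForm_apply, Finset.sum_eq_zero fun a _ => by ring, mul_zero]
  rfl

/-- Antisymmetrizing is harmless because `Q` is antisymmetric, and it makes the form alternating
before evaluation at `Q`, as the linear flow requires. -/
theorem sympl_eq_fullCentre (u v : FullVec) : sympl u v = fullCentre (fullForm u v) := by
  ext σ
  rw [sympl_apply, fullCentre_apply]
  simp_rw [fullForm_apply, mul_assoc, Finset.sum_mul, Finset.mul_sum]
  simp_rw [sub_mul, mul_sub, Finset.sum_sub_distrib]
  have h1 : ∀ F : Fin 3 → Fin 4 → Fin 4 → ℝ, ∑ μ, ∑ ν, ∑ a, F a μ ν = ∑ a, ∑ μ, ∑ ν, F a μ ν := by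
    intro F
    rw [Finset.sum_comm' (t' := Finset.univ) (s' := fun _ => Finset.univ) (by simp)]
    rw [Finset.sum_congr rfl fun ν _ => Finset.sum_comm, Finset.sum_comm]
    exact Finset.sum_congr rfl fun a _ => Finset.sum_comm
  rw [h1, h1, ← Finset.sum_sub_distrib]
  refine Finset.sum_congr rfl fun a _ => ?_
  have h2 : ∑ μ, ∑ ν, 1 / 2 * (u a ν * v a μ * σ.1 μ ν) =
      -∑ μ, ∑ ν, 1 / 2 * (u a μ * v a ν * σ.1 μ ν) := by
    rw [Finset.sum_comm, ← Finset.sum_neg_distrib]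
    refine Finset.sum_congr rfl fun μ _ => ?_
    rw [← Finset.sum_neg_distrib]
    refine Finset.sum_congr rfl fun ν _ => ?_
    rw [sig_antisymm σ ν μ]
    ring
  rw [h2, sub_neg_eq_add, ← Finset.sum_add_distrib]
  refine Finset.sum_congr rfl fun μ _ => ?_
  rw [← Finset.sum_add_distrib]
  exact Finset.sum_congr rfl fun ν _ => by ring

instance isOpenPosMeasure_volume_full : (volume : Measure (FullVec × FullCentre)).IsOpenPosMeasure
    :=
  Measure.prod.instIsOpenPosMeasure (μ := (volume : Measure FullVec))
    (ν := (volume : Measure FullCentre))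

theorem exists_isTest_unit {V : Type*} [NormedAddCommGroup V] [NormedSpace ℝ V]
    [FiniteDimensional ℝ V] [MeasureSpace V] [BorelSpace V]
    [IsFiniteMeasureOnCompacts (volume : Measure V)] [(volume : Measure V).IsOpenPosMeasure]
    {r : ℝ} (hr : 0 < r) : ∃ f : V → ℝ, IsTest f ∧ (∀ x, 0 ≤ f x) ∧ ∫ x, f x = 1 ∧
      ∀ x, f x ≠ 0 → ‖x‖ ≤ r := by
  let b : ContDiffBump (0 : V) := ⟨r / 2, r, by linarith, by linarith⟩
  refine ⟨b.normed volume, ⟨b.contDiff_normed, b.hasCompactSupport_normed⟩,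
    fun x => b.nonneg_normed x, b.integral_normed, fun x hx => ?_⟩
  have : x ∈ Function.support (b.normed volume) := hx
  rw [b.support_normed_eq, mem_ball_zero_iff] at this
  exact this.le

namespace EventRep

variable {H : Type*} [NormedAddCommGroup H] [InnerProductSpace ℂ H] [CompleteSpace H]
  (ρ : EventRep 3 H)

/-- All Weyl operators, with the centre. -/
def fullFamily : ContractionFamily (FullVec × FullCentre) H :=
  ρ.weylFamily (.id ℝ FullVec) fullCentre

theorem exists_isTest_mem_graph_q {f : FullVec × FullCentre → ℝ} (hf : IsTest f) (a : Fin 3)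
    (μ : Fin 4) : ∃ g, IsTest g ∧ ∀ ψ : H,
      (ρ.fullFamily.smear f ψ, Complex.I • ρ.fullFamily.smear g ψ) ∈ (ρ.q a μ).graph := by
  have hX := isLinearFlow_shear (B := FullCentre) (Pi.single a (Pi.single μ 1) : FullVec)
    ((-(1 / 2) : ℝ) • fullForm (Pi.single a (Pi.single μ 1)))
    (by rw [smul_apply, fullForm_self, smul_zero])
  exact ⟨_, hf.lieDeriv hX.smooth, fun ψ => ρ.fullFamily.smear_mem_graph_generator hX
    (fun t x φ => ρ.W_weylFamily (j := .id ℝ FullVec) sympl_eq_fullCentre _ t x φ) hf ψ⟩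

/-- Each coordinate sends a smearing to another smearing with a test kernel, so products of
coordinates can be applied; no radial symmetry is needed for membership in the domain. -/
theorem smear_mem_domain_dqdq {f : FullVec × FullCentre → ℝ} (hf : IsTest f) (μ ν : Fin 4)
    (ψ : H) : ρ.fullFamily.smear f ψ ∈ (ρ.dqdq μ ν).domain := by
  obtain ⟨g₁, ht₁, hg₁⟩ := ρ.exists_isTest_mem_graph_q hf 2 ν
  obtain ⟨g₂, ht₂, hg₂⟩ := ρ.exists_isTest_mem_graph_q hf 1 ν
  have key : ∀ a, ∃ φ, (Complex.I • ρ.fullFamily.smear g₁ ψ - Complex.I • ρ.fullFamily.smear g₂ ψ,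
      φ) ∈ (ρ.q a μ).graph := by
    intro a
    obtain ⟨k₁, -, hk₁⟩ := ρ.exists_isTest_mem_graph_q ht₁ a μ
    obtain ⟨k₂, -, hk₂⟩ := ρ.exists_isTest_mem_graph_q ht₂ a μ
    exact ⟨_, (ρ.q a μ).graph.sub_mem ((ρ.q a μ).graph.smul_mem Complex.I (hk₁ ψ))
      ((ρ.q a μ).graph.smul_mem Complex.I (hk₂ ψ))⟩
  obtain ⟨φ₁, h₁⟩ := key 1
  obtain ⟨φ₀, h₀⟩ := key 0
  exact LinearPMap.mem_domain_of_mem_graph (mem_graph_opMul.2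
    ⟨_, mem_graph_sub.2 ⟨_, _, hg₁ ψ, hg₂ ψ, rfl⟩, mem_graph_sub.2 ⟨_, _, h₁, h₀, rfl⟩⟩)

/-- The components of the area have a common dense domain. -/
theorem dense_domain_dqWedge {ι : Type*} (μ ν : ι → Fin 4) :
    Dense {ψ : H | ∀ l, ψ ∈ (ρ.dqWedge (μ l) (ν l)).domain} := by
  choose f hf hpos hunit hsupp using fun m : ℕ =>
    exists_isTest_unit (V := FullVec × FullCentre) (Nat.one_div_pos_of_nat (α := ℝ) (n := m))
  intro ψ
  refine mem_closure_of_tendsto (ρ.fullFamily.tendsto_smear (ρ.weylFamily_zero _ _) hf hpos hunit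
    tendsto_one_div_add_atTop_nhds_zero_nat hsupp ψ) (Eventually.of_forall fun m l => ?_)
  exact (LinearPMap.le_closure _).1
    ⟨ρ.smear_mem_domain_dqdq (hf m) _ _ ψ, ρ.smear_mem_domain_dqdq (hf m) _ _ ψ⟩

end EventRep

end QST

end

/-! ### The quantum conditions and the final bounds. -/

noncomputable section

namespace QST

open Filter Topology

/-! ### The quantum conditions -/

theorem coordQ_succ_zero (j : Fin 3) : coordQ j.succ 0 = -elecFun j := by
  ext σ
  exact sig_antisymm σ j.succ 0

theorem elec_dot_sq (σ : Sig) : (∑ j, elec σ.1 j * magn σ.1 j) ^ 2 = 1 := by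
  rcases σ.2.2.2 with h | h <;> rw [h] <;> norm_num

/-- Cauchy-Schwarz: `1 = (e·m)² ≤ e² m² = (m²)²`. -/
theorem one_le_sum_magn_sq (σ : Sig) : 1 ≤ ∑ j, magn σ.1 j ^ 2 := by
  have h := Finset.sum_mul_sq_le_sq_mul_sq Finset.univ (elec σ.1) (magn σ.1)
  rw [elec_dot_sq, σ.2.2.1] at h
  have h0 : 0 ≤ ∑ j, magn σ.1 j ^ 2 := Finset.sum_nonneg fun j _ => sq_nonneg _
  nlinarith

theorem one_le_magnFun (σ : Sig) : 1 ≤ (∑ l, magnFun l ^ 2) σ := by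
  rw [EventRep.sumSq_apply, ← Fin.sum_univ_three fun l => magnFun l σ ^ 2]
  exact one_le_sum_magn_sq σ

theorem one_le_elecFun (σ : Sig) : 1 ≤ (∑ j, elecFun j ^ 2) σ := by
  rw [EventRep.sumSq_apply, ← Fin.sum_univ_three fun j => elecFun j σ ^ 2]
  exact (one_le_sum_magn_sq σ).trans σ.2.2.1.ge

theorem sum_coordQ_succ_zero_sq : ∑ j : Fin 3, coordQ j.succ 0 ^ 2 = ∑ j, elecFun j ^ 2 := by
  simp_rw [coordQ_succ_zero, neg_sq]

namespace EventRep

variable {H : Type*} [NormedAddCommGroup H] [InnerProductSpace ℂ H] [CompleteSpace H]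

theorem mem_graph_centralOp_neg {n : ℕ} (ρ : EventRep n H) {g : C(Sig, ℝ)} {ψ φ : H}
    (h : (ψ, φ) ∈ (ρ.centralOp g).graph) : (ψ, -φ) ∈ (ρ.centralOp (-g)).graph := by
  have h0 := mem_graph_generator.1 h
  refine mem_graph_generator.2 ?_
  have h1 : HasDerivAt (fun t : ℝ => ρ.Z (expI (t • g)) ψ) (Complex.I • φ) (-0 : ℝ) := by
    simpa using h0
  have h2 := h1.scomp (0 : ℝ) (hasDerivAt_neg (0 : ℝ))
  simpa [Function.comp_def] using h2

variable (ρ : EventRep 3 H)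

theorem sub_smul_centralOp_neg (A : H →ₗ.[ℂ] H) (g : C(Sig, ℝ)) :
    A - Complex.I • ρ.centralOp (-g) = A + Complex.I • ρ.centralOp g := by
  apply LinearPMap.eq_of_eq_graph
  ext ⟨ψ, φ⟩
  rw [mem_graph_sub, mem_graph_add]
  constructor
  · rintro ⟨a, _, ha, hq', rfl⟩
    obtain ⟨q, hq, rfl⟩ := mem_graph_smul.1 hq'
    have := ρ.mem_graph_centralOp_neg hq
    rw [neg_neg] at this
    exact ⟨a, _, ha, mem_graph_smul.2 ⟨_, this, rfl⟩, by rw [smul_neg, sub_eq_add_neg]⟩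
  · rintro ⟨a, _, ha, hq', rfl⟩
    obtain ⟨q, hq, rfl⟩ := mem_graph_smul.1 hq'
    exact ⟨a, _, ha, mem_graph_smul.2 ⟨_, ρ.mem_graph_centralOp_neg hq, rfl⟩,
      by rw [smul_neg, sub_neg_eq_add]⟩

/-- The sign differs from the space-space case because `Q^{j0} = -e_j`. -/
theorem timeArea_eq (j : Fin 3) : ρ.timeArea j = ρ.timeAreaRe j + Complex.I • ρ.e j := by
  rw [timeArea, (ρ.dqWedge_eq_and_isNormalOp j.succ 0).1, coordQ_succ_zero,
    sub_smul_centralOp_neg]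
  rfl

/-- The bounds of the area operators with components `dq^μ ∧ dq^ν`. -/
theorem dqWedge_bounds (μ ν : Fin 3 → Fin 4) (h1 : ∀ σ, 1 ≤ (∑ l, coordQ (μ l) (ν l) ^ 2) σ) :
    OpLE (ρ.centralOp (∑ l, coordQ (μ l) (ν l) ^ 2))
      (sumSqModuli fun l => ρ.dqWedge (μ l) (ν l)) ∧
    OpLE opOne (ρ.centralOp (∑ l, coordQ (μ l) (ν l) ^ 2)) ∧
    (∃! S : H →ₗ.[ℂ] H, IsSqrtSumSqModuli (fun l => ρ.dqWedge (μ l) (ν l)) S) ∧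
    (∀ S : H →ₗ.[ℂ] H, IsSqrtSumSqModuli (fun l => ρ.dqWedge (μ l) (ν l)) S →
      (sumSqModuli fun l => ρ.dqWedge (μ l) (ν l)) ≤ opMul S S ∧
      OpLE (ρ.centralOp (∑ l, coordQ (μ l) (ν l) ^ 2)) (opMul S S) ∧ OpLE opOne S) :=
  ρ.area_bounds h1 (fun _ _ _ => ρ.exists_coordQ_norm_le _ _)
    (fun f _ => ρ.commutesWith_Z_dqWedge _ _ f)
    (fun _ => (ρ.dqWedge_eq_and_isNormalOp _ _).2.closed)
    (fun _ => (ρ.dqWedge_eq_and_isNormalOp _ _).2.dense) (ρ.dense_domain_dqWedge μ ν)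

end EventRep

end QST

end

theorem mainTheorem4 {H : Type*} [NormedAddCommGroup H] [InnerProductSpace ℂ H] [CompleteSpace H]
    (ρ : QST.EventRep 3 H) :
    -- the components are normal and differ from selfadjoint operators by central terms
    (∀ l : Fin 3, IsSelfAdjoint (ρ.spaceAreaRe l) ∧ IsSelfAdjoint (ρ.m l) ∧
      ρ.spaceArea l = ρ.spaceAreaRe l - Complex.I • ρ.m l ∧ QST.IsNormalOp (ρ.spaceArea l)) ∧
    (∀ j : Fin 3, IsSelfAdjoint (ρ.timeAreaRe j) ∧ IsSelfAdjoint (ρ.e j) ∧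
      ρ.timeArea j = ρ.timeAreaRe j + Complex.I • ρ.e j ∧ QST.IsNormalOp (ρ.timeArea j)) ∧
    -- the sums of the square moduli are bounded below by `m²`, `e²`, and these by the unit
    QST.OpLE ρ.mSq (QST.sumSqModuli ρ.spaceArea) ∧
    QST.OpLE ρ.eSq (QST.sumSqModuli ρ.timeArea) ∧
    QST.OpLE QST.opOne ρ.mSq ∧
    QST.OpLE QST.opOne ρ.eSq ∧
    -- the area operators, the square roots of these sums, exist and are bounded below by `1`
    (∃! S : H →ₗ.[ℂ] H, QST.IsSqrtSumSqModuli ρ.spaceArea S) ∧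
    (∃! S : H →ₗ.[ℂ] H, QST.IsSqrtSumSqModuli ρ.timeArea S) ∧
    (∀ S : H →ₗ.[ℂ] H, QST.IsSqrtSumSqModuli ρ.spaceArea S →
      QST.sumSqModuli ρ.spaceArea ≤ QST.opMul S S ∧ QST.OpLE ρ.mSq (QST.opMul S S) ∧
      QST.OpLE QST.opOne S) ∧
    (∀ S : H →ₗ.[ℂ] H, QST.IsSqrtSumSqModuli ρ.timeArea S →
      QST.sumSqModuli ρ.timeArea ≤ QST.opMul S S ∧ QST.OpLE ρ.eSq (QST.opMul S S) ∧
      QST.OpLE QST.opOne S) := by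
  obtain ⟨hm, h1, hS, hSm⟩ := ρ.dqWedge_bounds (fun l => (l + 1).succ) (fun l => (l + 2).succ)
    QST.one_le_magnFun
  have ht := ρ.dqWedge_bounds (fun j => j.succ) (fun _ => 0)
    (by rw [QST.sum_coordQ_succ_zero_sq]; exact QST.one_le_elecFun)
  rw [QST.sum_coordQ_succ_zero_sq] at ht
  obtain ⟨he, h1', hS', hSe⟩ := ht
  exact ⟨fun l => ⟨ρ.isSelfAdjoint_qqWedge _ _, ρ.isSelfAdjoint_centralOp _,
      (ρ.dqWedge_eq_and_isNormalOp _ _).1, (ρ.dqWedge_eq_and_isNormalOp _ _).2⟩,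
    fun j => ⟨ρ.isSelfAdjoint_qqWedge _ _, ρ.isSelfAdjoint_centralOp _, ρ.timeArea_eq j,
      (ρ.dqWedge_eq_and_isNormalOp _ _).2⟩,
    hm, he, h1, h1', hS, hS', hSm, hSe⟩
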